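/- **Theorem 3.8.** Let $M$ be a smooth manifold of dimension $2n+1$. On $TM\oplus T^*M$ consider the pairing $\langle X+\xi,Y+\beta\rangle=\tfrac12(\xi(Y)+\beta(X))$ and the Courant bracket $$[X+\xi,Y+\beta]=[X,Y]+\mathcal L_X\beta-\mathcal L_Y\xi-\tfrac12 d(i_X\beta-i_Y\xi),$$ both extended complex-bilinearly to $(TM\oplus T^*M)\otimes\mathbb C$. Let $(\Phi,E_\pm)$ be a generalized almost contact structure on $M$, i.e. $\Phi\in\mathrm{End}(TM\oplus T^*M)$ and $E_\pm=X_\pm+\eta_\pm\in C^\infty(TM\oplus T^*M)$ with $\Phi+\Phi^*=0$, $\langle E_+,E_-\rangle=\tfrac12$, $\langle E_\pm,E_\pm\rangle=0$ and $\Phi^2 e=-e+2(\langle E_-,e\rangle E_++\langle E_+,e\rangle E_-)$. Put $$E^{(1,0)}=\{e-i\Phi(e)\mid e\in TM\oplus T^*M,\ \langle e,E_\pm\rangle=0\},\qquad L_\pm=\mathbb C E_\pm\oplus E^{(1,0)},\qquad R=X_++X_-,$$ let $\mathcal R$ be the foliation spanned by the nowhere vanishing vector field $R$, $T\mathcal R=\langle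 R\rangle$, $\mathrm{ann}(R)=\{\beta\in T^*M\mid\beta(R)=0\}$, and $$\mathbb T_{\mathcal R}M=TM/T\mathcal R\oplus\mathrm{ann}(R)=(TM\oplus\mathrm{ann}(R))/T\mathcal R,\qquad H_\pm=L_\pm\cap(TM\oplus\mathrm{ann}(R))\otimes\mathbb C .$$ A smooth section $s$ of $TM\oplus\mathrm{ann}(R)$ is called $R$-invariant if $[C^\infty(T\mathcal R),s]\subseteq C^\infty(T\mathcal R)$ (similarly over $\mathbb C$); the $R$-invariant (or basic) sections of $\mathbb T_{\mathcal R}M$ and of $\mathbb T_{\mathcal R}M\otimes\mathbb C$ are the classes of $R$-invariant sections. A smooth function $f$ is basic if $R f=0$. Let $\bullet\in\{+,-\}$ and suppose that $L_\bullet$ is Courant involutive, i.e. $C^\infty(L_\bullet)$ is closed under the Courant bracket. Then: 1. $M$ carries the transverse Courant algebroid $\mathbb T_{\mathcal R}M$: it is a smooth vector bundle of rank $4n$; the pairing of $TM\oplus T^*M$ induces a symmetric nondegenerate pairing on it, the projection to $TM$ induces an anchor $\mathbb T_{\mathcal R}M\to TM/T\mathcal R$, and the Courant bracket of $R$-invariant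 sections of $TM\oplus\mathrm{ann}(R)$ is again $R$-invariant and induces a well-defined bracket on the basic sections of $\mathbb T_{\mathcal R}M$; with these data the axioms of a Courant algebroid (skew-symmetry, Jacobi identity up to the differential of $\tfrac13(\langle[\sigma,\tau],\upsilon\rangle+\text{cyclic})$, compatibility of bracket and anchor, Leibniz rule, vanishing of the anchor on differentials, invariance of the pairing) hold for basic sections and basic functions. 2. At every point, $(H_\bullet+T\mathcal R\otimes\mathbb C)/T\mathcal R\otimes\mathbb C$ has complex dimension $2n$. 3. Suppose that every point of $M$ has a neighbourhood on which $R$ lies in $L_\bullet$ either at every point or at no point. (For connected $M$: $R$ lies in $L_\bullet$ everywhere or nowhere.) Then $(H_\bullet+T\mathcal R\otimes\mathbb C)/T\mathcal R\otimes\mathbb C$ is a transverse Dirac structure: it is a smooth complex subbundle of $\mathbb T_{\mathcal R}M\otimes\mathbb C$ of rank $2n$, isotropic for the induced pairing, and its $R$-invariant sections are closed under the Courant bracket. -/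

import Mathlib

open Set Filter Topology Bundle VectorField
open scoped Manifold ContDiff TensorProduct

noncomputable section

namespace GenContact

variable {n : ℕ} {M : Type*} [TopologicalSpace M]
  [ChartedSpace (EuclideanSpace ℝ (Fin (2 * n + 1))) M]

/-! ## The bundle `TM ⊕ T*M` and the Courant bracket

All manifolds have dimension `2 n + 1`, and are modelled on
`EuclideanSpace ℝ (Fin (2 * n + 1))` (no boundary). -/

/-- The cotangent space at `x`. -/
abbrev Cotangent (n : ℕ) {M : Type*} [TopologicalSpace M]
    [ChartedSpace (EuclideanSpace ℝ (Fin (2 * n + 1))) M] (x : M) : Type :=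
  TangentSpace (𝓡 (2 * n + 1)) x →L[ℝ] ℝ

/-- The fibre of `TM ⊕ T*M` at `x`; the pair `(X, ξ)` is written `X + ξ` on paper. -/
abbrev GT (n : ℕ) {M : Type*} [TopologicalSpace M]
    [ChartedSpace (EuclideanSpace ℝ (Fin (2 * n + 1))) M] (x : M) : Type :=
  TangentSpace (𝓡 (2 * n + 1)) x × Cotangent n x

/-- The fibre of the complexification `(TM ⊕ T*M) ⊗ ℂ` at `x`. -/
abbrev GTC (n : ℕ) {M : Type*} [TopologicalSpace M]
    [ChartedSpace (EuclideanSpace ℝ (Fin (2 * n + 1))) M] (x : M) : Type :=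
  ℂ ⊗[ℝ] GT n x

/-- Smoothness of a vector field. -/
def SmoothVF [IsManifold (𝓡 (2 * n + 1)) ∞ M] (X : ∀ x : M, TangentSpace (𝓡 (2 * n + 1)) x) : Prop :=
  ContMDiff (𝓡 (2 * n + 1)) (𝓡 (2 * n + 1)).tangent ∞
    (fun x => (⟨x, X x⟩ : TangentBundle (𝓡 (2 * n + 1)) M))

/-- Smoothness of a one-form, as a section of the bundle of continuous linear maps. -/
def SmoothForm [IsManifold (𝓡 (2 * n + 1)) ∞ M] (ξ : ∀ x : M, Cotangent n x) : Prop :=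
  ContMDiff (𝓡 (2 * n + 1))
    ((𝓡 (2 * n + 1)).prod 𝓘(ℝ, EuclideanSpace ℝ (Fin (2 * n + 1)) →L[ℝ] ℝ)) ∞
    (fun x => TotalSpace.mk' (EuclideanSpace ℝ (Fin (2 * n + 1)) →L[ℝ] ℝ)
      (E := fun x : M => TangentSpace (𝓡 (2 * n + 1)) x →L[ℝ] ℝ) x (ξ x))

/-- Smoothness of a section of `TM ⊕ T*M`. -/
def Smooth [IsManifold (𝓡 (2 * n + 1)) ∞ M] (s : ∀ x : M, GT n x) : Prop :=
  SmoothVF (fun x => (s x).1) ∧ SmoothForm (fun x => (s x).2)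

/-- Smoothness of a real function. -/
def SmoothFun (n : ℕ) {M : Type*} [TopologicalSpace M]
    [ChartedSpace (EuclideanSpace ℝ (Fin (2 * n + 1))) M] (f : M → ℝ) : Prop :=
  ContMDiff (𝓡 (2 * n + 1)) 𝓘(ℝ, ℝ) ∞ f

/-- The differential `df` of a function, as a one-form. -/
def dFun (n : ℕ) {M : Type*} [TopologicalSpace M]
    [ChartedSpace (EuclideanSpace ℝ (Fin (2 * n + 1))) M] (f : M → ℝ) (x : M) : Cotangent n x :=
  mfderiv (𝓡 (2 * n + 1)) 𝓘(ℝ, ℝ) f x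

/-- The coordinate expression of the one-form `β` in the preferred chart at `x`: its pullback
under the inverse of that chart. -/
def chartForm (β : ∀ x : M, Cotangent n x) (x : M) (p : EuclideanSpace ℝ (Fin (2 * n + 1))) :
    EuclideanSpace ℝ (Fin (2 * n + 1)) →L[ℝ] ℝ :=
  (β ((extChartAt (𝓡 (2 * n + 1)) x).symm p)).comp
    (mfderiv 𝓘(ℝ, EuclideanSpace ℝ (Fin (2 * n + 1))) (𝓡 (2 * n + 1))
      (extChartAt (𝓡 (2 * n + 1)) x).symm p)

/-- The exterior derivative of a one-form, `(dβ)_x (u, v) = ∑ (∂ᵢ βⱼ - ∂ⱼ βᵢ) uⁱ vʲ`, computed in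
the preferred chart at `x`. -/
def dForm (β : ∀ x : M, Cotangent n x) (x : M) :
    TangentSpace (𝓡 (2 * n + 1)) x →L[ℝ] TangentSpace (𝓡 (2 * n + 1)) x →L[ℝ] ℝ :=
  let A : EuclideanSpace ℝ (Fin (2 * n + 1)) →L[ℝ]
      EuclideanSpace ℝ (Fin (2 * n + 1)) →L[ℝ] ℝ :=
    fderiv ℝ (chartForm β x) (extChartAt (𝓡 (2 * n + 1)) x x)
  let φ' : EuclideanSpace ℝ (Fin (2 * n + 1)) →L[ℝ] EuclideanSpace ℝ (Fin (2 * n + 1)) :=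
    mfderiv (𝓡 (2 * n + 1)) 𝓘(ℝ, EuclideanSpace ℝ (Fin (2 * n + 1)))
      (extChartAt (𝓡 (2 * n + 1)) x) x
  let B : EuclideanSpace ℝ (Fin (2 * n + 1)) →L[ℝ]
      EuclideanSpace ℝ (Fin (2 * n + 1)) →L[ℝ] ℝ := (A - A.flip).bilinearComp φ' φ'
  B

/-- The Lie derivative of a one-form along a vector field, `𝓛_X β = i_X dβ + d (i_X β)`. -/
def lieForm (X : ∀ x : M, TangentSpace (𝓡 (2 * n + 1)) x) (β : ∀ x : M, Cotangent n x) (x : M) :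
    Cotangent n x :=
  dForm β x (X x) + dFun n (fun y => β y (X y)) x

/-- The (skew-symmetric, untwisted) Courant bracket
`[X + ξ, Y + β] = [X, Y] + 𝓛_X β - 𝓛_Y ξ - ½ d (i_X β - i_Y ξ)`. -/
def courant (s t : ∀ x : M, GT n x) (x : M) : GT n x :=
  (mlieBracket (𝓡 (2 * n + 1)) (fun y => (s y).1) (fun y => (t y).1) x,
    lieForm (fun y => (s y).1) (fun y => (t y).2) x
      - lieForm (fun y => (t y).1) (fun y => (s y).2) x
      - (1 / 2 : ℝ) • dFun n (fun y => (t y).2 (s y).1 - (s y).2 (t y).1) x)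

/-- The natural pairing `⟨X + ξ, Y + β⟩ = ½ (ξ(Y) + β(X))`. -/
def pairing (x : M) : LinearMap.BilinForm ℝ (GT n x) :=
  LinearMap.mk₂ ℝ (fun a b => (1 / 2 : ℝ) * (a.2 b.1 + b.2 a.1))
    (by intro a a' b; simp; ring) (by intro c a b; simp; ring)
    (by intro a b b'; simp; ring) (by intro c a b; simp; ring)

/-- The complex bilinear extension of the pairing. -/
def pairingC (x : M) : LinearMap.BilinForm ℂ (GTC n x) :=
  LinearMap.BilinForm.baseChange ℂ (pairing x)

/-- The inclusion of the real vectors. -/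
def toC (x : M) (a : GT n x) : GTC n x := (1 : ℂ) ⊗ₜ[ℝ] a

/-- Real part: `re (1 ⊗ a + i ⊗ b) = a`. -/
def re (x : M) : GTC n x →ₗ[ℝ] GT n x :=
  (TensorProduct.lid ℝ (GT n x)).toLinearMap ∘ₗ LinearMap.rTensor (GT n x) Complex.reLm

/-- Imaginary part: `im (1 ⊗ a + i ⊗ b) = b`. -/
def im (x : M) : GTC n x →ₗ[ℝ] GT n x :=
  (TensorProduct.lid ℝ (GT n x)).toLinearMap ∘ₗ LinearMap.rTensor (GT n x) Complex.imLm

/-- Smoothness of a section of `(TM ⊕ T*M) ⊗ ℂ`. -/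
def SmoothC [IsManifold (𝓡 (2 * n + 1)) ∞ M] (s : ∀ x : M, GTC n x) : Prop :=
  Smooth (fun x => re x (s x)) ∧ Smooth (fun x => im x (s x))

/-- The complex bilinear extension of the Courant bracket. -/
def courantC (s t : ∀ x : M, GTC n x) (x : M) : GTC n x :=
  toC x (courant (fun y => re y (s y)) (fun y => re y (t y)) x
      - courant (fun y => im y (s y)) (fun y => im y (t y)) x)
    + Complex.I • toC x (courant (fun y => re y (s y)) (fun y => im y (t y)) x
      + courant (fun y => im y (s y)) (fun y => re y (t y)) x)

/-- A family of complex subspaces of `(TM ⊕ T*M) ⊗ ℂ` is Courant involutive if its smooth sections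
are closed under the Courant bracket. -/
def CourantInvolutive [IsManifold (𝓡 (2 * n + 1)) ∞ M]
    (L : ∀ x : M, Submodule ℂ (GTC n x)) : Prop :=
  ∀ s t : ∀ x : M, GTC n x, SmoothC s → SmoothC t → (∀ x, s x ∈ L x) → (∀ x, t x ∈ L x) →
    ∀ x, courantC s t x ∈ L x

/-! ## Generalized almost contact structures -/

/-- The two signs `+`, `-`. -/
inductive Sgn
  | plus
  | minus

/-- A generalized almost contact structure `(Φ, E₊, E₋)` on a manifold of dimension `2 n + 1`. -/
structure GenAlmostContact (n : ℕ) (M : Type*) [TopologicalSpace M]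
    [ChartedSpace (EuclideanSpace ℝ (Fin (2 * n + 1))) M]
    [IsManifold (𝓡 (2 * n + 1)) ∞ M] where
  /-- The bundle endomorphism `Φ` of `TM ⊕ T*M`. -/
  Φ : ∀ x : M, GT n x →ₗ[ℝ] GT n x
  /-- The sections `E₊`, `E₋` of `TM ⊕ T*M`. -/
  E : Sgn → ∀ x : M, GT n x
  /-- `Φ` is smooth: it maps smooth sections to smooth sections. -/
  smooth_Φ : ∀ s : ∀ x : M, GT n x, Smooth s → Smooth (fun x => Φ x (s x))
  smooth_E : ∀ ε, Smooth (E ε)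
  /-- `Φ + Φ* = 0`. -/
  skew_Φ : ∀ x a b, pairing x (Φ x a) b + pairing x a (Φ x b) = 0
  pairing_E : ∀ x, pairing x (E .plus x) (E .minus x) = 1 / 2
  null_E : ∀ ε x, pairing x (E ε x) (E ε x) = 0
  Φ_sq : ∀ x a, Φ x (Φ x a) = -a + (2 : ℝ) • (pairing x (E .minus x) a • E .plus x
    + pairing x (E .plus x) a • E .minus x)

namespace GenAlmostContact

variable [IsManifold (𝓡 (2 * n + 1)) ∞ M] (S : GenAlmostContact n M)

/-- The eigenbundle `E^(1,0) = {e - i Φ(e) | ⟨e, E₊⟩ = ⟨e, E₋⟩ = 0}` of `Φ` for the eigenvalue `i`.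
(The set is already a complex subspace, so the span adds nothing.) -/
def E10 (x : M) : Submodule ℂ (GTC n x) :=
  Submodule.span ℂ {z | ∃ e : GT n x, (∀ ε, pairing x e (S.E ε x) = 0) ∧
    z = toC x e - Complex.I • toC x (S.Φ x e)}

/-- `L_± = (L_{E_±} ⊗ ℂ) ⊕ E^(1,0)`. -/
def L (ε : Sgn) (x : M) : Submodule ℂ (GTC n x) :=
  Submodule.span ℂ {toC x (S.E ε x)} ⊔ S.E10 x

/-- The vector field `R = X₊ + X₋`, where `E_± = X_± + η_±`. -/
def R (x : M) : TangentSpace (𝓡 (2 * n + 1)) x := (S.E .plus x).1 + (S.E .minus x).1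

/-- The tangent line `T𝓡` of the foliation spanned by `R`, inside `TM ⊕ T*M`. -/
def TR (x : M) : Submodule ℝ (GT n x) := Submodule.span ℝ {(S.R x, 0)}

/-- The annihilator `ann(R) ⊆ T*M`. -/
def annR (x : M) : Submodule ℝ (Cotangent n x) where
  carrier := {β | β (S.R x) = 0}
  add_mem' := by intro a b ha hb; simp_all
  zero_mem' := by simp
  smul_mem' := by intro c a ha; simp_all

/-- `T𝓡^⊥ = TM ⊕ ann(R)`. -/
def TRperp (x : M) : Submodule ℝ (GT n x) := Submodule.prod ⊤ (S.annR x)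

/-- The normal space `TM / T𝓡` of the foliation. -/
abbrev NR (x : M) : Type :=
  TangentSpace (𝓡 (2 * n + 1)) x ⧸ Submodule.span ℝ {S.R x}

/-- The fibre of `𝕋_𝓡 M = N_R ⊕ ann(R)`, as `(TM ⊕ ann(R)) / T𝓡` inside `(TM ⊕ T*M) / T𝓡`. -/
def transFiber (x : M) : Submodule ℝ (GT n x ⧸ S.TR x) := (S.TRperp x).map (S.TR x).mkQ

/-- The `R`-invariant smooth sections of `TM ⊕ ann(R)`: those `s` with
`[C^∞(T𝓡), s] ⊆ C^∞(T𝓡)`. -/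
def invSections : Set (∀ x : M, GT n x) :=
  {s | Smooth s ∧ (∀ x, s x ∈ S.TRperp x) ∧
    ∀ r : ∀ x : M, GT n x, Smooth r → (∀ x, r x ∈ S.TR x) → ∀ x, courant r s x ∈ S.TR x}

/-- `s` is a lift to `TM ⊕ T*M` of the section `σ` of `𝕋_𝓡 M`. -/
def Lifts (s : ∀ x : M, GT n x) (σ : ∀ x : M, S.transFiber x) : Prop :=
  ∀ x, (S.TR x).mkQ (s x) = (σ x : GT n x ⧸ S.TR x)

/-- The `R`-invariant (basic) smooth sections of `𝕋_𝓡 M`. -/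
def basicSections : Set (∀ x : M, S.transFiber x) :=
  {σ | ∃ s ∈ S.invSections, S.Lifts s σ}

/-- The basic functions: smooth functions that are constant along the leaves. -/
def basicFun : Set (M → ℝ) := {f | SmoothFun n f ∧ ∀ x, dFun n f x (S.R x) = 0}

/-- `𝕋_𝓡 M` as a transverse Courant algebroid: a smooth vector bundle of rank `4 n` whose fibrewise
pairing, whose bracket of basic sections, and whose anchor to the normal bundle `N_R` are the ones
induced from `TM ⊕ T*M`, such that the bracket of basic sections is again basic and
the axioms of a Courant algebroid hold for basic sections and basic functions. -/
structure TransverseCourantAlgebroid where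
  /-- The induced pairing. -/
  pair : ∀ x : M, LinearMap.BilinForm ℝ (S.transFiber x)
  /-- The induced bracket of sections (of interest on basic sections only). -/
  br : (∀ x : M, S.transFiber x) → (∀ x : M, S.transFiber x) → ∀ x : M, S.transFiber x
  /-- The anchor `𝕋_𝓡 M → N_R`. -/
  anchor : ∀ x : M, S.transFiber x →ₗ[ℝ] S.NR x
  /-- The derivative of a basic function along a normal vector. -/
  nder : (M → ℝ) → ∀ x : M, S.NR x →ₗ[ℝ] ℝ
  /-- The differential of a basic function as a section of `𝕋_𝓡 M`. -/
  D : (M → ℝ) → ∀ x : M, S.transFiber x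
  -- `𝕋_𝓡 M` is a smooth vector bundle of rank `4 n`: it has local frames
  -- coming from smooth sections of `TM ⊕ ann(R)`
  frame : ∀ x : M, ∃ s : Fin (4 * n) → ∀ y : M, GT n y,
    (∀ i, Smooth (s i) ∧ ∀ y, s i y ∈ S.TRperp y) ∧
    ∀ᶠ y in 𝓝 x, LinearIndependent ℝ (fun i => (S.TR y).mkQ (s i y)) ∧
      Submodule.span ℝ (range fun i => (S.TR y).mkQ (s i y)) = S.transFiber y
  -- the data are the ones induced from `TM ⊕ T*M`
  pair_lift : ∀ (x : M) (a b : GT n x) (u v : S.transFiber x),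
    (S.TR x).mkQ a = u → (S.TR x).mkQ b = v → pair x u v = pairing x a b
  br_lift : ∀ s ∈ S.invSections, ∀ t ∈ S.invSections, ∀ σ τ, S.Lifts s σ → S.Lifts t τ →
    courant s t ∈ S.invSections ∧ S.Lifts (courant s t) (br σ τ)
  anchor_lift : ∀ (x : M) (a : GT n x) (u : S.transFiber x),
    (S.TR x).mkQ a = u → anchor x u = (Submodule.span ℝ {S.R x}).mkQ a.1
  nder_lift : ∀ f ∈ S.basicFun, ∀ (x : M) (v : TangentSpace (𝓡 (2 * n + 1)) x),
    nder f x ((Submodule.span ℝ {S.R x}).mkQ v) = dFun n f x v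
  D_lift : ∀ f ∈ S.basicFun, S.Lifts (fun x => (0, dFun n f x)) (D f)
  -- the pairing is symmetric and nondegenerate
  pair_symm : ∀ (x : M) (u v : S.transFiber x), pair x u v = pair x v u
  pair_nondeg : ∀ (x : M) (u : S.transFiber x), (∀ v, pair x u v = 0) → u = 0
  -- basic sections form a module over the basic functions, closed under all the operations
  basic_zero : (fun _ => 0) ∈ S.basicSections
  basic_add : ∀ σ ∈ S.basicSections, ∀ τ ∈ S.basicSections,
    (fun x => σ x + τ x) ∈ S.basicSections
  basic_smul : ∀ f ∈ S.basicFun, ∀ σ ∈ S.basicSections, (fun x => f x • σ x) ∈ S.basicSections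
  basic_br : ∀ σ ∈ S.basicSections, ∀ τ ∈ S.basicSections, br σ τ ∈ S.basicSections
  basic_D : ∀ f ∈ S.basicFun, D f ∈ S.basicSections
  basic_pair : ∀ σ ∈ S.basicSections, ∀ τ ∈ S.basicSections,
    (fun x => pair x (σ x) (τ x)) ∈ S.basicFun
  basic_nder : ∀ σ ∈ S.basicSections, ∀ f ∈ S.basicFun,
    (fun x => nder f x (anchor x (σ x))) ∈ S.basicFun
  -- the axioms of a Courant algebroid
  br_skew : ∀ σ ∈ S.basicSections, ∀ τ ∈ S.basicSections, ∀ x, br σ τ x = -br τ σ x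
  br_add : ∀ σ ∈ S.basicSections, ∀ τ ∈ S.basicSections, ∀ υ ∈ S.basicSections, ∀ x,
    br σ (fun y => τ y + υ y) x = br σ τ x + br σ υ x
  jacobi : ∀ σ ∈ S.basicSections, ∀ τ ∈ S.basicSections, ∀ υ ∈ S.basicSections, ∀ x,
    br (br σ τ) υ x + br (br τ υ) σ x + br (br υ σ) τ x =
      D (fun y => (1 / 3 : ℝ) * (pair y (br σ τ y) (υ y) + pair y (br τ υ y) (σ y)
        + pair y (br υ σ y) (τ y))) x
  anchor_br : ∀ σ ∈ S.basicSections, ∀ τ ∈ S.basicSections, ∀ f ∈ S.basicFun, ∀ x,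
    nder f x (anchor x (br σ τ x)) =
      nder (fun y => nder f y (anchor y (τ y))) x (anchor x (σ x))
        - nder (fun y => nder f y (anchor y (σ y))) x (anchor x (τ x))
  leibniz : ∀ σ ∈ S.basicSections, ∀ τ ∈ S.basicSections, ∀ f ∈ S.basicFun, ∀ x,
    br σ (fun y => f y • τ y) x =
      f x • br σ τ x + nder f x (anchor x (σ x)) • τ x - pair x (σ x) (τ x) • D f x
  anchor_D : ∀ f ∈ S.basicFun, ∀ x, anchor x (D f x) = 0
  compat : ∀ σ ∈ S.basicSections, ∀ τ ∈ S.basicSections, ∀ υ ∈ S.basicSections, ∀ x,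
    nder (fun y => pair y (τ y) (υ y)) x (anchor x (σ x)) =
      pair x (br σ τ x + D (fun y => pair y (σ y) (τ y)) x) (υ x)
        + pair x (τ x) (br σ υ x + D (fun y => pair y (σ y) (υ y)) x)

/-! ### Complexification and transverse Dirac structures -/

/-- `T𝓡 ⊗ ℂ`. -/
def TRC (x : M) : Submodule ℂ (GTC n x) := (S.TR x).baseChange ℂ

/-- `(TM ⊕ ann(R)) ⊗ ℂ`. -/
def TRperpC (x : M) : Submodule ℂ (GTC n x) := (S.TRperp x).baseChange ℂ

/-- The fibre of `𝕋_𝓡 M ⊗ ℂ`, as `(TM ⊕ ann(R)) ⊗ ℂ / T𝓡 ⊗ ℂ`. -/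
def transFiberC (x : M) : Submodule ℂ (GTC n x ⧸ S.TRC x) := (S.TRperpC x).map (S.TRC x).mkQ

/-- The `R`-invariant smooth sections of `(TM ⊕ ann(R)) ⊗ ℂ`. -/
def invSectionsC : Set (∀ x : M, GTC n x) :=
  {s | SmoothC s ∧ (∀ x, s x ∈ S.TRperpC x) ∧
    ∀ r : ∀ x : M, GTC n x, SmoothC r → (∀ x, r x ∈ S.TRC x) → ∀ x, courantC r s x ∈ S.TRC x}

/-- `H_± = L_± ∩ (TM ⊕ ann(R)) ⊗ ℂ`. -/
def H (ε : Sgn) (x : M) : Submodule ℂ (GTC n x) := S.L ε x ⊓ S.TRperpC x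

/-- The fibre of `(H_± + T𝓡 ⊗ ℂ) / T𝓡 ⊗ ℂ`. -/
def diracFiber (ε : Sgn) (x : M) : Submodule ℂ (GTC n x ⧸ S.TRC x) :=
  (S.H ε x ⊔ S.TRC x).map (S.TRC x).mkQ

/-- A transverse Dirac structure: a smooth complex subbundle of `𝕋_𝓡 M ⊗ ℂ` of rank `2 n`,
isotropic for the induced pairing, whose `R`-invariant sections are closed under the induced
bracket. Sections of the quotient bundle are handled through their lifts to `(TM ⊕ ann(R)) ⊗ ℂ`. -/
structure IsTransverseDirac (D : ∀ x : M, Submodule ℂ (GTC n x ⧸ S.TRC x)) : Prop where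
  le : ∀ x, D x ≤ S.transFiberC x
  frame : ∀ x : M, ∃ s : Fin (2 * n) → ∀ y : M, GTC n y,
    (∀ i, SmoothC (s i) ∧ ∀ y, s i y ∈ S.TRperpC y) ∧
    ∀ᶠ y in 𝓝 x, LinearIndependent ℂ (fun i => (S.TRC y).mkQ (s i y)) ∧
      Submodule.span ℂ (range fun i => (S.TRC y).mkQ (s i y)) = D y
  isotropic : ∀ (x : M) (a b : GTC n x),
    (S.TRC x).mkQ a ∈ D x → (S.TRC x).mkQ b ∈ D x → pairingC x a b = 0
  involutive : ∀ s ∈ S.invSectionsC, ∀ t ∈ S.invSectionsC,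
    (∀ x, (S.TRC x).mkQ (s x) ∈ D x) → (∀ x, (S.TRC x).mkQ (t x) ∈ D x) →
    courantC s t ∈ S.invSectionsC ∧ ∀ x, (S.TRC x).mkQ (courantC s t x) ∈ D x

end GenAlmostContact

end GenContact

end

open Set Filter Topology Bundle VectorField
open scoped Manifold ContDiff TensorProduct

noncomputable section

namespace GenContact

variable {n : ℕ} {M : Type*} [TopologicalSpace M]
  [ChartedSpace (EuclideanSpace ℝ (Fin (2 * n + 1))) M]

section Calculus

variable [IsManifold (𝓡 (2 * n + 1)) ∞ M]

/-! ### Smooth functions, vector fields and one-forms -/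

/-! The relations between `E₊` and `E₋` give `η(R) = ⟨E₊ + E₋, E₊ + E₋⟩ = 1` for `η = η₊ + η₋`.
Hence `R` vanishes nowhere, `T𝓡` is an isotropic line, `TM ⊕ ann(R)` is its orthogonal, and `𝕋_𝓡 M`
is the reduction `N^⊥ / N` for `N = T𝓡`. The induced pairing is nondegenerate and the rank is `4n +
2 - 2`.

The identities of the Courant bracket on `TM ⊕ T*M` are checked by evaluating one-forms on vector
fields. The two long ones, Jacobi and invariance of the pairing, are formal consequences of the Lie
algebra of vector fields acting on functions (`absCourant_jacobi`, `absCourant_compat`); Cartan's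
formula `dForm_apply` makes the link. They descend to basic sections for three reasons. Every smooth
section of `T𝓡` is `f R` with `f` smooth, so invariance need only be tested against `R`
(`mem_invSections_iff`). Invariance of the pairing shows that `⟨s, t⟩` is basic and that `[s, t]` is
orthogonal to `R`. The Jacobi identity for `s, t, R` then shows that `[s, t]` is invariant
(`courant_mem_invSections`). Two invariant lifts of one section differ by a section of `T𝓡`, which
does not change the class of a bracket.

The rank is linear algebra. On the orthogonal of `E_±` the map `Φ` is skew with square `-1`, so
`L_±` is isotropic; together with the conjugate of `L_∓`, also isotropic, it spans everything, so it
is its own orthogonal (`orthogonal_L`). If `L = L^⊥` and `N` is isotropic, then `L ∩ N^⊥ + N` is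
again its own orthogonal (`orthogonal_reduction`). Thus `H + T𝓡 ⊗ ℂ` has dimension `2n + 1`.

For the Dirac structure the dichotomy on `R` serves to build sections. Where `R ∈ L` locally, `L ⊆
R^⊥` and `H = L`. Where `R ∉ L`, some section `l` of `L` has `⟨l, R⟩ ≠ 0`: subtracting multiples of
`l` moves sections of `L` into `H` (`exists_smooth_H`), and adding multiples of `R` moves sections
of `H + T𝓡 ⊗ ℂ` into `L` (`exists_correction`). Involutivity of `L` applied to the corrected
sections puts `[s, t]` in `L + T𝓡 ⊗ ℂ`; it is also orthogonal to `R`, and `(L + T𝓡 ⊗ ℂ) ∩ R^⊥ = H +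
T𝓡 ⊗ ℂ` by the modular law. -/

theorem SmoothVF.add {X Y : ∀ x : M, TangentSpace (𝓡 (2 * n + 1)) x} (hX : SmoothVF X)
    (hY : SmoothVF Y) : SmoothVF (fun x => X x + Y x) :=
  ContMDiff.add_section hX hY

theorem SmoothVF.smul {f : M → ℝ} {X : ∀ x : M, TangentSpace (𝓡 (2 * n + 1)) x}
    (hf : SmoothFun n f) (hX : SmoothVF X) : SmoothVF (fun x => f x • X x) :=
  ContMDiff.smul_section hf hX

theorem SmoothVF.zero : SmoothVF (fun x : M => (0 : TangentSpace (𝓡 (2 * n + 1)) x)) :=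
  contMDiff_zeroSection ℝ _

theorem SmoothForm.add {ξ η : ∀ x : M, Cotangent n x} (hξ : SmoothForm ξ)
    (hη : SmoothForm η) : SmoothForm (fun x => ξ x + η x) :=
  ContMDiff.add_section hξ hη

theorem SmoothForm.smul {f : M → ℝ} {ξ : ∀ x : M, Cotangent n x}
    (hf : SmoothFun n f) (hξ : SmoothForm ξ) : SmoothForm (fun x => f x • ξ x) :=
  ContMDiff.smul_section hf hξ

theorem SmoothForm.zero : SmoothForm (fun x : M => (0 : Cotangent n x)) :=
  contMDiff_zeroSection ℝ (fun x : M => TangentSpace (𝓡 (2 * n + 1)) x →L[ℝ] ℝ)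

omit [IsManifold (𝓡 (2 * n + 1)) ∞ M] in
theorem SmoothFun.const (c : ℝ) : SmoothFun n (fun _ : M => c) := contMDiff_const

theorem SmoothForm.apply {ξ : ∀ x : M, Cotangent n x}
    {X : ∀ x : M, TangentSpace (𝓡 (2 * n + 1)) x} (hξ : SmoothForm ξ) (hX : SmoothVF X) :
    SmoothFun n (fun x => ξ x (X x)) := by
  have h : ContMDiff (𝓡 (2 * n + 1)) ((𝓡 (2 * n + 1)).prod 𝓘(ℝ, ℝ)) ∞
      (fun m => TotalSpace.mk' ℝ (E := Bundle.Trivial M ℝ) m (ξ m (X m))) :=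
    ContMDiff.clm_bundle_apply (F₂ := ℝ) (E₂ := Bundle.Trivial M ℝ) (b := fun x => x) hξ hX
  intro x
  exact (Bundle.contMDiffAt_section _).mp (h x)

theorem SmoothFun.dFun_apply {f : M → ℝ} {X : ∀ x : M, TangentSpace (𝓡 (2 * n + 1)) x}
    (hf : SmoothFun n f) (hX : SmoothVF X) : SmoothFun n (fun x => dFun n f x (X x)) := by
  have h := (ContMDiff.contMDiff_tangentMap (m := ∞) hf (by simp)).comp hX
  exact (contMDiff_snd_tangentBundle_modelSpace ℝ 𝓘(ℝ, ℝ)).comp h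

theorem exists_smooth_bump (x : M) [T2Space M] {s : Set M} (hs : s ∈ 𝓝 x) :
    ∃ f : M → ℝ, SmoothFun n f ∧ f =ᶠ[𝓝 x] 1 ∧ tsupport f ⊆ s := by
  obtain ⟨f, hf, -⟩ := (SmoothBumpFunction.nhds_basis_support (I := 𝓡 (2 * n + 1)) hs).mem_iff.1
    hs
  exact ⟨f, f.contMDiff, f.eventuallyEq_one, hf⟩

/-- The extension that is constant in a trivialization is cut off by a bump function. Agreement on a
neighbourhood, not only at `x`, is what `SmoothForm.of_apply` needs. -/
theorem exists_smooth_section_eventuallyEq [T2Space M] (F : Type*) [NormedAddCommGroup F]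
    [NormedSpace ℝ F] {V : M → Type*} [TopologicalSpace (TotalSpace F V)]
    [∀ x, AddCommGroup (V x)] [∀ x, Module ℝ (V x)] [∀ x, TopologicalSpace (V x)]
    [FiberBundle F V] [VectorBundle ℝ F V] [ContMDiffVectorBundle ∞ F V (𝓡 (2 * n + 1))]
    {x : M} (v : V x) : ∃ s : ∀ y, V y,
      ContMDiff (𝓡 (2 * n + 1)) ((𝓡 (2 * n + 1)).prod 𝓘(ℝ, F)) ∞
        (fun y => TotalSpace.mk' F y (s y)) ∧
      ∀ᶠ y in 𝓝 x, s y = FiberBundle.extend F v y := by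
  obtain ⟨u, hu, hs⟩ := FiberBundle.exists_contMDiffOn_extend (k := ∞) (𝓡 (2 * n + 1)) F v
  obtain ⟨w, hwu, hw, hxw⟩ := mem_nhds_iff.1 hu
  obtain ⟨f, hf, hf1, hfs⟩ := exists_smooth_bump (n := n) x (hw.mem_nhds hxw)
  refine ⟨f • FiberBundle.extend F v,
    ContMDiffOn.smul_section_of_tsupport hf.contMDiffOn hw hfs (hs.mono hwu), ?_⟩
  filter_upwards [hf1] with y hy
  simp [hy]

theorem exists_smoothVF_eq [T2Space M] {x : M} (v : TangentSpace (𝓡 (2 * n + 1)) x) :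
    ∃ X : ∀ y : M, TangentSpace (𝓡 (2 * n + 1)) y, SmoothVF X ∧ X x = v := by
  obtain ⟨s, hs, h⟩ := exists_smooth_section_eventuallyEq (n := n)
    (EuclideanSpace ℝ (Fin (2 * n + 1))) v
  exact ⟨s, hs, by simpa using h.self_of_nhds⟩

theorem exists_smoothForm_eq [T2Space M] {x : M} (v : Cotangent n x) :
    ∃ ξ : ∀ y : M, Cotangent n y, SmoothForm ξ ∧ ξ x = v := by
  obtain ⟨s, hs, h⟩ := exists_smooth_section_eventuallyEq (n := n)
    (V := fun x : M => TangentSpace (𝓡 (2 * n + 1)) x →L[ℝ] ℝ)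
    (EuclideanSpace ℝ (Fin (2 * n + 1)) →L[ℝ] ℝ) v
  exact ⟨s, hs, by simpa using h.self_of_nhds⟩

/-- A one-form is smooth if its values on smooth vector fields are smooth. -/
theorem SmoothForm.of_apply [T2Space M] {ξ : ∀ x : M, Cotangent n x}
    (h : ∀ X : ∀ x : M, TangentSpace (𝓡 (2 * n + 1)) x, SmoothVF X →
      SmoothFun n (fun x => ξ x (X x))) : SmoothForm ξ := by
  intro x₀
  rw [contMDiffAt_hom_bundle]
  refine ⟨contMDiffAt_id, ?_⟩
  dsimp only
  set t := trivializationAt (EuclideanSpace ℝ (Fin (2 * n + 1)))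
    (TangentSpace (𝓡 (2 * n + 1)) : M → Type _) x₀
  -- A constant vector in the trivialization is only a local field, but near `x₀` it agrees with a
  -- global smooth field, to which `h` applies.
  have key : ∀ v : EuclideanSpace ℝ (Fin (2 * n + 1)),
      ContMDiffAt (𝓡 (2 * n + 1)) 𝓘(ℝ, ℝ) ∞ (fun y => ξ y (t.symmL ℝ y v)) x₀ := by
    intro v
    obtain ⟨X, hX, hXv⟩ := exists_smooth_section_eventuallyEq (n := n)
      (EuclideanSpace ℝ (Fin (2 * n + 1))) (V := (TangentSpace (𝓡 (2 * n + 1)) : M → Type _))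
      (x := x₀) (t.symmL ℝ x₀ v)
    refine (h X hX x₀).congr_of_eventuallyEq ?_
    filter_upwards [hXv, t.open_baseSet.mem_nhds
      (FiberBundle.mem_baseSet_trivializationAt' x₀)] with y hy hyt
    have h₀ : (t ⟨x₀, t.symmL ℝ x₀ v⟩).2 = v := by
      rw [Trivialization.symmL_apply _ (FiberBundle.mem_baseSet_trivializationAt' x₀)]
      exact congrArg Prod.snd
        (t.apply_mk_symm (FiberBundle.mem_baseSet_trivializationAt' x₀) v)
    rw [hy, FiberBundle.extend, h₀, Trivialization.symmL_apply _ hyt]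
  have hsum : ∀ f : EuclideanSpace ℝ (Fin (2 * n + 1)) →L[ℝ] ℝ,
      f = ∑ i, f (EuclideanSpace.single i 1) • EuclideanSpace.proj i := by
    intro f
    refine ContinuousLinearMap.coe_injective
      ((EuclideanSpace.basisFun _ ℝ).toBasis.ext fun j => ?_)
    simp
  have hev : (fun y => ContinuousLinearMap.inCoordinates (EuclideanSpace ℝ (Fin (2 * n + 1)))
      (TangentSpace (𝓡 (2 * n + 1)) : M → Type _) ℝ (Bundle.Trivial M ℝ) x₀ y x₀ y (ξ y)) =
      fun y => ∑ i, (ξ y (t.symmL ℝ y (EuclideanSpace.single i 1))) •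
        (EuclideanSpace.proj i : EuclideanSpace ℝ (Fin (2 * n + 1)) →L[ℝ] ℝ) := by
    funext y
    rw [hsum (ContinuousLinearMap.inCoordinates _ _ _ _ _ _ _ _ _)]
    simp [ContinuousLinearMap.inCoordinates, t]
  refine ContMDiffAt.congr_of_eventuallyEq ?_ (Eventually.of_forall fun y => congrFun hev y)
  exact contMDiffAt_finsetSum fun i _ => (key _).smul contMDiffAt_const

end Calculus

/-! ### Exterior derivative and Lie bracket in charts; Cartan's formula -/

section Cartan

variable [IsManifold (𝓡 (2 * n + 1)) ∞ M]

theorem two_le_infty : (2 : WithTop ℕ∞) ≤ ∞ :=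
  WithTop.coe_le_coe.2 (le_top : (2 : ℕ∞) ≤ ⊤)

/-- The coordinate expression of the vector field `X` in the preferred chart at `x`. -/
def chartVF (X : ∀ x : M, TangentSpace (𝓡 (2 * n + 1)) x) (x : M) :
    EuclideanSpace ℝ (Fin (2 * n + 1)) → EuclideanSpace ℝ (Fin (2 * n + 1)) :=
  mpullback 𝓘(ℝ, EuclideanSpace ℝ (Fin (2 * n + 1))) (𝓡 (2 * n + 1))
    (extChartAt (𝓡 (2 * n + 1)) x).symm X

/-- The tangent space at `x` is identified with the model space through the preferred chart at `x`,
so at the base point chart expressions carry no derivative factor. -/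
theorem mfderiv_extChartAt_symm_self (x : M) :
    mfderiv 𝓘(ℝ, EuclideanSpace ℝ (Fin (2 * n + 1))) (𝓡 (2 * n + 1))
      (extChartAt (𝓡 (2 * n + 1)) x).symm (extChartAt (𝓡 (2 * n + 1)) x x) =
      ContinuousLinearMap.id ℝ _ := by
  have : IsManifold (𝓡 (2 * n + 1)) 1 M := IsManifold.of_le (n := ∞) (by simp)
  have := mfderivWithin_range_extChartAt_symm (I := 𝓡 (2 * n + 1)) (x := x)
  simpa only [modelWithCornersSelf_coe, range_id, mfderivWithin_univ] using this

theorem isInvertible_mfderiv_extChartAt_symm' {x : M} {p : EuclideanSpace ℝ (Fin (2 * n + 1))}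
    (hp : p ∈ (extChartAt (𝓡 (2 * n + 1)) x).target) :
    (mfderiv 𝓘(ℝ, EuclideanSpace ℝ (Fin (2 * n + 1))) (𝓡 (2 * n + 1))
      (extChartAt (𝓡 (2 * n + 1)) x).symm p).IsInvertible := by
  have : IsManifold (𝓡 (2 * n + 1)) 1 M := IsManifold.of_le (n := ∞) (by simp)
  have := isInvertible_mfderivWithin_extChartAt_symm hp
  simpa only [modelWithCornersSelf_coe, range_id, mfderivWithin_univ] using this

theorem chartVF_self (X : ∀ x : M, TangentSpace (𝓡 (2 * n + 1)) x) (x : M) :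
    chartVF X x (extChartAt (𝓡 (2 * n + 1)) x x) = X x := by
  let A : EuclideanSpace ℝ (Fin (2 * n + 1)) →L[ℝ] EuclideanSpace ℝ (Fin (2 * n + 1)) :=
    mfderiv 𝓘(ℝ, EuclideanSpace ℝ (Fin (2 * n + 1))) (𝓡 (2 * n + 1))
      (extChartAt (𝓡 (2 * n + 1)) x).symm (extChartAt (𝓡 (2 * n + 1)) x x)
  have hA : A = ContinuousLinearMap.id ℝ _ := mfderiv_extChartAt_symm_self x
  let X' : M → EuclideanSpace ℝ (Fin (2 * n + 1)) := X
  change A.inverse (X' ((extChartAt (𝓡 (2 * n + 1)) x).symm (extChartAt (𝓡 (2 * n + 1)) x x))) =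
    X' x
  rw [hA, ContinuousLinearMap.inverse_id, extChartAt_to_inv]
  rfl

theorem chartForm_chartVF (β : ∀ x : M, Cotangent n x)
    (X : ∀ x : M, TangentSpace (𝓡 (2 * n + 1)) x) {x : M}
    {p : EuclideanSpace ℝ (Fin (2 * n + 1))}
    (hp : p ∈ (extChartAt (𝓡 (2 * n + 1)) x).target) :
    chartForm β x p (chartVF X x p) =
      β ((extChartAt (𝓡 (2 * n + 1)) x).symm p) (X ((extChartAt (𝓡 (2 * n + 1)) x).symm p)) := by
  have h := (isInvertible_mfderiv_extChartAt_symm' hp).self_apply_inverse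
    (X ((extChartAt (𝓡 (2 * n + 1)) x).symm p))
  exact congrArg (β ((extChartAt (𝓡 (2 * n + 1)) x).symm p)) h

theorem chartForm_self (β : ∀ x : M, Cotangent n x) (x : M)
    (v : EuclideanSpace ℝ (Fin (2 * n + 1))) :
    chartForm β x (extChartAt (𝓡 (2 * n + 1)) x x) v = β x v := by
  let A : EuclideanSpace ℝ (Fin (2 * n + 1)) →L[ℝ] EuclideanSpace ℝ (Fin (2 * n + 1)) :=
    mfderiv 𝓘(ℝ, EuclideanSpace ℝ (Fin (2 * n + 1))) (𝓡 (2 * n + 1))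
      (extChartAt (𝓡 (2 * n + 1)) x).symm (extChartAt (𝓡 (2 * n + 1)) x x)
  have hA : A = ContinuousLinearMap.id ℝ _ := mfderiv_extChartAt_symm_self x
  let β' : M → EuclideanSpace ℝ (Fin (2 * n + 1)) →L[ℝ] ℝ := β
  change β' ((extChartAt (𝓡 (2 * n + 1)) x).symm (extChartAt (𝓡 (2 * n + 1)) x x)) (A v) = β' x v
  rw [hA, extChartAt_to_inv]
  rfl

theorem SmoothVF.differentiableAt_chartVF {X : ∀ x : M, TangentSpace (𝓡 (2 * n + 1)) x}
    (hX : SmoothVF X) (x : M) :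
    DifferentiableAt ℝ (chartVF X x) (extChartAt (𝓡 (2 * n + 1)) x x) := by
  have : IsManifold (𝓡 (2 * n + 1)) 2 M := IsManifold.of_le (n := ∞) two_le_infty
  have h := MDifferentiableWithinAt.differentiableWithinAt_mpullbackWithin_vectorField
    (s := univ) (I := 𝓡 (2 * n + 1)) (V := X) (x := x)
    ((hX x).mdifferentiableAt (by simp)).mdifferentiableWithinAt
  simp only [modelWithCornersSelf_coe, range_id, mpullbackWithin_univ, preimage_univ,
    inter_self] at h
  exact h.differentiableAt univ_mem

theorem SmoothForm.differentiableAt_chartForm {β : ∀ x : M, Cotangent n x}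
    (hβ : SmoothForm β) (x : M) :
    DifferentiableAt ℝ (chartForm β x) (extChartAt (𝓡 (2 * n + 1)) x x) := by
  have : IsManifold (𝓡 (2 * n + 1)) 1 M := IsManifold.of_le (n := ∞) (by simp)
  have h := ((contMDiffAt_hom_bundle _).1 (hβ x)).2
  have hs : ContMDiffAt 𝓘(ℝ, EuclideanSpace ℝ (Fin (2 * n + 1))) (𝓡 (2 * n + 1)) ∞
      (extChartAt (𝓡 (2 * n + 1)) x).symm (extChartAt (𝓡 (2 * n + 1)) x x) :=
    (contMDiffOn_extChartAt_symm x).contMDiffAt (extChartAt_target_mem_nhds x)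
  have h2 := (h.comp_of_eq hs (extChartAt_to_inv x))
  refine (h2.contDiffAt.differentiableAt (by simp)).congr_of_eventuallyEq ?_
  filter_upwards [extChartAt_target_mem_nhds (I := 𝓡 (2 * n + 1)) x] with p hp
  have hp' := (extChartAt (𝓡 (2 * n + 1)) x).map_target hp
  -- The fibrewise inverse of the trivialization is the derivative of the inverse chart, so
  -- `chartForm` is the form read in the trivialization.
  have hsymm := TangentBundle.symmL_trivializationAt (I := 𝓡 (2 * n + 1)) (x₀ := x)
    (x := (extChartAt (𝓡 (2 * n + 1)) x).symm p) (by simpa using hp')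
  rw [(extChartAt (𝓡 (2 * n + 1)) x).right_inv hp] at hsymm
  simp only [modelWithCornersSelf_coe, range_id, mfderivWithin_univ] at hsymm
  ext v
  simp only [chartForm, Function.comp_apply, ContinuousLinearMap.inCoordinates, hsymm]
  simp

omit [IsManifold (𝓡 (2 * n + 1)) ∞ M] in
theorem SmoothFun.dFun_eq_fderiv {f : M → ℝ} (hf : SmoothFun n f) (x : M) :
    dFun n f x = fderiv ℝ (fun p => f ((extChartAt (𝓡 (2 * n + 1)) x).symm p))
      (extChartAt (𝓡 (2 * n + 1)) x x) := by
  have h := (((hf x).mdifferentiableAt (by simp)).hasMFDerivAt).2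
  rw [modelWithCornersSelf_coe, range_id] at h
  let f' : EuclideanSpace ℝ (Fin (2 * n + 1)) →L[ℝ] ℝ := dFun n f x
  have h' : HasFDerivWithinAt (fun p => f ((extChartAt (𝓡 (2 * n + 1)) x).symm p)) f' univ
      (extChartAt (𝓡 (2 * n + 1)) x x) := h
  exact (h'.hasFDerivAt univ_mem).fderiv.symm

theorem mlieBracket_eq_chart (X Y : ∀ x : M, TangentSpace (𝓡 (2 * n + 1)) x) (x : M) :
    mlieBracket (𝓡 (2 * n + 1)) X Y x =
      lieBracket ℝ (chartVF X x) (chartVF Y x) (extChartAt (𝓡 (2 * n + 1)) x x) := by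
  have : IsManifold (𝓡 (2 * n + 1)) 1 M := IsManifold.of_le (n := ∞) (by simp)
  let A : EuclideanSpace ℝ (Fin (2 * n + 1)) →L[ℝ] EuclideanSpace ℝ (Fin (2 * n + 1)) :=
    mfderiv (𝓡 (2 * n + 1)) 𝓘(ℝ, EuclideanSpace ℝ (Fin (2 * n + 1)))
      (extChartAt (𝓡 (2 * n + 1)) x) x
  have hA : A = ContinuousLinearMap.id ℝ _ := mfderiv_extChartAt_self
  rw [← mlieBracketWithin_univ, mlieBracketWithin_apply]
  simp only [modelWithCornersSelf_coe, range_id, mpullbackWithin_univ, preimage_univ, inter_self]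
  change A.inverse (lieBracketWithin ℝ (chartVF X x) (chartVF Y x) univ
    (extChartAt (𝓡 (2 * n + 1)) x x)) = _
  rw [hA, ContinuousLinearMap.inverse_id, lieBracketWithin_univ]
  rfl

theorem dForm_eq_fderiv (β : ∀ x : M, Cotangent n x) (x : M)
    (u v : TangentSpace (𝓡 (2 * n + 1)) x) : dForm β x u v =
      fderiv ℝ (chartForm β x) (extChartAt (𝓡 (2 * n + 1)) x x) u v -
      fderiv ℝ (chartForm β x) (extChartAt (𝓡 (2 * n + 1)) x x) v u := by
  have : IsManifold (𝓡 (2 * n + 1)) 1 M := IsManifold.of_le (n := ∞) (by simp)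
  let A : EuclideanSpace ℝ (Fin (2 * n + 1)) →L[ℝ] EuclideanSpace ℝ (Fin (2 * n + 1)) :=
    mfderiv (𝓡 (2 * n + 1)) 𝓘(ℝ, EuclideanSpace ℝ (Fin (2 * n + 1)))
      (extChartAt (𝓡 (2 * n + 1)) x) x
  have hA : A = ContinuousLinearMap.id ℝ _ := mfderiv_extChartAt_self
  change fderiv ℝ (chartForm β x) (extChartAt (𝓡 (2 * n + 1)) x x) (A u) (A v) -
    fderiv ℝ (chartForm β x) (extChartAt (𝓡 (2 * n + 1)) x x) (A v) (A u) = _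
  rw [hA]
  rfl

/-- Cartan's formula for the exterior derivative of a one-form. -/
theorem dForm_apply {β : ∀ x : M, Cotangent n x} {X Y : ∀ x : M, TangentSpace (𝓡 (2 * n + 1)) x}
    (hβ : SmoothForm β) (hX : SmoothVF X) (hY : SmoothVF Y) (x : M) :
    dForm β x (X x) (Y x) = dFun n (fun y => β y (Y y)) x (X x)
      - dFun n (fun y => β y (X y)) x (Y x) - β x (mlieBracket (𝓡 (2 * n + 1)) X Y x) := by
  have : IsManifold (𝓡 (2 * n + 1)) 1 M := IsManifold.of_le (n := ∞) (by simp)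
  -- Product rule for `β(Z)` in the chart. Antisymmetrising, the derivatives of `β` give `dβ` and
  -- those of the fields give `β([X, Y])`.
  have key : ∀ {Z : ∀ x : M, TangentSpace (𝓡 (2 * n + 1)) x} (_ : SmoothVF Z)
      (v : TangentSpace (𝓡 (2 * n + 1)) x), dFun n (fun y => β y (Z y)) x v =
        fderiv ℝ (chartForm β x) (extChartAt (𝓡 (2 * n + 1)) x x) v (Z x) +
        β x (fderiv ℝ (chartVF Z x) (extChartAt (𝓡 (2 * n + 1)) x x) v) := by
    intro Z hZ v
    rw [(hβ.apply hZ).dFun_eq_fderiv]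
    have he : (fun p => β ((extChartAt (𝓡 (2 * n + 1)) x).symm p)
        (Z ((extChartAt (𝓡 (2 * n + 1)) x).symm p))) =ᶠ[𝓝 (extChartAt (𝓡 (2 * n + 1)) x x)]
        fun p => chartForm β x p (chartVF Z x p) := by
      filter_upwards [extChartAt_target_mem_nhds (I := 𝓡 (2 * n + 1)) x] with p hp
      exact (chartForm_chartVF β Z hp).symm
    have h1 := DFunLike.congr_fun (he.fderiv_eq.trans
      ((hβ.differentiableAt_chartForm x).hasFDerivAt.clm_apply
        (hZ.differentiableAt_chartVF x).hasFDerivAt).fderiv) v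
    refine h1.trans ?_
    change chartForm β x (extChartAt (𝓡 (2 * n + 1)) x x)
      (fderiv ℝ (chartVF Z x) (extChartAt (𝓡 (2 * n + 1)) x x) v) +
      fderiv ℝ (chartForm β x) (extChartAt (𝓡 (2 * n + 1)) x x) v
        (chartVF Z x (extChartAt (𝓡 (2 * n + 1)) x x)) = _
    rw [chartForm_self, chartVF_self, add_comm]
  have h2 : β x (mlieBracket (𝓡 (2 * n + 1)) X Y x) =
      β x (fderiv ℝ (chartVF Y x) (extChartAt (𝓡 (2 * n + 1)) x x) (X x)) -
      β x (fderiv ℝ (chartVF X x) (extChartAt (𝓡 (2 * n + 1)) x x) (Y x)) := by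
    rw [mlieBracket_eq_chart, lieBracket_eq]
    simp only [chartVF_self]
    exact (β x).map_sub _ _
  rw [dForm_eq_fderiv, key hY, key hX, h2]
  ring

/-- The differential of a function is closed. -/
theorem dForm_dFun {f : M → ℝ} (hf : SmoothFun n f) (x : M)
    (u v : TangentSpace (𝓡 (2 * n + 1)) x) : dForm (dFun n f) x u v = 0 := by
  have : IsManifold (𝓡 (2 * n + 1)) 1 M := IsManifold.of_le (n := ∞) (by simp)
  have hs : ContMDiffOn 𝓘(ℝ, EuclideanSpace ℝ (Fin (2 * n + 1))) (𝓡 (2 * n + 1)) ∞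
      (extChartAt (𝓡 (2 * n + 1)) x).symm (extChartAt (𝓡 (2 * n + 1)) x).target :=
    contMDiffOn_extChartAt_symm x
  have hnhds := extChartAt_target_mem_nhds (I := 𝓡 (2 * n + 1)) x
  set g : EuclideanSpace ℝ (Fin (2 * n + 1)) → ℝ :=
    fun p => f ((extChartAt (𝓡 (2 * n + 1)) x).symm p) with hg
  -- In the chart `df` is the ordinary derivative of `f`, so closedness is the symmetry of the
  -- second derivative.
  have he : chartForm (dFun n f) x =ᶠ[𝓝 (extChartAt (𝓡 (2 * n + 1)) x x)] fderiv ℝ g := by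
    filter_upwards [eventually_mem_nhds_iff.2 hnhds] with p hp
    have := mfderiv_comp p ((hf _).mdifferentiableAt (by simp))
      ((hs.contMDiffAt hp).mdifferentiableAt (by simp))
    rw [chartForm, ← mfderiv_eq_fderiv]
    exact this.symm
  have hgc : ContDiffAt ℝ ∞ g (extChartAt (𝓡 (2 * n + 1)) x x) :=
    (hf.contMDiffAt.comp _ (hs.contMDiffAt hnhds)).contDiffAt
  have hsymm : IsSymmSndFDerivAt ℝ g (extChartAt (𝓡 (2 * n + 1)) x x) :=
    hgc.isSymmSndFDerivAt (by rw [minSmoothness_of_isRCLikeNormedField]; exact two_le_infty)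
  rw [dForm_eq_fderiv, he.fderiv_eq]
  exact sub_eq_zero.2 (hsymm u v)

theorem SmoothFun.smoothForm_dFun [T2Space M] {f : M → ℝ} (hf : SmoothFun n f) :
    SmoothForm (dFun n f) :=
  SmoothForm.of_apply fun _ hX => hf.dFun_apply hX

/-- The Lie bracket acts on functions as the commutator of derivations. -/
theorem dFun_mlieBracket [T2Space M] {f : M → ℝ} {X Y : ∀ x : M, TangentSpace (𝓡 (2 * n + 1)) x}
    (hf : SmoothFun n f) (hX : SmoothVF X) (hY : SmoothVF Y) (x : M) :
    dFun n f x (mlieBracket (𝓡 (2 * n + 1)) X Y x) =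
      dFun n (fun y => dFun n f y (Y y)) x (X x) - dFun n (fun y => dFun n f y (X y)) x (Y x) := by
  have h := dForm_apply hf.smoothForm_dFun hX hY x
  rw [dForm_dFun hf] at h
  linarith

theorem SmoothVF.mlieBracket {X Y : ∀ x : M, TangentSpace (𝓡 (2 * n + 1)) x}
    (hX : SmoothVF X) (hY : SmoothVF Y) :
    SmoothVF (mlieBracket (𝓡 (2 * n + 1)) X Y) := by
  have : IsManifold (𝓡 (2 * n + 1)) (((⊤ : ℕ∞) : WithTop ℕ∞) + 1) M :=
    IsManifold.of_le (n := ∞) (by simp)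
  have : IsManifold (𝓡 (2 * n + 1)) (minSmoothness ℝ 2) M :=
    IsManifold.of_le (n := ∞)
      (by rw [minSmoothness_of_isRCLikeNormedField]; exact two_le_infty)
  exact ContDiff.mlieBracket_vectorField (m := ⊤) (n := ⊤) hX hY (by simp)

/-- In Cartan's formula the term `Y(β(X))` cancels against `d(i_X β)`. -/
theorem lieForm_apply {β : ∀ x : M, Cotangent n x}
    {X Y : ∀ x : M, TangentSpace (𝓡 (2 * n + 1)) x}
    (hβ : SmoothForm β) (hX : SmoothVF X) (hY : SmoothVF Y) (x : M) :
    lieForm X β x (Y x) = dFun n (fun y => β y (Y y)) x (X x)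
      - β x (VectorField.mlieBracket (𝓡 (2 * n + 1)) X Y x) := by
  rw [lieForm, add_apply, dForm_apply hβ hX hY]
  ring

end Cartan

section AbstractCourant

/-! ### The Courant bracket of a Lie algebra acting on a module

Here `𝔛` plays the role of vector fields, `A` of functions, `𝔛 →ₗ[ℝ] A` of one-forms. -/

variable {𝔛 A : Type*} [LieRing 𝔛] [LieAlgebra ℝ 𝔛] [AddCommGroup A] [Module ℝ A]
  [LieRingModule 𝔛 A] [LieModule ℝ 𝔛 A]

/-- The differential `df = (Z ↦ Z f)`. -/
def absD (f : A) : 𝔛 →ₗ[ℝ] A where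
  toFun Z := ⁅Z, f⁆
  map_add' _ _ := add_lie _ _ _
  map_smul' _ _ := smul_lie _ _ _

@[simp] theorem absD_apply (f : A) (Z : 𝔛) : absD f Z = ⁅Z, f⁆ := rfl

/-- The natural pairing. -/
def absPairing (s t : 𝔛 × (𝔛 →ₗ[ℝ] A)) : A := (1 / 2 : ℝ) • (s.2 t.1 + t.2 s.1)

/-- The Courant bracket. -/
def absCourant (s t : 𝔛 × (𝔛 →ₗ[ℝ] A)) : 𝔛 × (𝔛 →ₗ[ℝ] A) :=
  (⁅s.1, t.1⁆, ⁅s.1, t.2⁆ - ⁅t.1, s.2⁆ - (1 / 2 : ℝ) • absD (t.2 s.1 - s.2 t.1))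

/-- The vector part is the Jacobi identity of `𝔛`. For the form part, evaluate on `Z`, orient the
three brackets cyclically and expand the action of a bracket as a commutator: both sides become real
combinations of the same terms. Only real linearity of the forms is used. -/
theorem absCourant_jacobi (s t u : 𝔛 × (𝔛 →ₗ[ℝ] A)) :
    absCourant (absCourant s t) u + absCourant (absCourant t u) s + absCourant (absCourant u s) t =
      (0, absD ((1 / 3 : ℝ) • (absPairing (absCourant s t) u + absPairing (absCourant t u) s
        + absPairing (absCourant u s) t))) := by
  obtain ⟨X, ξ⟩ := s
  obtain ⟨Y, β⟩ := t
  obtain ⟨W, γ⟩ := u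
  have h1 : ⁅Y, X⁆ = -⁅X, Y⁆ := (lie_skew Y X).symm
  have h2 : ⁅W, Y⁆ = -⁅Y, W⁆ := (lie_skew W Y).symm
  have h3 : ⁅X, W⁆ = -⁅W, X⁆ := (lie_skew X W).symm
  refine Prod.ext ?_ (LinearMap.ext fun Z => ?_)
  · have h := lie_jacobi X Y W
    simp only [absCourant, Prod.fst_add]
    rw [← lie_skew ⁅X, Y⁆ W, ← lie_skew ⁅Y, W⁆ X, ← lie_skew ⁅W, X⁆ Y, ← neg_add, ← neg_add,
      neg_eq_zero, ← h]
    abel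
  · simp only [absCourant, absPairing, Prod.snd_add, LinearMap.add_apply, LinearMap.sub_apply,
      LinearMap.smul_apply, LieHom.lie_apply, absD_apply, lie_add, lie_sub, lie_smul,
      lie_lie, h1, h2, h3, lie_neg, map_neg]
    module

theorem absCourant_compat (s t u : 𝔛 × (𝔛 →ₗ[ℝ] A)) :
    ⁅s.1, absPairing t u⁆ = absPairing (absCourant s t + (0, absD (absPairing s t))) u +
      absPairing t (absCourant s u + (0, absD (absPairing s u))) := by
  obtain ⟨X, ξ⟩ := s
  obtain ⟨Y, β⟩ := t
  obtain ⟨W, γ⟩ := u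
  have h1 : ⁅Y, X⁆ = -⁅X, Y⁆ := (lie_skew Y X).symm
  have h2 : ⁅W, Y⁆ = -⁅Y, W⁆ := (lie_skew W Y).symm
  simp only [absCourant, absPairing, Prod.snd_add, Prod.fst_add, LinearMap.add_apply,
    LinearMap.sub_apply,
    LinearMap.smul_apply, LieHom.lie_apply, absD_apply, lie_add, lie_sub, lie_smul,
    map_neg, h2, add_zero]
  module

end AbstractCourant

/-! ### Smooth sections as elements of the abstract Courant algebra -/

section Bundled

variable [IsManifold (𝓡 (2 * n + 1)) ∞ M]

theorem SmoothVF.const_smul (c : ℝ) {X : ∀ x : M, TangentSpace (𝓡 (2 * n + 1)) x}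
    (hX : SmoothVF X) : SmoothVF (fun x => c • X x) :=
  SmoothVF.smul (SmoothFun.const c) hX

variable (n M) in
/-- The space of smooth vector fields. -/
def VF : Submodule ℝ (∀ x : M, TangentSpace (𝓡 (2 * n + 1)) x) where
  carrier := {X | SmoothVF X}
  add_mem' hX hY := SmoothVF.add hX hY
  zero_mem' := SmoothVF.zero
  smul_mem' c _ hX := SmoothVF.const_smul c hX

omit [IsManifold (𝓡 (2 * n + 1)) ∞ M] in
theorem SmoothFun.add {f g : M → ℝ} (hf : SmoothFun n f) (hg : SmoothFun n g) :
    SmoothFun n (fun x => f x + g x) := ContMDiff.add hf hg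

omit [IsManifold (𝓡 (2 * n + 1)) ∞ M] in
theorem SmoothFun.mul {f g : M → ℝ} (hf : SmoothFun n f) (hg : SmoothFun n g) :
    SmoothFun n (fun x => f x * g x) := ContMDiff.mul hf hg

omit [IsManifold (𝓡 (2 * n + 1)) ∞ M] in
theorem SmoothFun.sub {f g : M → ℝ} (hf : SmoothFun n f) (hg : SmoothFun n g) :
    SmoothFun n (fun x => f x - g x) := ContMDiff.sub hf hg

omit [IsManifold (𝓡 (2 * n + 1)) ∞ M] in
theorem SmoothFun.mdiff {f : M → ℝ} (hf : SmoothFun n f) (x : M) :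
    MDifferentiableAt (𝓡 (2 * n + 1)) 𝓘(ℝ, ℝ) f x :=
  (hf x).mdifferentiableAt (by simp)

variable (n M) in
omit [IsManifold (𝓡 (2 * n + 1)) ∞ M] in
/-- The space of smooth functions. -/
def FN : Submodule ℝ (M → ℝ) where
  carrier := {f | SmoothFun n f}
  add_mem' hf hg := SmoothFun.add hf hg
  zero_mem' := SmoothFun.const 0
  smul_mem' c _ hf := SmoothFun.mul (SmoothFun.const c) hf

theorem SmoothVF.mdiff {X : ∀ x : M, TangentSpace (𝓡 (2 * n + 1)) x} (hX : SmoothVF X) (x : M) :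
    MDifferentiableAt (𝓡 (2 * n + 1)) (𝓡 (2 * n + 1)).tangent
      (fun x => (⟨x, X x⟩ : TangentBundle (𝓡 (2 * n + 1)) M)) x :=
  (hX x).mdifferentiableAt (by simp)

instance : LieRing (VF n M) where
  bracket X Y := ⟨mlieBracket (𝓡 (2 * n + 1)) X.1 Y.1, X.2.mlieBracket Y.2⟩
  add_lie X Y Z := Subtype.ext <| funext fun x => mlieBracket_add_left (X.2.mdiff x) (Y.2.mdiff x)
  lie_add X Y Z := Subtype.ext <| funext fun x => mlieBracket_add_right (Y.2.mdiff x) (Z.2.mdiff x)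
  lie_self X := Subtype.ext mlieBracket_self
  leibniz_lie X Y Z := by
    have : IsManifold (𝓡 (2 * n + 1)) (minSmoothness ℝ 3) M :=
      IsManifold.of_le (n := ∞) (by
        rw [minSmoothness_of_isRCLikeNormedField]
        exact WithTop.coe_le_coe.2 (le_top : (3 : ℕ∞) ≤ ⊤))
    have h : ∀ X : VF n M, ContMDiff (𝓡 (2 * n + 1)) (𝓡 (2 * n + 1)).tangent (minSmoothness ℝ 2)
        (fun x => (⟨x, X.1 x⟩ : TangentBundle (𝓡 (2 * n + 1)) M)) := fun X =>
      ContMDiff.of_le X.2 (by rw [minSmoothness_of_isRCLikeNormedField]; exact two_le_infty)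
    exact Subtype.ext (leibniz_identity_mlieBracket (h X) (h Y) (h Z))

instance : LieAlgebra ℝ (VF n M) where
  lie_smul _ _ Y := Subtype.ext <| funext fun x => mlieBracket_const_smul_right (Y.2.mdiff x)

omit [IsManifold (𝓡 (2 * n + 1)) ∞ M] in
theorem dFun_add {f g : M → ℝ} (hf : SmoothFun n f) (hg : SmoothFun n g) (x : M) :
    dFun n (fun y => f y + g y) x = dFun n f x + dFun n g x :=
  (((hf.mdiff x).hasMFDerivAt).add ((hg.mdiff x).hasMFDerivAt)).mfderiv

omit [IsManifold (𝓡 (2 * n + 1)) ∞ M] in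
theorem dFun_mul {f g : M → ℝ} (hf : SmoothFun n f) (hg : SmoothFun n g) (x : M) :
    dFun n (fun y => f y * g y) x = f x • dFun n g x + g x • dFun n f x := by
  refine ((((hf.mdiff x).hasMFDerivAt).mul' ((hg.mdiff x).hasMFDerivAt)).mfderiv).trans ?_
  ext v
  change f x * dFun n g x v + dFun n f x v * g x = f x * dFun n g x v + g x * dFun n f x v
  ring

omit [IsManifold (𝓡 (2 * n + 1)) ∞ M] in
theorem dFun_const (c : ℝ) (x : M) : dFun n (fun _ : M => c) x = 0 :=
  (hasMFDerivAt_const c x).mfderiv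

omit [IsManifold (𝓡 (2 * n + 1)) ∞ M] in
theorem dFun_const_mul (c : ℝ) {f : M → ℝ} (hf : SmoothFun n f) (x : M) :
    dFun n (fun y => c * f y) x = c • dFun n f x := by
  rw [dFun_mul (SmoothFun.const c) hf, dFun_const, smul_zero, add_zero]

instance [T2Space M] : LieRingModule (VF n M) (FN n M) where
  bracket X f := ⟨fun x => dFun n f.1 x (X.1 x), f.2.dFun_apply X.2⟩
  add_lie X Y f := Subtype.ext <| funext fun x => (dFun n f.1 x).map_add _ _
  lie_add X f g := Subtype.ext <| funext fun x =>
    DFunLike.congr_fun (dFun_add f.2 g.2 x) (X.1 x)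
  leibniz_lie X Y f := by
    refine Subtype.ext <| funext fun x => ?_
    exact (sub_eq_iff_eq_add.1 (dFun_mlieBracket f.2 X.2 Y.2 x).symm)

instance [T2Space M] : LieModule ℝ (VF n M) (FN n M) where
  smul_lie c X f := Subtype.ext <| funext fun x => (dFun n f.1 x).map_smul c (X.1 x)
  lie_smul c X f := Subtype.ext <| funext fun x =>
    DFunLike.congr_fun (dFun_const_mul c f.2 x) (X.1 x)

/-- The functional on vector fields defined by a smooth one-form. -/
def SmoothForm.functional {ξ : ∀ x : M, Cotangent n x} (hξ : SmoothForm ξ) :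
    VF n M →ₗ[ℝ] FN n M where
  toFun X := ⟨fun x => ξ x (X.1 x), hξ.apply X.2⟩
  map_add' _ _ := Subtype.ext <| funext fun x => (ξ x).map_add _ _
  map_smul' c _ := Subtype.ext <| funext fun x => (ξ x).map_smul c _

theorem cotangent_ext [T2Space M] {x : M} {ξ η : Cotangent n x}
    (h : ∀ X : VF n M, ξ (X.1 x) = η (X.1 x)) : ξ = η := by
  ext v
  obtain ⟨X, hX, rfl⟩ := exists_smoothVF_eq (n := n) v
  exact h ⟨X, hX⟩

/-- A smooth section of `TM ⊕ T*M` as an element of the abstract Courant algebra. -/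
def Smooth.bundle {s : ∀ x : M, GT n x} (hs : Smooth s) : VF n M × (VF n M →ₗ[ℝ] FN n M) :=
  (⟨fun x => (s x).1, hs.1⟩, hs.2.functional)

/-- Every tangent vector is a value of a smooth field, so nothing is lost on passing to the abstract
algebra, and identities proved there come back as identities of sections. -/
theorem Smooth.ext_bundle [T2Space M] {s t : ∀ x : M, GT n x} (hs : Smooth s) (ht : Smooth t)
    (h : hs.bundle = ht.bundle) : s = t := by
  funext x
  refine Prod.ext (congrFun (congrArg (fun a => a.1.1) h) x) (cotangent_ext fun X => ?_)
  exact congrFun (congrArg (fun a => (a.2 X).1) h) x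

theorem Smooth.pairing {s t : ∀ x : M, GT n x} (hs : Smooth s) (ht : Smooth t) :
    SmoothFun n (fun x => GenContact.pairing x (s x) (t x)) :=
  (SmoothFun.const (1 / 2)).mul ((hs.2.apply ht.1).add (ht.2.apply hs.1))

theorem Smooth.absPairing_bundle {s t : ∀ x : M, GT n x} (hs : Smooth s) (ht : Smooth t) :
    absPairing hs.bundle ht.bundle = ⟨_, hs.pairing ht⟩ := rfl

theorem courant_snd_apply [T2Space M] {s t : ∀ x : M, GT n x} (hs : Smooth s) (ht : Smooth t) (Z : VF n M)
    (x : M) : (courant s t x).2 (Z.1 x) = ((absCourant hs.bundle ht.bundle).2 Z).1 x := by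
  have h1 := lieForm_apply ht.2 hs.1 Z.2 x
  have h2 := lieForm_apply hs.2 ht.1 Z.2 x
  have h : (courant s t x).2 (Z.1 x) = lieForm (fun y => (s y).1) (fun y => (t y).2) x (Z.1 x)
      - lieForm (fun y => (t y).1) (fun y => (s y).2) x (Z.1 x)
      - (1 / 2 : ℝ) • dFun n (fun y => (t y).2 (s y).1 - (s y).2 (t y).1) x (Z.1 x) := rfl
  rw [h, h1, h2]
  rfl

theorem Smooth.courant [T2Space M] {s t : ∀ x : M, GT n x} (hs : Smooth s) (ht : Smooth t) :
    Smooth (courant s t) := by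
  refine ⟨hs.1.mlieBracket ht.1, SmoothForm.of_apply fun Z hZ => ?_⟩
  have : (fun x => (GenContact.courant s t x).2 (Z x)) =
      ((absCourant hs.bundle ht.bundle).2 ⟨Z, hZ⟩).1 :=
    funext fun x => courant_snd_apply hs ht ⟨Z, hZ⟩ x
  rw [this]
  exact ((absCourant hs.bundle ht.bundle).2 ⟨Z, hZ⟩).2

theorem Smooth.bundle_courant [T2Space M] {s t : ∀ x : M, GT n x} (hs : Smooth s)
    (ht : Smooth t) : (hs.courant ht).bundle = absCourant hs.bundle ht.bundle := by
  refine Prod.ext (Subtype.ext rfl) (LinearMap.ext fun Z => Subtype.ext (funext fun x => ?_))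
  exact courant_snd_apply hs ht Z x

theorem Smooth.add {s t : ∀ x : M, GT n x} (hs : Smooth s) (ht : Smooth t) :
    Smooth (fun x => s x + t x) := ⟨hs.1.add ht.1, hs.2.add ht.2⟩

theorem Smooth.smul {f : M → ℝ} {s : ∀ x : M, GT n x} (hf : SmoothFun n f) (hs : Smooth s) :
    Smooth (fun x => f x • s x) := ⟨SmoothVF.smul hf hs.1, SmoothForm.smul hf hs.2⟩

theorem Smooth.zero : Smooth (fun x : M => (0 : GT n x)) := ⟨SmoothVF.zero, SmoothForm.zero⟩

theorem Smooth.neg {s : ∀ x : M, GT n x} (hs : Smooth s) : Smooth (fun x => -s x) := by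
  have h : (fun x => -s x) = fun x => (-1 : ℝ) • s x :=
    funext fun x => (neg_one_smul ℝ (s x)).symm
  rw [h]
  exact Smooth.smul (SmoothFun.const (-1)) hs

theorem Smooth.sub {s t : ∀ x : M, GT n x} (hs : Smooth s) (ht : Smooth t) :
    Smooth (fun x => s x - t x) := by
  simpa [sub_eq_add_neg] using hs.add ht.neg

theorem SmoothFun.smooth_dFun [T2Space M] {f : M → ℝ} (hf : SmoothFun n f) :
    Smooth (fun x : M => ((0, dFun n f x) : GT n x)) := ⟨SmoothVF.zero, hf.smoothForm_dFun⟩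

theorem SmoothFun.bundle_dFun [T2Space M] {f : M → ℝ} (hf : SmoothFun n f) :
    hf.smooth_dFun.bundle = (0, absD ⟨f, hf⟩) := rfl

/-- The Jacobi identity for the Courant bracket, up to a differential. -/
theorem courant_jacobi [T2Space M] {s t u : ∀ x : M, GT n x} (hs : Smooth s) (ht : Smooth t)
    (hu : Smooth u) (x : M) :
    courant (courant s t) u x + courant (courant t u) s x + courant (courant u s) t x =
      (0, dFun n (fun y => (1 / 3 : ℝ) * (pairing y (courant s t y) (u y)
        + pairing y (courant t u y) (s y) + pairing y (courant u s y) (t y))) x) := by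
  have hf : SmoothFun n (fun y => (1 / 3 : ℝ) * (pairing y (courant s t y) (u y)
        + pairing y (courant t u y) (s y) + pairing y (courant u s y) (t y))) :=
    (SmoothFun.const _).mul ((((hs.courant ht).pairing hu).add ((ht.courant hu).pairing hs)).add
      ((hu.courant hs).pairing ht))
  have h := absCourant_jacobi hs.bundle ht.bundle hu.bundle
  simp only [← Smooth.bundle_courant] at h
  exact congrFun (Smooth.ext_bundle ((((hs.courant ht).courant hu).add
    ((ht.courant hu).courant hs)).add ((hu.courant hs).courant ht)) hf.smooth_dFun h) x

/-- Invariance of the pairing under the Courant bracket, up to differentials. -/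
theorem courant_compat [T2Space M] {s t u : ∀ x : M, GT n x} (hs : Smooth s) (ht : Smooth t)
    (hu : Smooth u) (x : M) :
    dFun n (fun y => pairing y (t y) (u y)) x (s x).1 =
      pairing x (courant s t x + (0, dFun n (fun y => pairing y (s y) (t y)) x)) (u x) +
      pairing x (t x) (courant s u x + (0, dFun n (fun y => pairing y (s y) (u y)) x)) := by
  have h := absCourant_compat hs.bundle ht.bundle hu.bundle
  simp only [← Smooth.bundle_courant, Smooth.absPairing_bundle, ← SmoothFun.bundle_dFun] at h
  exact congrFun (congrArg Subtype.val h) x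

end Bundled

/-! ### Skew-symmetry, additivity and Leibniz rule of the Courant bracket -/

section CourantIdentities

variable [IsManifold (𝓡 (2 * n + 1)) ∞ M]

omit [IsManifold (𝓡 (2 * n + 1)) ∞ M] in
theorem pairing_apply (x : M) (a b : GT n x) :
    pairing x a b = (1 / 2 : ℝ) * (a.2 b.1 + b.2 a.1) := rfl

omit [IsManifold (𝓡 (2 * n + 1)) ∞ M] in
theorem pairing_comm (x : M) (a b : GT n x) : pairing x a b = pairing x b a := by
  rw [pairing_apply, pairing_apply, add_comm]

omit [IsManifold (𝓡 (2 * n + 1)) ∞ M] in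
theorem dFun_sub {f g : M → ℝ} (hf : SmoothFun n f) (hg : SmoothFun n g) (x : M) :
    dFun n (fun y => f y - g y) x = dFun n f x - dFun n g x :=
  (((hf.mdiff x).hasMFDerivAt).sub ((hg.mdiff x).hasMFDerivAt)).mfderiv

/-- The form part written with derivatives of functions and Lie brackets only, so that the rules
below reduce to ring identities on a test field `Z`. -/
theorem courant_snd_apply' [T2Space M] {s t : ∀ x : M, GT n x} (hs : Smooth s) (ht : Smooth t)
    {Z : ∀ x : M, TangentSpace (𝓡 (2 * n + 1)) x} (hZ : SmoothVF Z) (x : M) :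
    (courant s t x).2 (Z x) =
      (dFun n (fun y => (t y).2 (Z y)) x (s x).1
        - (t x).2 (mlieBracket (𝓡 (2 * n + 1)) (fun y => (s y).1) Z x))
      - (dFun n (fun y => (s y).2 (Z y)) x (t x).1
        - (s x).2 (mlieBracket (𝓡 (2 * n + 1)) (fun y => (t y).1) Z x))
      - (1 / 2 : ℝ) * (dFun n (fun y => (t y).2 (s y).1) x (Z x)
        - dFun n (fun y => (s y).2 (t y).1) x (Z x)) := by
  have h : (courant s t x).2 (Z x) = lieForm (fun y => (s y).1) (fun y => (t y).2) x (Z x)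
      - lieForm (fun y => (t y).1) (fun y => (s y).2) x (Z x)
      - (1 / 2 : ℝ) • dFun n (fun y => (t y).2 (s y).1 - (s y).2 (t y).1) x (Z x) := rfl
  rw [h, lieForm_apply ht.2 hs.1 hZ, lieForm_apply hs.2 ht.1 hZ,
    dFun_sub (ht.2.apply hs.1) (hs.2.apply ht.1)]
  rfl

theorem gt_ext [T2Space M] {x : M} {a b : GT n x} (h₁ : a.1 = b.1)
    (h₂ : ∀ Z : ∀ x : M, TangentSpace (𝓡 (2 * n + 1)) x, SmoothVF Z → a.2 (Z x) = b.2 (Z x)) :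
    a = b :=
  Prod.ext h₁ (cotangent_ext fun Z => h₂ Z.1 Z.2)

theorem courant_skew [T2Space M] {s t : ∀ x : M, GT n x} (hs : Smooth s) (ht : Smooth t) (x : M) :
    courant s t x = -courant t s x := by
  refine gt_ext mlieBracket_swap_apply fun Z hZ => ?_
  change _ = -(courant t s x).2 (Z x)
  rw [courant_snd_apply' hs ht hZ, courant_snd_apply' ht hs hZ]
  ring

theorem courant_add_right [T2Space M] {s t u : ∀ x : M, GT n x} (hs : Smooth s) (ht : Smooth t)
    (hu : Smooth u) (x : M) :
    courant s (fun y => t y + u y) x = courant s t x + courant s u x := by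
  refine gt_ext (mlieBracket_add_right (ht.1.mdiff x) (hu.1.mdiff x)) fun Z hZ => ?_
  change _ = (courant s t x).2 (Z x) + (courant s u x).2 (Z x)
  rw [courant_snd_apply' hs (ht.add hu) hZ, courant_snd_apply' hs ht hZ,
    courant_snd_apply' hs hu hZ]
  have h1 : dFun n (fun y => (t y + u y).2 (Z y)) x =
    dFun n (fun y => (t y).2 (Z y)) x + dFun n (fun y => (u y).2 (Z y)) x :=
    dFun_add (ht.2.apply hZ) (hu.2.apply hZ) x
  have h2 : dFun n (fun y => (t y + u y).2 (s y).1) x =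
    dFun n (fun y => (t y).2 (s y).1) x + dFun n (fun y => (u y).2 (s y).1) x :=
    dFun_add (ht.2.apply hs.1) (hu.2.apply hs.1) x
  have h3 : dFun n (fun y => (s y).2 (t y + u y).1) x =
      dFun n (fun y => (s y).2 (t y).1) x + dFun n (fun y => (s y).2 (u y).1) x := by
    rw [← dFun_add (hs.2.apply ht.1) (hs.2.apply hu.1) x]
    congr 1
    funext y
    exact (s y).2.map_add _ _
  have h4 : mlieBracket (𝓡 (2 * n + 1)) (fun y => (t y + u y).1) Z x =
    mlieBracket (𝓡 (2 * n + 1)) (fun y => (t y).1) Z x +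
    mlieBracket (𝓡 (2 * n + 1)) (fun y => (u y).1) Z x :=
    mlieBracket_add_left (ht.1.mdiff x) (hu.1.mdiff x)
  rw [h1, h2, h3, h4]
  have h5 : (t x + u x).1 = (t x).1 + (u x).1 := rfl
  have h6 : (t x + u x).2 = (t x).2 + (u x).2 := rfl
  rw [h5, h6]
  simp only [add_apply, map_add]
  ring

/-- The extra `df` term has two sources: `-𝓛_{fY} ξ` contributes `-ξ(Y) df`, and `-½ d(f (β(X) -
ξ(Y)))` contributes `-½ (β(X) - ξ(Y)) df`. Their sum is `-⟨s, t⟩ df`. -/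
theorem courant_smul_right [T2Space M] {f : M → ℝ} {s t : ∀ x : M, GT n x} (hf : SmoothFun n f)
    (hs : Smooth s) (ht : Smooth t) (x : M) :
    courant s (fun y => f y • t y) x = f x • courant s t x + dFun n f x (s x).1 • t x
      - pairing x (s x) (t x) • ((0, dFun n f x) : GT n x) := by
  refine gt_ext ?_ fun Z hZ => ?_
  · have h := mlieBracket_smul_right (V := fun y => (s y).1) (hf.mdiff x) (ht.1.mdiff x)
    refine h.trans ?_
    change dFun n f x (s x).1 • (t x).1 + f x • mlieBracket (𝓡 (2 * n + 1)) _ _ x =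
      f x • mlieBracket (𝓡 (2 * n + 1)) (fun y => (s y).1) (fun y => (t y).1) x
      + dFun n f x (s x).1 • (t x).1 -
      pairing x (s x) (t x) • (0 : TangentSpace (𝓡 (2 * n + 1)) x)
    rw [smul_zero, sub_zero]
    exact add_comm _ _
  · change _ = f x * (courant s t x).2 (Z x) + dFun n f x (s x).1 * (t x).2 (Z x)
      - pairing x (s x) (t x) * dFun n f x (Z x)
    rw [courant_snd_apply' hs (Smooth.smul hf ht) hZ, courant_snd_apply' hs ht hZ]
    have h1 : dFun n (fun y => (f y • t y).2 (Z y)) x = f x • dFun n (fun y => (t y).2 (Z y)) x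
        + (t x).2 (Z x) • dFun n f x := dFun_mul hf (ht.2.apply hZ) x
    have h2 : dFun n (fun y => (f y • t y).2 (s y).1) x =
        f x • dFun n (fun y => (t y).2 (s y).1) x + (t x).2 (s x).1 • dFun n f x :=
      dFun_mul hf (ht.2.apply hs.1) x
    have h3 : dFun n (fun y => (s y).2 (f y • t y).1) x =
        f x • dFun n (fun y => (s y).2 (t y).1) x + (s x).2 (t x).1 • dFun n f x := by
      rw [← dFun_mul hf (hs.2.apply ht.1) x]
      congr 1
      funext y
      exact (s y).2.map_smul _ _
    have h4 : mlieBracket (𝓡 (2 * n + 1)) (fun y => (f y • t y).1) Z x =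
        -dFun n f x (Z x) • (t x).1 +
        f x • mlieBracket (𝓡 (2 * n + 1)) (fun y => (t y).1) Z x :=
      mlieBracket_smul_left (hf.mdiff x) (ht.1.mdiff x)
    rw [h1, h2, h3, h4]
    have h5 : (f x • t x).1 = f x • (t x).1 := rfl
    have h6 : (f x • t x).2 = f x • (t x).2 := rfl
    rw [h5, h6, pairing_apply]
    simp only [add_apply, map_add, smul_apply, map_smul, smul_eq_mul]
    ring

theorem courant_add_left [T2Space M] {s t u : ∀ x : M, GT n x} (hs : Smooth s) (ht : Smooth t)
    (hu : Smooth u) (x : M) :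
    courant (fun y => t y + u y) s x = courant t s x + courant u s x := by
  rw [courant_skew (ht.add hu) hs, courant_add_right hs ht hu, courant_skew ht hs,
    courant_skew hu hs, neg_add]

theorem courant_smul_left [T2Space M] {f : M → ℝ} {s t : ∀ x : M, GT n x} (hf : SmoothFun n f)
    (hs : Smooth s) (ht : Smooth t) (x : M) :
    courant (fun y => f y • s y) t x = f x • courant s t x - dFun n f x (t x).1 • s x
      + pairing x (s x) (t x) • ((0, dFun n f x) : GT n x) := by
  rw [courant_skew (Smooth.smul hf hs) ht, courant_smul_right hf ht hs, courant_skew hs ht,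
    pairing_comm x (s x), smul_neg]
  abel

end CourantIdentities

/-! ### The line `T𝓡`, its orthogonal, and `R`-invariant sections -/

namespace GenAlmostContact

variable [IsManifold (𝓡 (2 * n + 1)) ∞ M] (S : GenAlmostContact n M)

/-- The one-form `η = η₊ + η₋`, which satisfies `η(R) = 1`. -/
def eta (x : M) : Cotangent n x := (S.E .plus x).2 + (S.E .minus x).2

/-- `η(R) = ⟨E₊ + E₋, E₊ + E₋⟩ = 2 ⟨E₊, E₋⟩`. Besides making `R` nonvanishing, this gives a smooth
complement to `ann(R)`. -/
theorem eta_R (x : M) : S.eta x (S.R x) = 1 := by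
  have h1 := S.pairing_E x
  have h2 := S.null_E .plus x
  have h3 := S.null_E .minus x
  rw [pairing_apply] at h1 h2 h3
  rw [eta, R]
  simp only [add_apply, map_add]
  linarith

/-- The vector field `R` as a section of `TM ⊕ T*M`. -/
def Rsec (x : M) : GT n x := (S.R x, 0)

theorem smooth_Rsec : Smooth S.Rsec := ⟨(S.smooth_E .plus).1.add (S.smooth_E .minus).1, .zero⟩

theorem smooth_eta : SmoothForm S.eta := (S.smooth_E .plus).2.add (S.smooth_E .minus).2

theorem pairing_Rsec (x : M) (a : GT n x) : pairing x a (S.Rsec x) = 1 / 2 * a.2 (S.R x) := by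
  simp [pairing_apply, Rsec]

theorem mem_TR {x : M} {a : GT n x} : a ∈ S.TR x ↔ ∃ c : ℝ, c • S.Rsec x = a :=
  Submodule.mem_span_singleton

theorem Rsec_mem_TR (x : M) : S.Rsec x ∈ S.TR x := Submodule.mem_span_singleton_self _

/-- The form `η` reads off the coefficient along `R`, so a smooth section of `T𝓡` has a smooth
coefficient. -/
theorem eq_smul_of_mem_TR {x : M} {a : GT n x} (h : a ∈ S.TR x) :
    a = S.eta x a.1 • S.Rsec x := by
  obtain ⟨c, rfl⟩ := S.mem_TR.1 h
  have h1 : (c • S.Rsec x).1 = c • S.R x := rfl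
  rw [h1, map_smul, eta_R, smul_eq_mul, mul_one]

theorem mem_TRperp {x : M} {a : GT n x} : a ∈ S.TRperp x ↔ pairing x a (S.Rsec x) = 0 := by
  rw [pairing_Rsec]
  change a.1 ∈ ⊤ ∧ a.2 (S.R x) = 0 ↔ _
  simp

theorem TR_le_TRperp (x : M) : S.TR x ≤ S.TRperp x := by
  intro a ha
  obtain ⟨c, rfl⟩ := S.mem_TR.1 ha
  rw [mem_TRperp, pairing_Rsec]
  simp [Rsec]

theorem pairing_TR {x : M} {a b : GT n x} (ha : a ∈ S.TR x) (hb : b ∈ S.TRperp x) :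
    pairing x a b = 0 := by
  obtain ⟨c, rfl⟩ := S.mem_TR.1 ha
  rw [pairing_comm, map_smul, S.mem_TRperp.1 hb, smul_zero]

/-- In the Leibniz rule the `df` term carries the factor `⟨R, s⟩ = 0`, and the other extra term is a
multiple of `R`. -/
theorem courant_smul_Rsec_mem [T2Space M] {f : M → ℝ} (hf : SmoothFun n f)
    {s : ∀ x : M, GT n x} (hs : Smooth s) (hp : ∀ x, s x ∈ S.TRperp x) {x : M}
    (h : courant S.Rsec s x ∈ S.TR x) : courant (fun y => f y • S.Rsec y) s x ∈ S.TR x := by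
  rw [courant_smul_left hf S.smooth_Rsec hs, S.pairing_TR (S.Rsec_mem_TR x) (hp x), zero_smul,
    add_zero]
  exact sub_mem (Submodule.smul_mem _ _ h) (Submodule.smul_mem _ _ (S.Rsec_mem_TR x))

theorem mem_invSections_iff [T2Space M] {s : ∀ x : M, GT n x} :
    s ∈ S.invSections ↔ Smooth s ∧ (∀ x, s x ∈ S.TRperp x) ∧
      ∀ x, courant S.Rsec s x ∈ S.TR x := by
  refine ⟨fun h => ⟨h.1, h.2.1, h.2.2 _ S.smooth_Rsec S.Rsec_mem_TR⟩, fun h => ⟨h.1, h.2.1, ?_⟩⟩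
  intro r hr hrT x
  have h1 : r = fun y => S.eta y (r y).1 • S.Rsec y :=
    funext fun y => S.eq_smul_of_mem_TR (hrT y)
  rw [h1]
  exact S.courant_smul_Rsec_mem (S.smooth_eta.apply hr.1) h.1 h.2.1 (h.2.2 x)

theorem courant_Rsec_Rsec (x : M) [T2Space M] : courant S.Rsec S.Rsec x = 0 := by
  have h := courant_skew S.smooth_Rsec S.smooth_Rsec x
  rw [eq_neg_iff_add_eq_zero, ← two_smul ℝ] at h
  exact (smul_eq_zero.1 h).resolve_left two_ne_zero

/-- Smooth sections of `T𝓡` are `R`-invariant. -/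
theorem mem_invSections_of_TR [T2Space M] {r : ∀ x : M, GT n x} (hr : Smooth r)
    (hrT : ∀ x, r x ∈ S.TR x) : r ∈ S.invSections := by
  refine S.mem_invSections_iff.2 ⟨hr, fun x => S.TR_le_TRperp x (hrT x), fun x => ?_⟩
  rw [courant_skew S.smooth_Rsec hr]
  have h1 : r = fun y => S.eta y (r y).1 • S.Rsec y :=
    funext fun y => S.eq_smul_of_mem_TR (hrT y)
  rw [h1]
  refine neg_mem (S.courant_smul_Rsec_mem (S.smooth_eta.apply hr.1) S.smooth_Rsec
    (fun x => S.TR_le_TRperp x (S.Rsec_mem_TR x)) ?_)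
  rw [courant_Rsec_Rsec]
  exact zero_mem _

variable {S}

theorem courant_mem_TR_right [T2Space M] {s r : ∀ x : M, GT n x} (hs : s ∈ S.invSections)
    (hr : Smooth r) (hrT : ∀ x, r x ∈ S.TR x) (x : M) : courant s r x ∈ S.TR x := by
  rw [courant_skew hs.1 hr]
  exact neg_mem (hs.2.2 r hr hrT x)

theorem pairing_Rsec_eq_zero {s : ∀ x : M, GT n x} (hs : s ∈ S.invSections) :
    (fun x => pairing x (s x) (S.Rsec x)) = fun _ => 0 :=
  funext fun x => S.mem_TRperp.1 (hs.2.1 x)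

/-- The pairing of two `R`-invariant sections is basic. -/
theorem pairing_mem_basicFun [T2Space M] {s t : ∀ x : M, GT n x} (hs : s ∈ S.invSections)
    (ht : t ∈ S.invSections) : (fun x => pairing x (s x) (t x)) ∈ S.basicFun := by
  refine ⟨hs.1.pairing ht.1, fun x => ?_⟩
  -- Differentiate `⟨s, t⟩` along `R`: the functions `⟨R, s⟩` and `⟨R, t⟩` vanish identically, and
  -- `[R, s]`, `[R, t]` lie in `T𝓡`, which is orthogonal to `t` and `s`.
  have h := courant_compat S.smooth_Rsec hs.1 ht.1 x
  have hs' : (fun x => pairing x (S.Rsec x) (s x)) = fun _ => 0 := by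
    simp_rw [pairing_comm _ (S.Rsec _)]; exact pairing_Rsec_eq_zero hs
  have ht' : (fun x => pairing x (S.Rsec x) (t x)) = fun _ => 0 := by
    simp_rw [pairing_comm _ (S.Rsec _)]; exact pairing_Rsec_eq_zero ht
  rw [hs', ht', dFun_const] at h
  have h0 : ((0, 0) : GT n x) = 0 := rfl
  rw [h0, add_zero, add_zero,
    S.pairing_TR (hs.2.2 _ S.smooth_Rsec S.Rsec_mem_TR x) (ht.2.1 x), pairing_comm,
    S.pairing_TR (ht.2.2 _ S.smooth_Rsec S.Rsec_mem_TR x) (hs.2.1 x), add_zero] at h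
  exact h

/-- Differentiate `⟨t, R⟩ = 0` along `s`. The term `[s, R]` lies in `T𝓡`, and `d⟨s, t⟩` kills `R`
because `⟨s, t⟩` is basic, so only `⟨[s, t], R⟩` remains. -/
theorem courant_mem_TRperp [T2Space M] {s t : ∀ x : M, GT n x} (hs : s ∈ S.invSections)
    (ht : t ∈ S.invSections) (x : M) : courant s t x ∈ S.TRperp x := by
  have h := courant_compat hs.1 ht.1 S.smooth_Rsec x
  have h0 : ((0, 0) : GT n x) = 0 := rfl
  have h1 : pairing x ((0, dFun n (fun y => pairing y (s y) (t y)) x) : GT n x) (S.Rsec x) = 0 := by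
    rw [pairing_Rsec, (pairing_mem_basicFun hs ht).2 x, mul_zero]
  rw [pairing_Rsec_eq_zero hs, pairing_Rsec_eq_zero ht, dFun_const, h0, add_zero, map_add,
    LinearMap.add_apply, h1, add_zero, pairing_comm x (t x),
    S.pairing_TR (courant_mem_TR_right hs S.smooth_Rsec S.Rsec_mem_TR x) (ht.2.1 x), add_zero] at h
  exact S.mem_TRperp.2 h.symm

/-- `R`-invariant sections are closed under the Courant bracket. -/
theorem courant_mem_invSections [T2Space M] {s t : ∀ x : M, GT n x} (hs : s ∈ S.invSections)
    (ht : t ∈ S.invSections) : courant s t ∈ S.invSections := by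
  refine S.mem_invSections_iff.2 ⟨hs.1.courant ht.1, courant_mem_TRperp hs ht, fun x => ?_⟩
  have hR := S.smooth_Rsec
  have htR := courant_mem_TR_right ht hR S.Rsec_mem_TR
  have hRs := hs.2.2 _ hR S.Rsec_mem_TR
  -- Jacobi for `s, t, R`: the function under the differential vanishes identically, so `[R, [s,
  -- t]]` is a sum of brackets of sections of `T𝓡` with `s` and `t`.
  have hj := courant_jacobi hs.1 ht.1 hR x
  have hN : (fun y => (1 / 3 : ℝ) * (pairing y (courant s t y) (S.Rsec y)
      + pairing y (courant t S.Rsec y) (s y) + pairing y (courant S.Rsec s y) (t y))) =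
      fun _ => 0 := by
    funext y
    rw [S.mem_TRperp.1 (courant_mem_TRperp hs ht y), S.pairing_TR (htR y) (hs.2.1 y),
      S.pairing_TR (hRs y) (ht.2.1 y)]
    simp
  have h0 : ((0, 0) : GT n x) = 0 := rfl
  rw [hN, dFun_const, h0, add_assoc] at hj
  rw [courant_skew hR (hs.1.courant ht.1), eq_neg_of_add_eq_zero_left hj, neg_neg]
  exact add_mem (hs.2.2 _ (ht.1.courant hR) htR x) (ht.2.2 _ (hR.courant hs.1) hRs x)

end GenAlmostContact

/-! ### Dual families and independence modulo the radical -/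

section LinearAlgebra

variable {K V : Type*} [Field K] [AddCommGroup V] [Module K V]

theorem finrank_map_mkQ_add [FiniteDimensional K V] {T W : Submodule K V} (h : T ≤ W) :
    Module.finrank K (W.map T.mkQ) + Module.finrank K T = Module.finrank K W := by
  have h1 := LinearMap.finrank_range_add_finrank_ker (T.mkQ.domRestrict W)
  rw [LinearMap.range_domRestrict, LinearMap.ker_domRestrict, Submodule.ker_mkQ] at h1
  rw [← h1, (Submodule.submoduleOfEquivOfLe h).finrank_eq.symm]
  rfl

/-- Vectors in `W` which are independent modulo the radical `T` of a bilinear form on `W` have a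
dual family in `W`. -/
theorem exists_dual_family (B : LinearMap.BilinForm K V) {T W : Submodule K V}
    (hB : ∀ a ∈ W, (∀ b ∈ W, B a b = 0) → a ∈ T) {ι : Type*} [Fintype ι] [DecidableEq ι]
    {a : ι → V} (ha : ∀ i, a i ∈ W) (hli : LinearIndependent K (fun i => T.mkQ (a i))) :
    ∃ b : ι → V, (∀ j, b j ∈ W) ∧ ∀ i j, B (a i) (b j) = if i = j then 1 else 0 := by
  let φ : W →ₗ[K] (ι → K) := LinearMap.pi fun i => (B (a i)).domRestrict W
  have hφ : LinearMap.range φ = ⊤ := by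
    by_contra hne
    -- If the `a i` did not pair onto all of `ι → K`, a functional killing the range would give a
    -- nontrivial combination of them orthogonal to `W`, hence in `T`.
    obtain ⟨f, hf0, hf⟩ := Submodule.exists_le_ker_of_lt_top _ (lt_top_iff_ne_top.2 hne)
    apply hf0
    have hfsum : ∀ v : ι → K, f v = ∑ i, v i * f (Pi.single i 1) := by
      intro v
      conv_lhs => rw [pi_eq_sum_univ' v, map_sum]
      refine Finset.sum_congr rfl fun i _ => ?_
      rw [map_smul, smul_eq_mul]
    have hT : ∑ i, f (Pi.single i 1) • a i ∈ T := by
      refine hB _ (W.sum_mem fun i _ => W.smul_mem _ (ha i)) fun b hb => ?_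
      have h1 : f (φ ⟨b, hb⟩) = 0 := hf ⟨⟨b, hb⟩, rfl⟩
      rw [hfsum] at h1
      rw [map_sum, LinearMap.sum_apply, ← h1]
      refine Finset.sum_congr rfl fun i _ => ?_
      simp [φ, mul_comm]
    have h0 : ∑ i, f (Pi.single i 1) • T.mkQ (a i) = 0 := by
      rw [← (Submodule.Quotient.mk_eq_zero T).2 hT, ← Submodule.mkQ_apply, map_sum]
      simp
    have h2 := Fintype.linearIndependent_iff.1 hli _ h0
    ext i
    simpa using h2 i
  have hex : ∀ j, ∃ w : W, φ w = Pi.single j 1 := fun j => LinearMap.range_eq_top.1 hφ _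
  choose w hw using hex
  refine ⟨fun j => w j, fun j => (w j).2, fun i j => ?_⟩
  have := congrFun (hw j) i
  simpa [φ, Pi.single_apply] using this

/-- The `b j` do not see `T`, so a relation modulo `T` is a left null vector of the matrix of
pairings. Since a nonzero determinant is an open condition, this spreads independence from one point
to its neighbours. -/
theorem linearIndependent_mkQ_of_det_ne_zero (B : LinearMap.BilinForm K V) {T : Submodule K V}
    {ι : Type*} [Fintype ι] [DecidableEq ι] {a b : ι → V} (hT : ∀ t ∈ T, ∀ j, B t (b j) = 0)
    (hdet : (Matrix.of fun i j => B (a i) (b j)).det ≠ 0) :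
    LinearIndependent K (fun i => T.mkQ (a i)) := by
  rw [Fintype.linearIndependent_iff]
  intro c hc
  have h1 : ∑ i, c i • a i ∈ T := by
    rw [← Submodule.Quotient.mk_eq_zero, ← Submodule.mkQ_apply, map_sum, ← hc]
    simp
  have h2 : c = 0 := by
    refine Matrix.eq_zero_of_vecMul_eq_zero hdet (funext fun j => ?_)
    have := hT _ h1 j
    rw [map_sum, LinearMap.sum_apply] at this
    simpa [Matrix.vecMul, dotProduct] using this
  exact fun i => congrFun h2 i

end LinearAlgebra

theorem exists_smooth_eq [IsManifold (𝓡 (2 * n + 1)) ∞ M] [T2Space M] {x : M}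
    (a : GT n x) : ∃ s : ∀ y : M, GT n y, Smooth s ∧ s x = a := by
  obtain ⟨X, hX, h1⟩ := exists_smoothVF_eq a.1
  obtain ⟨ξ, hξ, h2⟩ := exists_smoothForm_eq a.2
  exact ⟨fun y => (X y, ξ y), ⟨hX, hξ⟩, Prod.ext h1 h2⟩

/-! ### Rank, nondegeneracy and local frames of `𝕋_𝓡 M` -/

namespace GenAlmostContact

variable [IsManifold (𝓡 (2 * n + 1)) ∞ M] (S : GenAlmostContact n M)

instance (x : M) : FiniteDimensional ℝ (TangentSpace (𝓡 (2 * n + 1)) x) :=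
  inferInstanceAs (FiniteDimensional ℝ (EuclideanSpace ℝ (Fin (2 * n + 1))))

instance (x : M) : FiniteDimensional ℝ (Cotangent n x) :=
  inferInstanceAs (FiniteDimensional ℝ (EuclideanSpace ℝ (Fin (2 * n + 1)) →L[ℝ] ℝ))

omit [IsManifold (𝓡 (2 * n + 1)) ∞ M] in
theorem finrank_GT (x : M) : Module.finrank ℝ (GT n x) = 4 * n + 2 := by
  have h1 : Module.finrank ℝ (TangentSpace (𝓡 (2 * n + 1)) x) = 2 * n + 1 :=
    finrank_euclideanSpace_fin
  have h2 : Module.finrank ℝ (Cotangent n x) = 2 * n + 1 := by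
    have e : (EuclideanSpace ℝ (Fin (2 * n + 1)) →ₗ[ℝ] ℝ) ≃ₗ[ℝ]
      (EuclideanSpace ℝ (Fin (2 * n + 1)) →L[ℝ] ℝ) := LinearMap.toContinuousLinearMap
    refine (e.finrank_eq.symm.trans Subspace.dual_finrank_eq).trans finrank_euclideanSpace_fin
  rw [Module.finrank_prod, h1, h2]
  ring

theorem Rsec_ne_zero (x : M) : S.Rsec x ≠ 0 := by
  intro h
  have h1 := S.eta_R x
  have h2 : S.R x = 0 := congrArg Prod.fst h
  rw [h2, map_zero] at h1
  exact zero_ne_one h1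

omit [IsManifold (𝓡 (2 * n + 1)) ∞ M] in
/-- The natural pairing is nondegenerate. -/
theorem eq_zero_of_pairing {x : M} {a : GT n x} (h : ∀ b, pairing x a b = 0) : a = 0 := by
  have h2 : a.2 = 0 := by
    ext v
    simpa [pairing_apply] using h (v, 0)
  have h1 : a.1 = 0 := by
    by_contra hne
    let v : EuclideanSpace ℝ (Fin (2 * n + 1)) := a.1
    have hv : inner ℝ v v ≠ 0 := inner_self_ne_zero.2 hne
    have h3 := h (0, innerSL ℝ v)
    rw [pairing_apply, h2] at h3
    have h4 : (innerSL ℝ v) v = inner ℝ v v := innerSL_apply_apply ..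
    apply hv
    rw [← h4]
    have h5 : (1 / 2 : ℝ) * (0 + (innerSL ℝ v) v) = 0 := h3
    linarith
  exact Prod.ext h1 h2

theorem finrank_TR (x : M) : Module.finrank ℝ (S.TR x) = 1 := finrank_span_singleton
  (S.Rsec_ne_zero x)

theorem finrank_TRperp (x : M) : Module.finrank ℝ (S.TRperp x) = 4 * n + 1 := by
  have h1 : S.TRperp x = LinearMap.ker ((pairing x).flip (S.Rsec x)) := by
    ext a
    rw [mem_TRperp]
    rfl
  have h2 : (pairing x).flip (S.Rsec x) ≠ 0 := by
    intro h
    refine S.Rsec_ne_zero x (eq_zero_of_pairing fun b => ?_)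
    rw [pairing_comm]
    exact DFunLike.congr_fun h b
  have h3 := Module.Dual.finrank_ker_add_one_of_ne_zero h2
  rw [finrank_GT, ← h1] at h3
  exact Nat.succ_injective h3

theorem finrank_transFiber (x : M) : Module.finrank ℝ (S.transFiber x) = 4 * n := by
  have h := finrank_map_mkQ_add (S.TR_le_TRperp x)
  rw [finrank_TR, finrank_TRperp] at h
  exact Nat.succ_injective h

/-- The orthogonal of `TM ⊕ ann(R)` is `T𝓡`. -/
theorem mem_TR_of_pairing {x : M} {a : GT n x}
    (h : ∀ b ∈ S.TRperp x, pairing x a b = 0) : a ∈ S.TR x := by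
  have hη : pairing x ((0, S.eta x) : GT n x) (S.Rsec x) = 1 / 2 := by
    rw [pairing_Rsec, eta_R, mul_one]
  -- The factor 2 compensates `⟨R, η⟩ = 1/2`. Any `b` is a vector of `TM ⊕ ann(R)` plus a multiple
  -- of `η`, so it remains to match the pairings with `η`.
  refine S.mem_TR.2 ⟨2 * pairing x a (0, S.eta x), ?_⟩
  refine (sub_eq_zero.1 (eq_zero_of_pairing fun b => ?_)).symm
  have hb : b - (2 * pairing x b (S.Rsec x)) • ((0, S.eta x) : GT n x) ∈ S.TRperp x := by
    rw [mem_TRperp, map_sub, map_smul, LinearMap.sub_apply, LinearMap.smul_apply, hη, smul_eq_mul]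
    ring
  have h1 := h _ hb
  rw [map_sub, map_smul, smul_eq_mul] at h1
  rw [map_sub, map_smul, LinearMap.sub_apply, LinearMap.smul_apply, smul_eq_mul,
    pairing_comm x (S.Rsec x)]
  linarith

variable {S}

variable (S) in
/-- The projection `X + ξ ↦ X + ξ - ξ(R) η` onto `TM ⊕ ann(R)`. -/
def proj (x : M) (a : GT n x) : GT n x := a - a.2 (S.R x) • (0, S.eta x)

theorem proj_mem (x : M) (a : GT n x) : S.proj x a ∈ S.TRperp x := by
  rw [mem_TRperp, pairing_Rsec, proj]
  change 1 / 2 * (a.2 (S.R x) - a.2 (S.R x) * S.eta x (S.R x)) = 0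
  rw [eta_R]
  ring

theorem proj_eq_self {x : M} {a : GT n x} (h : a ∈ S.TRperp x) : S.proj x a = a := by
  rw [mem_TRperp, pairing_Rsec] at h
  have : a.2 (S.R x) = 0 := by linarith
  rw [proj, this, zero_smul, sub_zero]

theorem smooth_proj {s : ∀ x : M, GT n x} (hs : Smooth s) : Smooth (fun x => S.proj x (s x)) :=
  hs.sub (Smooth.smul (hs.2.apply S.smooth_Rsec.1) ⟨SmoothVF.zero, S.smooth_eta⟩)

theorem exists_smooth_TRperp [T2Space M] {x : M} {a : GT n x} (ha : a ∈ S.TRperp x) :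
    ∃ s : ∀ y : M, GT n y, Smooth s ∧ (∀ y, s y ∈ S.TRperp y) ∧ s x = a := by
  obtain ⟨s, hs, h⟩ := exists_smooth_eq a
  exact ⟨fun y => S.proj y (s y), smooth_proj hs, fun y => proj_mem y _, by
    rw [← h] at ha ⊢; exact proj_eq_self ha⟩

variable (S) in
-- Lift a basis of the fibre at `x` together with a dual family, and extend both to smooth sections
-- of `TM ⊕ ann(R)`. The determinant of their pairings is 1 at `x`, so it is nonzero nearby, and the
-- constant rank turns independence into spanning.
theorem exists_frame [T2Space M] (x : M) : ∃ s : Fin (4 * n) → ∀ y : M, GT n y,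
    (∀ i, Smooth (s i) ∧ ∀ y, s i y ∈ S.TRperp y) ∧
    ∀ᶠ y in 𝓝 x, LinearIndependent ℝ (fun i => (S.TR y).mkQ (s i y)) ∧
      Submodule.span ℝ (range fun i => (S.TR y).mkQ (s i y)) = S.transFiber y := by
  let b := Module.finBasisOfFinrankEq ℝ (S.transFiber x) (S.finrank_transFiber x)
  have hlift : ∀ i, ∃ a ∈ S.TRperp x, (S.TR x).mkQ a = b i := fun i => (b i).2
  choose a ha hab using hlift
  have hli : LinearIndependent ℝ (fun i => (S.TR x).mkQ (a i)) := by
    simp_rw [hab]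
    exact b.linearIndependent.map' (S.transFiber x).subtype (Submodule.ker_subtype _)
  obtain ⟨c, hc, hac⟩ := exists_dual_family (pairing x)
    (fun _ _ => S.mem_TR_of_pairing) ha hli
  choose s hs hsp hsx using fun i => exists_smooth_TRperp (ha i)
  choose t ht htp htx using fun i => exists_smooth_TRperp (hc i)
  refine ⟨s, fun i => ⟨hs i, hsp i⟩, ?_⟩
  have hcont : Continuous fun y => (Matrix.of fun i j => pairing y (s i y) (t j y)).det :=
    Continuous.matrix_det (continuous_matrix fun i j => ((hs i).pairing (ht j)).continuous)
  have hx : (Matrix.of fun i j => pairing x (s i x) (t j x)).det ≠ 0 := by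
    simp_rw [hsx, htx, hac]
    have : (Matrix.of fun i j : Fin (4 * n) => if i = j then (1 : ℝ) else 0) = 1 := by
      ext i j
      simp [Matrix.one_apply]
    rw [this, Matrix.det_one]
    exact one_ne_zero
  filter_upwards [hcont.continuousAt.eventually_ne hx] with y hy
  have hind : LinearIndependent ℝ (fun i => (S.TR y).mkQ (s i y)) :=
    linearIndependent_mkQ_of_det_ne_zero (pairing y)
      (fun r hr j => S.pairing_TR hr (htp j y)) hy
  refine ⟨hind, Submodule.eq_of_le_of_finrank_eq ?_ ?_⟩
  · rw [Submodule.span_le]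
    rintro _ ⟨i, rfl⟩
    exact ⟨_, hsp i y, rfl⟩
  · rw [finrank_span_eq_card hind, finrank_transFiber, Fintype.card_fin]

end GenAlmostContact

/-- `𝓛_X df = d(Xf)`, and the correction term of the bracket removes half of it. -/
theorem courant_dFun [IsManifold (𝓡 (2 * n + 1)) ∞ M] [T2Space M] {f : M → ℝ}
    (hf : SmoothFun n f) {s : ∀ x : M, GT n x} (hs : Smooth s) (x : M) :
    courant s (fun y => (0, dFun n f y)) x =
      (0, (1 / 2 : ℝ) • dFun n (fun y => dFun n f y (s y).1) x) := by
  refine gt_ext ?_ fun Z hZ => ?_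
  · have h := mlieBracket_zero_right (I := 𝓡 (2 * n + 1)) (W := fun y : M => (s y).1)
    exact congrFun h x
  · rw [courant_snd_apply' hs hf.smooth_dFun hZ]
    have h1 : mlieBracket (𝓡 (2 * n + 1))
        (fun y : M => (((0, dFun n f y) : GT n y)).1) Z x = 0 :=
      congrFun (mlieBracket_zero_left (I := 𝓡 (2 * n + 1)) (W := Z)) x
    have h2 : (fun y : M => (s y).2 (((0, dFun n f y) : GT n y)).1) = fun _ => 0 :=
      funext fun y => (s y).2.map_zero
    have h3 : dFun n (fun y => (s y).2 (Z y)) x (((0, dFun n f x) : GT n x)).1 = 0 := map_zero _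
    rw [h1, h2, h3, dFun_const, dFun_mlieBracket hf hs.1 hZ, map_zero]
    change _ = (1 / 2 : ℝ) * dFun n (fun y => dFun n f y (s y).1) x (Z x)
    rw [zero_apply]
    ring

namespace GenAlmostContact

variable [IsManifold (𝓡 (2 * n + 1)) ∞ M] {S : GenAlmostContact n M}

/-! ### The transverse Courant algebroid -/

theorem invSections_zero [T2Space M] : (fun _ => 0) ∈ S.invSections :=
  S.mem_invSections_of_TR Smooth.zero fun _ => zero_mem _

theorem invSections_add [T2Space M] {s t : ∀ x : M, GT n x} (hs : s ∈ S.invSections)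
    (ht : t ∈ S.invSections) : (fun x => s x + t x) ∈ S.invSections := by
  refine S.mem_invSections_iff.2 ⟨hs.1.add ht.1, fun x => add_mem (hs.2.1 x) (ht.2.1 x),
    fun x => ?_⟩
  rw [courant_add_right S.smooth_Rsec hs.1 ht.1]
  exact add_mem (hs.2.2 _ S.smooth_Rsec S.Rsec_mem_TR x) (ht.2.2 _ S.smooth_Rsec S.Rsec_mem_TR x)

theorem invSections_smul [T2Space M] {f : M → ℝ} (hf : f ∈ S.basicFun) {s : ∀ x : M, GT n x}
    (hs : s ∈ S.invSections) : (fun x => f x • s x) ∈ S.invSections := by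
  refine S.mem_invSections_iff.2 ⟨Smooth.smul hf.1 hs.1,
    fun x => Submodule.smul_mem _ _ (hs.2.1 x), fun x => ?_⟩
  have h : dFun n f x (S.Rsec x).1 = 0 := hf.2 x
  rw [courant_smul_right hf.1 S.smooth_Rsec hs.1, h,
    S.pairing_TR (S.Rsec_mem_TR x) (hs.2.1 x), zero_smul, zero_smul, add_zero, sub_zero]
  exact Submodule.smul_mem _ _ (hs.2.2 _ S.smooth_Rsec S.Rsec_mem_TR x)

theorem invSections_neg [T2Space M] {s : ∀ x : M, GT n x} (hs : s ∈ S.invSections) :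
    (fun x => -s x) ∈ S.invSections := by
  have h : (fun x => -s x) = fun x => (-1 : ℝ) • s x :=
    funext fun x => (neg_one_smul ℝ (s x)).symm
  rw [h]
  exact invSections_smul ⟨SmoothFun.const _, fun x => by rw [dFun_const]; rfl⟩ hs

theorem invSections_sub [T2Space M] {s t : ∀ x : M, GT n x} (hs : s ∈ S.invSections)
    (ht : t ∈ S.invSections) : (fun x => s x - t x) ∈ S.invSections := by
  simpa only [sub_eq_add_neg] using invSections_add hs (invSections_neg ht)

theorem invSections_dFun [T2Space M] {f : M → ℝ} (hf : f ∈ S.basicFun) :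
    (fun x => ((0, dFun n f x) : GT n x)) ∈ S.invSections := by
  refine S.mem_invSections_iff.2 ⟨hf.1.smooth_dFun, fun x => ?_, fun x => ?_⟩
  · rw [mem_TRperp, pairing_Rsec, hf.2 x, mul_zero]
  · have h : (fun y => dFun n f y (S.Rsec y).1) = fun _ => 0 := funext hf.2
    rw [courant_dFun hf.1 S.smooth_Rsec, h, dFun_const, smul_zero]
    exact zero_mem _

theorem basicFun_add {f g : M → ℝ} (hf : f ∈ S.basicFun) (hg : g ∈ S.basicFun) :
    (fun x => f x + g x) ∈ S.basicFun := by
  refine ⟨hf.1.add hg.1, fun x => ?_⟩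
  rw [dFun_add hf.1 hg.1, add_apply, hf.2, hg.2, add_zero]

theorem basicFun_const_mul (c : ℝ) {f : M → ℝ} (hf : f ∈ S.basicFun) :
    (fun x => c * f x) ∈ S.basicFun := by
  refine ⟨(SmoothFun.const c).mul hf.1, fun x => ?_⟩
  rw [dFun_const_mul c hf.1, smul_apply, hf.2, smul_zero]

/-- The derivative of `f` along `s` is `2 ⟨s, df⟩`, a pairing of two invariant sections. -/
theorem dFun_mem_basicFun [T2Space M] {f : M → ℝ} (hf : f ∈ S.basicFun) {s : ∀ x : M, GT n x}
    (hs : s ∈ S.invSections) : (fun x => dFun n f x (s x).1) ∈ S.basicFun := by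
  have h := basicFun_const_mul 2 (pairing_mem_basicFun hs (invSections_dFun hf))
  have he : (fun x => dFun n f x (s x).1) =
      fun x => 2 * pairing x (s x) ((0, dFun n f x) : GT n x) := by
    funext x
    rw [pairing_apply, map_zero]
    ring
  rwa [he]

theorem mem_TRperp_of_mkQ {x : M} {a : GT n x} {u : S.transFiber x}
    (h : (S.TR x).mkQ a = u) : a ∈ S.TRperp x := by
  obtain ⟨b, hb, hbu⟩ := u.2
  rw [← hbu, ← sub_eq_zero, ← map_sub, Submodule.mkQ_apply, Submodule.Quotient.mk_eq_zero] at h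
  simpa using add_mem (S.TR_le_TRperp x h) hb

theorem pairing_congr_mkQ {x : M} {a a' b b' : GT n x} {u v : S.transFiber x}
    (ha : (S.TR x).mkQ a = u) (ha' : (S.TR x).mkQ a' = u) (hb : (S.TR x).mkQ b = v)
    (hb' : (S.TR x).mkQ b' = v) : pairing x a b = pairing x a' b' := by
  have h1 : a - a' ∈ S.TR x := by
    rw [← Submodule.Quotient.mk_eq_zero, ← Submodule.mkQ_apply, map_sub, ha, ha', sub_self]
  have h2 : b - b' ∈ S.TR x := by
    rw [← Submodule.Quotient.mk_eq_zero, ← Submodule.mkQ_apply, map_sub, hb, hb', sub_self]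
  have h3 := S.pairing_TR h1 (mem_TRperp_of_mkQ hb)
  have h4 := S.pairing_TR h2 (mem_TRperp_of_mkQ ha')
  rw [map_sub, LinearMap.sub_apply] at h3
  rw [pairing_comm, map_sub] at h4
  linarith

variable (S)

/-- A representative in `TM ⊕ ann(R)` of a vector of `𝕋_𝓡 M`. -/
def repr (x : M) (u : S.transFiber x) : GT n x := u.2.choose

variable {S}

theorem mkQ_repr {x : M} (u : S.transFiber x) : (S.TR x).mkQ (S.repr x u) = u :=
  u.2.choose_spec.2

theorem mkQ_repr_add {x : M} (u v : S.transFiber x) :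
    (S.TR x).mkQ (S.repr x u + S.repr x v) = (u + v : S.transFiber x) := by
  rw [map_add, mkQ_repr, mkQ_repr, Submodule.coe_add]

theorem mkQ_repr_smul {x : M} (c : ℝ) (u : S.transFiber x) :
    (S.TR x).mkQ (c • S.repr x u) = (c • u : S.transFiber x) := by
  rw [map_smul, mkQ_repr, Submodule.coe_smul]

variable (S) in
/-- The pairing induced on `𝕋_𝓡 M`. -/
def transPair (x : M) : LinearMap.BilinForm ℝ (S.transFiber x) :=
  LinearMap.mk₂ ℝ (fun u v => pairing x (S.repr x u) (S.repr x v))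
    (fun u u' v => (pairing_congr_mkQ (mkQ_repr _) (mkQ_repr_add u u') (mkQ_repr v)
      (mkQ_repr v)).trans (LinearMap.map_add₂ (pairing x) _ _ _))
    (fun c u v => (pairing_congr_mkQ (mkQ_repr _) (mkQ_repr_smul c u) (mkQ_repr v)
      (mkQ_repr v)).trans (LinearMap.map_smul₂ (pairing x) _ _ _))
    (fun u v v' => (pairing_congr_mkQ (mkQ_repr u) (mkQ_repr u) (mkQ_repr _)
      (mkQ_repr_add v v')).trans (map_add (pairing x _) _ _))
    (fun c u v => (pairing_congr_mkQ (mkQ_repr u) (mkQ_repr u) (mkQ_repr _)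
      (mkQ_repr_smul c v)).trans (map_smul (pairing x _) _ _))

theorem transPair_lift {x : M} {a b : GT n x} {u v : S.transFiber x}
    (ha : (S.TR x).mkQ a = u) (hb : (S.TR x).mkQ b = v) :
    S.transPair x u v = pairing x a b :=
  pairing_congr_mkQ (mkQ_repr _) ha (mkQ_repr _) hb

variable (S) in
/-- The class in `𝕋_𝓡 M` of a vector of `TM ⊕ ann(R)`. -/
def toTrans {x : M} (a : GT n x) (ha : a ∈ S.TRperp x) : S.transFiber x :=
  ⟨(S.TR x).mkQ a, a, ha, rfl⟩

open Classical in
variable (S) in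
/-- The bracket induced on the sections of `𝕋_𝓡 M`. -/
def transBr [T2Space M] (σ τ : ∀ x : M, S.transFiber x) (x : M) : S.transFiber x :=
  -- Off the basic sections the value is arbitrary, since every axiom concerns basic sections. On
  -- them the choice of lifts is harmless by `courant_sub_mem_TR`.
  if h : σ ∈ S.basicSections ∧ τ ∈ S.basicSections then
    S.toTrans (courant h.1.choose h.2.choose x)
      (courant_mem_TRperp h.1.choose_spec.1 h.2.choose_spec.1 x)
  else 0

theorem sub_mem_TR_of_lifts {s s' : ∀ x : M, GT n x} {σ : ∀ x : M, S.transFiber x}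
    (h : S.Lifts s σ) (h' : S.Lifts s' σ) (x : M) : s x - s' x ∈ S.TR x := by
  rw [← Submodule.Quotient.mk_eq_zero, ← Submodule.mkQ_apply, map_sub, h x, h' x, sub_self]

/-- Well-definedness of the induced bracket: changing a lift adds a section of `T𝓡`, and its bracket
with an invariant section stays in `T𝓡`. -/
theorem courant_sub_mem_TR [T2Space M] {s s' t t' : ∀ x : M, GT n x} (hs : s ∈ S.invSections)
    (hs' : s' ∈ S.invSections) (ht : t ∈ S.invSections) (ht' : t' ∈ S.invSections)
    (h₁ : ∀ x, s x - s' x ∈ S.TR x) (h₂ : ∀ x, t x - t' x ∈ S.TR x) (x : M) :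
    courant s t x - courant s' t' x ∈ S.TR x := by
  have e1 : s = fun y => s' y + (s y - s' y) := funext fun y => (add_sub_cancel _ _).symm
  have e2 : t = fun y => t' y + (t y - t' y) := funext fun y => (add_sub_cancel _ _).symm
  have a1 : courant s t x = courant s' t x + courant (fun y => s y - s' y) t x := by
    conv_lhs => rw [e1]
    exact courant_add_left ht.1 hs'.1 (hs.1.sub hs'.1) x
  have a2 : courant s' t x = courant s' t' x + courant s' (fun y => t y - t' y) x := by
    conv_lhs => rw [e2]
    exact courant_add_right hs'.1 ht'.1 (ht.1.sub ht'.1) x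
  rw [a1, a2, add_assoc, add_sub_cancel_left]
  exact add_mem (courant_mem_TR_right hs' (ht.1.sub ht'.1) h₂ x)
    (ht.2.2 _ (hs.1.sub hs'.1) h₁ x)

theorem lifts_transBr [T2Space M] {s t : ∀ x : M, GT n x} (hs : s ∈ S.invSections)
    (ht : t ∈ S.invSections) {σ τ : ∀ x : M, S.transFiber x} (hσ : S.Lifts s σ)
    (hτ : S.Lifts t τ) : S.Lifts (courant s t) (S.transBr σ τ) := by
  intro x
  have h : σ ∈ S.basicSections ∧ τ ∈ S.basicSections := ⟨⟨s, hs, hσ⟩, ⟨t, ht, hτ⟩⟩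
  rw [transBr, dif_pos h]
  rw [← sub_eq_zero]
  change (S.TR x).mkQ _ - (S.TR x).mkQ _ = 0
  rw [← map_sub, Submodule.mkQ_apply, Submodule.Quotient.mk_eq_zero]
  exact courant_sub_mem_TR hs h.1.choose_spec.1 ht h.2.choose_spec.1
    (sub_mem_TR_of_lifts hσ h.1.choose_spec.2) (sub_mem_TR_of_lifts hτ h.2.choose_spec.2) x

variable (S) in
/-- The anchor induced on `𝕋_𝓡 M`. -/
def transAnchor (x : M) : S.transFiber x →ₗ[ℝ] S.NR x :=
  ((S.TR x).mapQ (Submodule.span ℝ {S.R x}) (LinearMap.fst ℝ _ _) (by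
    intro a ha
    obtain ⟨c, rfl⟩ := S.mem_TR.1 ha
    exact Submodule.smul_mem _ c (Submodule.mem_span_singleton_self _))).domRestrict
    (S.transFiber x)

theorem transAnchor_lift {x : M} {a : GT n x} {u : S.transFiber x} (h : (S.TR x).mkQ a = u) :
    S.transAnchor x u = (Submodule.span ℝ {S.R x}).mkQ a.1 := by
  rw [transAnchor, LinearMap.domRestrict_apply, ← h]
  rfl

open Classical in
variable (S) in
/-- The derivative of a basic function along a normal vector. -/
def transNder (f : M → ℝ) (x : M) : S.NR x →ₗ[ℝ] ℝ :=
  if h : f ∈ S.basicFun then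
    (Submodule.span ℝ {S.R x}).liftQ (dFun n f x).toLinearMap (by
      rw [Submodule.span_singleton_le_iff_mem]
      exact h.2 x)
  else 0

theorem transNder_lift {f : M → ℝ} (hf : f ∈ S.basicFun) (x : M)
    (v : TangentSpace (𝓡 (2 * n + 1)) x) :
    S.transNder f x ((Submodule.span ℝ {S.R x}).mkQ v) = dFun n f x v := by
  rw [transNder, dif_pos hf]
  rfl

open Classical in
variable (S) in
/-- The differential of a basic function as a section of `𝕋_𝓡 M`. -/
def transD [T2Space M] (f : M → ℝ) (x : M) : S.transFiber x :=
  if h : f ∈ S.basicFun then S.toTrans (0, dFun n f x) ((invSections_dFun h).2.1 x) else 0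

theorem lifts_transD [T2Space M] {f : M → ℝ} (hf : f ∈ S.basicFun) :
    S.Lifts (fun x => (0, dFun n f x)) (S.transD f) := by
  intro x
  rw [transD, dif_pos hf]
  rfl

theorem transNder_transAnchor {f : M → ℝ} (hf : f ∈ S.basicFun) {s : ∀ x : M, GT n x}
    {σ : ∀ x : M, S.transFiber x} (hσ : S.Lifts s σ) :
    (fun x => S.transNder f x (S.transAnchor x (σ x))) = fun x => dFun n f x (s x).1 :=
  funext fun x => by rw [transAnchor_lift (hσ x), transNder_lift hf]

theorem transPair_lifts {s t : ∀ x : M, GT n x} {σ τ : ∀ x : M, S.transFiber x}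
    (hσ : S.Lifts s σ) (hτ : S.Lifts t τ) :
    (fun x => S.transPair x (σ x) (τ x)) = fun x => pairing x (s x) (t x) :=
  funext fun x => transPair_lift (hσ x) (hτ x)

theorem Lifts.add {s t : ∀ x : M, GT n x} {σ τ : ∀ x : M, S.transFiber x}
    (hσ : S.Lifts s σ) (hτ : S.Lifts t τ) :
    S.Lifts (fun x => s x + t x) (fun x => σ x + τ x) := fun x => by
  rw [map_add, hσ x, hτ x]
  rfl

theorem Lifts.smul (f : M → ℝ) {s : ∀ x : M, GT n x} {σ : ∀ x : M, S.transFiber x}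
    (hσ : S.Lifts s σ) : S.Lifts (fun x => f x • s x) (fun x => f x • σ x) := fun x => by
  rw [map_smul, hσ x]
  rfl

theorem Lifts.neg {s : ∀ x : M, GT n x} {σ : ∀ x : M, S.transFiber x}
    (hσ : S.Lifts s σ) : S.Lifts (fun x => -s x) (fun x => -σ x) := fun x => by
  rw [map_neg, hσ x]
  rfl

theorem Lifts.sub {s t : ∀ x : M, GT n x} {σ τ : ∀ x : M, S.transFiber x}
    (hσ : S.Lifts s σ) (hτ : S.Lifts t τ) :
    S.Lifts (fun x => s x - t x) (fun x => σ x - τ x) := fun x => by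
  rw [map_sub, hσ x, hτ x]
  rfl

/-- The transfer principle: an identity between lifts at a point is an identity between classes, so
the bracket axioms follow from those on `TM ⊕ T*M`. -/
theorem Lifts.congr {s t : ∀ x : M, GT n x} {σ τ : ∀ x : M, S.transFiber x}
    (hσ : S.Lifts s σ) (hτ : S.Lifts t τ) {x : M} (h : s x = t x) : σ x = τ x :=
  Subtype.ext (by rw [← hσ x, ← hτ x, h])

theorem transPair_jacobi [T2Space M] {s t u : ∀ x : M, GT n x} (hs : s ∈ S.invSections)
    (ht : t ∈ S.invSections) (hu : u ∈ S.invSections) {σ τ υ : ∀ x : M, S.transFiber x}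
    (hσ : S.Lifts s σ) (hτ : S.Lifts t τ) (hυ : S.Lifts u υ) :
    (fun y => (1 / 3 : ℝ) * (S.transPair y (S.transBr σ τ y) (υ y)
        + S.transPair y (S.transBr τ υ y) (σ y) + S.transPair y (S.transBr υ σ y) (τ y))) =
      fun y => (1 / 3 : ℝ) * (pairing y (courant s t y) (u y)
        + pairing y (courant t u y) (s y) + pairing y (courant u s y) (t y)) := by
  funext y
  rw [transPair_lift (lifts_transBr hs ht hσ hτ y) (hυ y),
    transPair_lift (lifts_transBr ht hu hτ hυ y) (hσ y),
    transPair_lift (lifts_transBr hu hs hυ hσ y) (hτ y)]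

theorem pairing_jacobi_mem [T2Space M] {s t u : ∀ x : M, GT n x} (hs : s ∈ S.invSections)
    (ht : t ∈ S.invSections) (hu : u ∈ S.invSections) :
    (fun y => (1 / 3 : ℝ) * (pairing y (courant s t y) (u y)
      + pairing y (courant t u y) (s y) + pairing y (courant u s y) (t y))) ∈ S.basicFun :=
  basicFun_const_mul _ (basicFun_add (basicFun_add
    (pairing_mem_basicFun (courant_mem_invSections hs ht) hu)
    (pairing_mem_basicFun (courant_mem_invSections ht hu) hs))
    (pairing_mem_basicFun (courant_mem_invSections hu hs) ht))

theorem lifts_jacobi [T2Space M] {s t u : ∀ x : M, GT n x} (hs : s ∈ S.invSections)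
    (ht : t ∈ S.invSections) (hu : u ∈ S.invSections) {σ τ υ : ∀ x : M, S.transFiber x}
    (hσ : S.Lifts s σ) (hτ : S.Lifts t τ) (hυ : S.Lifts u υ) :
    S.Lifts (fun x => courant (courant s t) u x + courant (courant t u) s x
      + courant (courant u s) t x)
      (fun x => S.transBr (S.transBr σ τ) υ x + S.transBr (S.transBr τ υ) σ x
        + S.transBr (S.transBr υ σ) τ x) :=
  Lifts.add (Lifts.add
    (lifts_transBr (courant_mem_invSections hs ht) hu (lifts_transBr hs ht hσ hτ) hυ)
    (lifts_transBr (courant_mem_invSections ht hu) hs (lifts_transBr ht hu hτ hυ) hσ))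
    (lifts_transBr (courant_mem_invSections hu hs) ht (lifts_transBr hu hs hυ hσ) hτ)

theorem trans_jacobi [T2Space M] {s t u : ∀ x : M, GT n x} (hs : s ∈ S.invSections)
    (ht : t ∈ S.invSections) (hu : u ∈ S.invSections) {σ τ υ : ∀ x : M, S.transFiber x}
    (hσ : S.Lifts s σ) (hτ : S.Lifts t τ) (hυ : S.Lifts u υ) (x : M) :
    S.transBr (S.transBr σ τ) υ x + S.transBr (S.transBr τ υ) σ x + S.transBr (S.transBr υ σ) τ x =
      S.transD (fun y => (1 / 3 : ℝ) * (S.transPair y (S.transBr σ τ y) (υ y)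
        + S.transPair y (S.transBr τ υ y) (σ y) + S.transPair y (S.transBr υ σ y) (τ y))) x := by
  rw [transPair_jacobi hs ht hu hσ hτ hυ]
  exact Lifts.congr (lifts_jacobi hs ht hu hσ hτ hυ) (lifts_transD (pairing_jacobi_mem hs ht hu))
    (courant_jacobi hs.1 ht.1 hu.1 x)

theorem trans_leibniz [T2Space M] {s t : ∀ x : M, GT n x} (hs : s ∈ S.invSections)
    (ht : t ∈ S.invSections) {σ τ : ∀ x : M, S.transFiber x} (hσ : S.Lifts s σ)
    (hτ : S.Lifts t τ) {f : M → ℝ} (hf : f ∈ S.basicFun) (x : M) :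
    S.transBr σ (fun y => f y • τ y) x = f x • S.transBr σ τ x
      + S.transNder f x (S.transAnchor x (σ x)) • τ x
      - S.transPair x (σ x) (τ x) • S.transD f x := by
  have hD := lifts_transD hf
  have h0 := lifts_transBr hs (invSections_smul hf ht) hσ (hτ.smul f)
  have h := Lifts.sub ((Lifts.smul f (lifts_transBr hs ht hσ hτ)).add
    (hτ.smul fun y => dFun n f y (s y).1)) (Lifts.smul (fun y => pairing y (s y) (t y)) hD)
  have h1 : S.transNder f x (S.transAnchor x (σ x)) = dFun n f x (s x).1 :=
    congrFun (transNder_transAnchor hf hσ) x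
  have h2 := transPair_lift (hσ x) (hτ x)
  rw [h1, h2]
  exact Lifts.congr h0 h (courant_smul_right hf.1 hs.1 ht.1 x)

theorem trans_anchor [T2Space M] {s t : ∀ x : M, GT n x} (hs : s ∈ S.invSections)
    (ht : t ∈ S.invSections) {σ τ : ∀ x : M, S.transFiber x} (hσ : S.Lifts s σ)
    (hτ : S.Lifts t τ) {f : M → ℝ} (hf : f ∈ S.basicFun) (x : M) :
    S.transNder f x (S.transAnchor x (S.transBr σ τ x)) =
      S.transNder (fun y => S.transNder f y (S.transAnchor y (τ y))) x (S.transAnchor x (σ x))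
        - S.transNder (fun y => S.transNder f y (S.transAnchor y (σ y))) x
          (S.transAnchor x (τ x)) := by
  have h1 := congrFun (transNder_transAnchor hf (lifts_transBr hs ht hσ hτ)) x
  have h2 := congrFun (transNder_transAnchor (dFun_mem_basicFun hf ht) hσ) x
  have h3 := congrFun (transNder_transAnchor (dFun_mem_basicFun hf hs) hτ) x
  have h4 := dFun_mlieBracket hf.1 hs.1.1 ht.1.1 x
  rw [transNder_transAnchor hf hσ, transNder_transAnchor hf hτ]
  exact h1.trans (h4.trans (congrArg₂ _ h2.symm h3.symm))

theorem trans_compat [T2Space M] {s t u : ∀ x : M, GT n x} (hs : s ∈ S.invSections)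
    (ht : t ∈ S.invSections) (hu : u ∈ S.invSections) {σ τ υ : ∀ x : M, S.transFiber x}
    (hσ : S.Lifts s σ) (hτ : S.Lifts t τ) (hυ : S.Lifts u υ) (x : M) :
    S.transNder (fun y => S.transPair y (τ y) (υ y)) x (S.transAnchor x (σ x)) =
      S.transPair x (S.transBr σ τ x + S.transD (fun y => S.transPair y (σ y) (τ y)) x) (υ x)
        + S.transPair x (τ x)
          (S.transBr σ υ x + S.transD (fun y => S.transPair y (σ y) (υ y)) x) := by
  have e1 := congrArg (fun f => S.transNder f x (S.transAnchor x (σ x))) (transPair_lifts hτ hυ)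
  have e2 := congrArg (fun f => S.transPair x (S.transBr σ τ x + S.transD f x) (υ x))
    (transPair_lifts hσ hτ)
  have e3 := congrArg (fun f => S.transPair x (τ x) (S.transBr σ υ x + S.transD f x))
    (transPair_lifts hσ hυ)
  have h1 := congrFun (transNder_transAnchor (pairing_mem_basicFun ht hu) hσ) x
  have l2 := Lifts.add (lifts_transBr hs ht hσ hτ) (lifts_transD (pairing_mem_basicFun hs ht))
  have l3 := Lifts.add (lifts_transBr hs hu hσ hυ) (lifts_transD (pairing_mem_basicFun hs hu))
  have h2 := congrFun (transPair_lifts l2 hυ) x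
  have h3 := congrFun (transPair_lifts hτ l3) x
  have h4 := courant_compat hs.1 ht.1 hu.1 x
  exact e1.trans (h1.trans (h4.trans
    (congrArg₂ (· + ·) (e2.trans h2).symm (e3.trans h3).symm)))

variable (S) in
/-- The transverse Courant algebroid of a generalized almost contact structure. -/
def transverseCourantAlgebroid [T2Space M] : S.TransverseCourantAlgebroid where
  pair := S.transPair
  br := S.transBr
  anchor := S.transAnchor
  nder := S.transNder
  D := S.transD
  frame := S.exists_frame
  pair_lift _ _ _ _ _ ha hb := transPair_lift ha hb
  br_lift _ hs _ ht _ _ hσ hτ := ⟨courant_mem_invSections hs ht, lifts_transBr hs ht hσ hτ⟩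
  anchor_lift _ _ _ h := transAnchor_lift h
  nder_lift _ hf x v := transNder_lift hf x v
  D_lift _ hf := lifts_transD hf
  pair_symm x u v := pairing_comm x _ _
  pair_nondeg x u h := by
    have h1 : S.repr x u ∈ S.TR x := S.mem_TR_of_pairing
      fun b hb => (transPair_lift (v := S.toTrans b hb) (mkQ_repr u) rfl).symm.trans (h _)
    rw [← Submodule.Quotient.mk_eq_zero, ← Submodule.mkQ_apply, mkQ_repr] at h1
    exact Subtype.ext h1
  basic_zero := ⟨_, invSections_zero, fun x => map_zero _⟩
  basic_add := by
    rintro σ ⟨s, hs, hσ⟩ τ ⟨t, ht, hτ⟩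
    exact ⟨_, invSections_add hs ht, hσ.add hτ⟩
  basic_smul := by
    rintro f hf σ ⟨s, hs, hσ⟩
    exact ⟨_, invSections_smul hf hs, hσ.smul f⟩
  basic_br := by
    rintro σ ⟨s, hs, hσ⟩ τ ⟨t, ht, hτ⟩
    exact ⟨_, courant_mem_invSections hs ht, lifts_transBr hs ht hσ hτ⟩
  basic_D f hf := ⟨_, invSections_dFun hf, lifts_transD hf⟩
  basic_pair := by
    rintro σ ⟨s, hs, hσ⟩ τ ⟨t, ht, hτ⟩
    rw [transPair_lifts hσ hτ]
    exact pairing_mem_basicFun hs ht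
  basic_nder := by
    rintro σ ⟨s, hs, hσ⟩ f hf
    rw [transNder_transAnchor hf hσ]
    exact dFun_mem_basicFun hf hs
  br_skew := by
    rintro σ ⟨s, hs, hσ⟩ τ ⟨t, ht, hτ⟩ x
    exact (lifts_transBr hs ht hσ hτ).congr (lifts_transBr ht hs hτ hσ).neg
      (courant_skew hs.1 ht.1 x)
  br_add := by
    rintro σ ⟨s, hs, hσ⟩ τ ⟨t, ht, hτ⟩ υ ⟨u, hu, hυ⟩ x
    exact (lifts_transBr hs (invSections_add ht hu) hσ (hτ.add hυ)).congr
      ((lifts_transBr hs ht hσ hτ).add (lifts_transBr hs hu hσ hυ))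
      (courant_add_right hs.1 ht.1 hu.1 x)
  jacobi := by
    rintro σ ⟨s, hs, hσ⟩ τ ⟨t, ht, hτ⟩ υ ⟨u, hu, hυ⟩ x
    exact trans_jacobi hs ht hu hσ hτ hυ x
  anchor_br := by
    rintro σ ⟨s, hs, hσ⟩ τ ⟨t, ht, hτ⟩ f hf x
    exact trans_anchor hs ht hσ hτ hf x
  leibniz := by
    rintro σ ⟨s, hs, hσ⟩ τ ⟨t, ht, hτ⟩ f hf x
    exact trans_leibniz hs ht hσ hτ hf x
  anchor_D f hf x := by
    rw [transAnchor_lift (lifts_transD hf x), map_zero]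
  compat := by
    rintro σ ⟨s, hs, hσ⟩ τ ⟨t, ht, hτ⟩ υ ⟨u, hu, hυ⟩ x
    exact trans_compat hs ht hu hσ hτ hυ x

end GenAlmostContact

/-! ### Reduction of self-orthogonal subspaces -/

section SelfOrthogonal

variable {K V : Type*} [Field K] [AddCommGroup V] [Module K V] [FiniteDimensional K V]
  {B : LinearMap.BilinForm K V}

omit [FiniteDimensional K V] in
theorem orthogonal_sup_eq (L W : Submodule K V) :
    B.orthogonal (L ⊔ W) = B.orthogonal L ⊓ B.orthogonal W := by
  refine le_antisymm (le_inf (LinearMap.BilinForm.orthogonal_le le_sup_left)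
    (LinearMap.BilinForm.orthogonal_le le_sup_right)) fun z hz l hl => ?_
  obtain ⟨a, ha, b, hb, rfl⟩ := Submodule.mem_sup.1 hl
  have h1 : B a z = 0 := hz.1 a ha
  have h2 : B b z = 0 := hz.2 b hb
  change B (a + b) z = 0
  rw [map_add, LinearMap.add_apply, h1, h2, add_zero]

omit [FiniteDimensional K V] in
theorem modular_of_le {L N W : Submodule K V} (h : N ≤ W) : (L ⊔ N) ⊓ W = L ⊓ W ⊔ N := by
  rw [sup_comm L N, sup_inf_assoc_of_le L h, sup_comm]

/-- The reduction of a maximal isotropic subspace by a coisotropic one is maximal isotropic. -/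
theorem orthogonal_reduction (hB : B.Nondegenerate) (hr : B.IsRefl) {L N : Submodule K V}
    (hL : B.orthogonal L = L) (hN : N ≤ B.orthogonal N) :
    B.orthogonal (L ⊓ B.orthogonal N ⊔ N) = L ⊓ B.orthogonal N ⊔ N := by
  -- `L ∩ N^⊥ = (L + N)^⊥` because `L = L^⊥`. Hence the orthogonal of `L ∩ N^⊥ + N` is `(L + N) ∩
  -- N^⊥`, which the modular law identifies with the same space.
  have h1 : L ⊓ B.orthogonal N = B.orthogonal (L ⊔ N) := by rw [orthogonal_sup_eq, hL]
  rw [orthogonal_sup_eq, ← modular_of_le hN]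
  congr 1
  rw [h1, LinearMap.BilinForm.orthogonal_orthogonal hB hr]

theorem two_mul_finrank_of_orthogonal_eq (hB : B.Nondegenerate) {L : Submodule K V}
    (hL : B.orthogonal L = L) : 2 * Module.finrank K L = Module.finrank K V := by
  have h1 := LinearMap.BilinForm.finrank_orthogonal hB L
  have h2 := Submodule.finrank_le L
  rw [hL] at h1
  omega

end SelfOrthogonal

/-! ### Complexification -/

theorem re_tmul (x : M) (c : ℂ) (a : GT n x) : re x (c ⊗ₜ a) = c.re • a := by
  simp [re]

theorem im_tmul (x : M) (c : ℂ) (a : GT n x) : im x (c ⊗ₜ a) = c.im • a := by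
  simp [im]

theorem smul_toC (x : M) (c : ℂ) (a : GT n x) : c • toC x a = c ⊗ₜ[ℝ] a := by
  rw [toC, TensorProduct.smul_tmul', smul_eq_mul, mul_one]

theorem re_toC (x : M) (a : GT n x) : re x (toC x a) = a := by
  rw [toC, re_tmul, Complex.one_re, one_smul]

theorem im_toC (x : M) (a : GT n x) : im x (toC x a) = 0 := by
  rw [toC, im_tmul, Complex.one_im, zero_smul]

theorem toC_add (x : M) (a b : GT n x) : toC x (a + b) = toC x a + toC x b :=
  TensorProduct.tmul_add _ _ _

theorem toC_sub (x : M) (a b : GT n x) : toC x (a - b) = toC x a - toC x b :=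
  TensorProduct.tmul_sub _ _ _

theorem toC_smul (x : M) (c : ℝ) (a : GT n x) : toC x (c • a) = (c : ℂ) • toC x a := by
  rw [smul_toC, toC, ← TensorProduct.smul_tmul, Complex.real_smul, mul_one]

theorem re_smul (x : M) (c : ℂ) (z : GTC n x) :
    re x (c • z) = c.re • re x z - c.im • im x z := by
  induction z using TensorProduct.induction_on with
  | zero => simp
  | tmul d a =>
    rw [TensorProduct.smul_tmul', re_tmul, re_tmul, im_tmul, smul_eq_mul, Complex.mul_re]
    module
  | add z w hz hw =>
    rw [smul_add, map_add, hz, hw, map_add, map_add, smul_add, smul_add]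
    abel

theorem im_smul (x : M) (c : ℂ) (z : GTC n x) :
    im x (c • z) = c.re • im x z + c.im • re x z := by
  induction z using TensorProduct.induction_on with
  | zero => simp
  | tmul d a =>
    rw [TensorProduct.smul_tmul', im_tmul, re_tmul, im_tmul, smul_eq_mul, Complex.mul_im, add_smul,
      mul_smul, mul_smul]
  | add z w hz hw =>
    rw [smul_add, map_add, hz, hw, map_add, map_add, smul_add, smul_add]
    abel

theorem toC_re_add_toC_im (x : M) (z : GTC n x) :
    toC x (re x z) + Complex.I • toC x (im x z) = z := by
  induction z using TensorProduct.induction_on with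
  | zero => simp [toC]
  | tmul d a =>
    rw [re_tmul, im_tmul, toC_smul, toC_smul, smul_smul, ← add_smul, smul_toC, mul_comm Complex.I,
      Complex.re_add_im]
  | add z w hz hw =>
    rw [map_add, map_add, toC_add, toC_add, smul_add, add_add_add_comm, hz, hw]

theorem re_mk (x : M) (a b : GT n x) : re x (toC x a + Complex.I • toC x b) = a := by
  rw [map_add, re_smul, re_toC, re_toC, im_toC, Complex.I_re, zero_smul, smul_zero, sub_zero,
    add_zero]

theorem im_mk (x : M) (a b : GT n x) : im x (toC x a + Complex.I • toC x b) = b := by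
  rw [map_add, im_smul, im_toC, re_toC, im_toC, Complex.I_im, one_smul, smul_zero, zero_add,
    zero_add]

theorem gtc_ext {x : M} {z w : GTC n x} (h₁ : re x z = re x w) (h₂ : im x z = im x w) : z = w := by
  rw [← toC_re_add_toC_im x z, ← toC_re_add_toC_im x w, h₁, h₂]

theorem mem_baseChange {x : M} {V : Submodule ℝ (GT n x)} {z : GTC n x} :
    z ∈ V.baseChange ℂ ↔ re x z ∈ V ∧ im x z ∈ V := by
  refine ⟨fun h => ?_, fun h => ?_⟩
  · rw [Submodule.baseChange_eq_span] at h
    induction h using Submodule.span_induction with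
    | mem z hz =>
      obtain ⟨a, ha, rfl⟩ := hz
      change re x (toC x a) ∈ V ∧ im x (toC x a) ∈ V
      rw [re_toC, im_toC]
      exact ⟨ha, V.zero_mem⟩
    | zero => simp
    | add z w _ _ hz hw =>
      rw [map_add, map_add]
      exact ⟨V.add_mem hz.1 hw.1, V.add_mem hz.2 hw.2⟩
    | smul c z _ hz =>
      rw [re_smul, im_smul]
      exact ⟨V.sub_mem (V.smul_mem _ hz.1) (V.smul_mem _ hz.2),
        V.add_mem (V.smul_mem _ hz.2) (V.smul_mem _ hz.1)⟩
  · rw [← toC_re_add_toC_im x z]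
    exact add_mem (Submodule.tmul_mem_baseChange_of_mem _ h.1)
      (Submodule.smul_mem _ _ (Submodule.tmul_mem_baseChange_of_mem _ h.2))

theorem pairingC_toC (x : M) (a b : GT n x) :
    pairingC x (toC x a) (toC x b) = (pairing x a b : ℂ) := by
  rw [pairingC, toC, toC, LinearMap.BilinForm.baseChange_tmul, mul_one, Complex.real_smul, mul_one]

theorem pairingC_eq (x : M) (z w : GTC n x) : pairingC x z w =
    ((pairing x (re x z) (re x w) - pairing x (im x z) (im x w) : ℝ) : ℂ)
      + ((pairing x (re x z) (im x w) + pairing x (im x z) (re x w) : ℝ) : ℂ) * Complex.I := by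
  conv_lhs => rw [← toC_re_add_toC_im x z, ← toC_re_add_toC_im x w]
  simp only [map_add, map_smul, LinearMap.add_apply, LinearMap.smul_apply, pairingC_toC,
    smul_eq_mul]
  push_cast
  linear_combination (pairing x (im x z) (im x w) : ℂ) * Complex.I_mul_I

theorem pairingC_comm (x : M) (z w : GTC n x) : pairingC x z w = pairingC x w z := by
  rw [pairingC_eq, pairingC_eq, pairing_comm x (re x w), pairing_comm x (im x w),
    pairing_comm x (re x w), pairing_comm x (im x w), add_comm (pairing x (im x z) (re x w))]

theorem pairingC_isRefl (x : M) : (pairingC (n := n) x).IsRefl := fun z w h => by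
  rw [pairingC_comm, h]

theorem pairingC_toC_right_eq_zero {x : M} {z : GTC n x} {a : GT n x} :
    pairingC x z (toC x a) = 0 ↔ pairing x (re x z) a = 0 ∧ pairing x (im x z) a = 0 := by
  rw [pairingC_eq, re_toC, im_toC, map_zero, map_zero, sub_zero, zero_add, Complex.ext_iff]
  simp

theorem eq_zero_of_pairingC {x : M} {z : GTC n x} (h : ∀ w, pairingC x z w = 0) : z = 0 := by
  refine gtc_ext ?_ ?_
  · rw [map_zero]
    exact GenAlmostContact.eq_zero_of_pairing fun b => (pairingC_toC_right_eq_zero.1 (h (toC x b))).1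
  · rw [map_zero]
    exact GenAlmostContact.eq_zero_of_pairing fun b => (pairingC_toC_right_eq_zero.1 (h (toC x b))).2

theorem pairingC_nondegenerate (x : M) : (pairingC (n := n) x).Nondegenerate :=
  ⟨fun _ h => eq_zero_of_pairingC h,
    fun z h => eq_zero_of_pairingC fun w => by rw [pairingC_comm, h w]⟩

theorem finrank_GTC (x : M) : Module.finrank ℂ (GTC n x) = 4 * n + 2 := by
  rw [Module.finrank_baseChange, GenAlmostContact.finrank_GT]

/-- The opposite sign. -/
def Sgn.opp : Sgn → Sgn
  | .plus => .minus
  | .minus => .plus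

/-! ### `L_±` is its own orthogonal; the dimension of its reduction -/

namespace GenAlmostContact

variable [IsManifold (𝓡 (2 * n + 1)) ∞ M] (S : GenAlmostContact n M)

theorem Φ_sq_E (ε : Sgn) (x : M) : S.Φ x (S.Φ x (S.E ε x)) = 0 := by
  have h1 := S.pairing_E x
  have h2 := pairing_comm x (S.E .minus x) (S.E .plus x)
  rw [S.Φ_sq]
  cases ε
  · rw [h2, h1, S.null_E, zero_smul, add_zero, smul_smul]
    norm_num
  · rw [h1, S.null_E, zero_smul, zero_add, smul_smul]
    norm_num

/-- From `Φ³ E_± = 0` and the formula for `Φ²` at `Φ E_±`, the vector `Φ E_±` is a combination of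
`E₊` and `E₋`. By skewness `Φ` therefore preserves their common orthogonal; that `Φ E_±` itself
vanishes is not needed. -/
theorem pairing_Φ_E {x : M} {e : GT n x} (he : ∀ ε, pairing x e (S.E ε x) = 0) (ε : Sgn) :
    pairing x (S.Φ x e) (S.E ε x) = 0 := by
  have h1 := S.Φ_sq x (S.Φ x (S.E ε x))
  rw [S.Φ_sq_E, map_zero, eq_comm, neg_add_eq_zero] at h1
  have h2 := S.skew_Φ x e (S.E ε x)
  rw [h1, map_smul, map_add, map_smul, map_smul, he, he] at h2
  simpa using h2

theorem Φ_sq_of_perp {x : M} {e : GT n x} (he : ∀ ε, pairing x e (S.E ε x) = 0) :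
    S.Φ x (S.Φ x e) = -e := by
  rw [S.Φ_sq, pairing_comm, he, pairing_comm, he, zero_smul, zero_smul, add_zero, smul_zero,
    add_zero]

/-- On the orthogonal of `E_±`, skewness and `Φ² = -1` make `Φ` an isometry, so in `⟨e - iΦe, e' -
iΦe'⟩` the real and the imaginary parts cancel. The vector `E_ε` is null and orthogonal to all such
`e - iΦe`. -/
theorem isotropic_L (ε : Sgn) (x : M) : S.L ε x ≤ (pairingC x).orthogonal (S.L ε x) := by
  have hE : pairingC x (toC x (S.E ε x)) (toC x (S.E ε x)) = 0 := by
    rw [pairingC_toC, S.null_E, Complex.ofReal_zero]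
  have h1 : ∀ e, (∀ ε, pairing x e (S.E ε x) = 0) →
      pairingC x (toC x e - Complex.I • toC x (S.Φ x e)) (toC x (S.E ε x)) = 0 := by
    intro e he
    rw [map_sub, map_smul, LinearMap.sub_apply, LinearMap.smul_apply, pairingC_toC, pairingC_toC,
      he, S.pairing_Φ_E he, Complex.ofReal_zero, smul_zero, sub_zero]
  have h2 : ∀ e e', (∀ ε, pairing x e (S.E ε x) = 0) → (∀ ε, pairing x e' (S.E ε x) = 0) →
      pairingC x (toC x e - Complex.I • toC x (S.Φ x e))
        (toC x e' - Complex.I • toC x (S.Φ x e')) = 0 := by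
    intro e e' _ he'
    have h3 := S.skew_Φ x e e'
    have h4 := S.skew_Φ x e (S.Φ x e')
    rw [S.Φ_sq_of_perp he', map_neg] at h4
    have h3' : (pairing x (S.Φ x e) e' : ℂ) + (pairing x e (S.Φ x e') : ℂ) = 0 := mod_cast h3
    have h4' : (pairing x (S.Φ x e) (S.Φ x e') : ℂ) + -(pairing x e e' : ℂ) = 0 := mod_cast h4
    simp only [map_sub, map_smul, LinearMap.sub_apply, LinearMap.smul_apply, pairingC_toC,
      smul_eq_mul]
    linear_combination -Complex.I * h3' - h4'
      + (pairing x (S.Φ x e) (S.Φ x e') : ℂ) * Complex.I_mul_I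
  have h5 : S.L ε x = Submodule.span ℂ ({toC x (S.E ε x)} ∪
      {z | ∃ e : GT n x, (∀ ε, pairing x e (S.E ε x) = 0) ∧
        z = toC x e - Complex.I • toC x (S.Φ x e)}) := by
    rw [Submodule.span_union]
    rfl
  rw [h5, Submodule.span_le]
  intro z hz w hw
  change pairingC x w z = 0
  induction hw using Submodule.span_induction with
  | mem w hw =>
    rcases hz with hz | ⟨e, he, rfl⟩ <;> rcases hw with hw | ⟨e', he', rfl⟩
    · rw [Set.mem_singleton_iff.1 hz, Set.mem_singleton_iff.1 hw, hE]
    · rw [Set.mem_singleton_iff.1 hz, h1 e' he']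
    · rw [Set.mem_singleton_iff.1 hw, pairingC_comm, h1 e he]
    · exact h2 e' e he' he
  | zero => rw [map_zero, LinearMap.zero_apply]
  | add w w' _ _ h h' => rw [map_add, LinearMap.add_apply, h, h', add_zero]
  | smul c w _ h => rw [map_smul, LinearMap.smul_apply, h, smul_zero]

/-- The structure `(-Φ, E_±)`, whose bundle `L_±` is the conjugate of that of `(Φ, E_±)`. -/
def conj : GenAlmostContact n M where
  Φ x := -S.Φ x
  E := S.E
  smooth_Φ s hs := (S.smooth_Φ s hs).neg
  smooth_E := S.smooth_E
  skew_Φ x a b := by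
    have h := S.skew_Φ x a b
    rw [LinearMap.neg_apply, LinearMap.neg_apply, map_neg, map_neg, LinearMap.neg_apply]
    linarith
  pairing_E := S.pairing_E
  null_E := S.null_E
  Φ_sq x a := by
    rw [LinearMap.neg_apply, LinearMap.neg_apply, map_neg, neg_neg, S.Φ_sq]

/-- The projection onto the orthogonal of `E_±`. -/
def perpProj (x : M) (a : GT n x) : GT n x :=
  a - (2 : ℝ) • (pairing x (S.E .minus x) a • S.E .plus x + pairing x (S.E .plus x) a • S.E .minus x)

theorem pairing_perpProj (x : M) (a : GT n x) (ε : Sgn) :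
    pairing x (S.perpProj x a) (S.E ε x) = 0 := by
  have h1 := S.pairing_E x
  have h2 := pairing_comm x (S.E .minus x) (S.E .plus x)
  rw [perpProj, map_sub, map_smul, map_add, map_smul, map_smul]
  simp only [LinearMap.sub_apply, LinearMap.smul_apply, LinearMap.add_apply, smul_eq_mul]
  cases ε
  · rw [h2, h1, S.null_E, pairing_comm x a]
    ring
  · rw [h1, S.null_E, pairing_comm x a]
    ring

theorem perpProj_eq_self {x : M} {e : GT n x} (he : ∀ ε, pairing x e (S.E ε x) = 0) :
    S.perpProj x e = e := by
  rw [perpProj, pairing_comm, he, pairing_comm, he, zero_smul, zero_smul, add_zero, smul_zero,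
    sub_zero]

theorem E_mem_L (ε : Sgn) (x : M) : toC x (S.E ε x) ∈ S.L ε x :=
  Submodule.mem_sup_left (Submodule.mem_span_singleton_self _)

theorem sub_mem_L (ε : Sgn) {x : M} {e : GT n x} (he : ∀ ε, pairing x e (S.E ε x) = 0) :
    toC x e - Complex.I • toC x (S.Φ x e) ∈ S.L ε x :=
  Submodule.mem_sup_right (Submodule.subset_span ⟨e, he, rfl⟩)

/-- A real `e` orthogonal to `E_±` is the mean of `e - iΦe` and `e + iΦe`. The opposite sign on the
conjugate side supplies the missing one of `E₊`, `E₋`. -/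
theorem L_sup_conj_L (ε : Sgn) (x : M) : S.L ε x ⊔ S.conj.L ε.opp x = ⊤ := by
  have hE : ∀ δ, toC x (S.E δ x) ∈ S.L ε x ⊔ S.conj.L ε.opp x := by
    intro δ
    have h1 : toC x (S.E ε x) ∈ S.L ε x ⊔ S.conj.L ε.opp x :=
      Submodule.mem_sup_left (S.E_mem_L ε x)
    have h2 : toC x (S.E ε.opp x) ∈ S.L ε x ⊔ S.conj.L ε.opp x :=
      Submodule.mem_sup_right (S.conj.E_mem_L ε.opp x)
    cases ε <;> cases δ <;> assumption
  have hreal : ∀ a : GT n x, toC x a ∈ S.L ε x ⊔ S.conj.L ε.opp x := by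
    intro a
    have h1 := Submodule.mem_sup_left (T := S.conj.L ε.opp x)
      (S.sub_mem_L ε (S.pairing_perpProj x a))
    have h2 := Submodule.mem_sup_right (S := S.L ε x)
      (S.conj.sub_mem_L ε.opp (S.pairing_perpProj x a))
    have h3 := Submodule.smul_mem _ (1 / 2 : ℂ) (add_mem h1 h2)
    have hΦ : toC x (S.conj.Φ x (S.perpProj x a)) = -toC x (S.Φ x (S.perpProj x a)) :=
      TensorProduct.tmul_neg _ _
    have h4 : toC x (S.perpProj x a) ∈ S.L ε x ⊔ S.conj.L ε.opp x := by
      convert h3 using 1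
      rw [hΦ]
      module
    have h5 : toC x a = toC x (S.perpProj x a) + (2 : ℂ) •
        ((pairing x (S.E .minus x) a : ℂ) • toC x (S.E .plus x)
          + (pairing x (S.E .plus x) a : ℂ) • toC x (S.E .minus x)) := by
      rw [perpProj, toC_sub, toC_smul, toC_add, toC_smul, toC_smul, Complex.ofReal_ofNat,
        sub_add_cancel]
    rw [h5]
    exact add_mem h4 (Submodule.smul_mem _ _ (add_mem (Submodule.smul_mem _ _ (hE _))
      (Submodule.smul_mem _ _ (hE _))))
  refine eq_top_iff.2 fun z _ => ?_
  rw [← toC_re_add_toC_im x z]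
  exact add_mem (hreal _) (Submodule.smul_mem _ _ (hreal _))

/-- `L_±` is maximal isotropic. -/
theorem orthogonal_L (ε : Sgn) (x : M) : (pairingC x).orthogonal (S.L ε x) = S.L ε x := by
  refine le_antisymm (fun z hz => ?_) (S.isotropic_L ε x)
  have hz' : z ∈ S.L ε x ⊔ S.conj.L ε.opp x := by
    rw [L_sup_conj_L]
    trivial
  obtain ⟨l, hl, l', hl', rfl⟩ := Submodule.mem_sup.1 hz'
  -- Both `l + l'` and `l` are orthogonal to `L`, hence so is `l'`. It is also orthogonal to the
  -- isotropic conjugate summand that contains it, so it is orthogonal to everything.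
  suffices l' = 0 by rwa [this, add_zero]
  refine eq_zero_of_pairingC fun w => ?_
  have hw : w ∈ S.L ε x ⊔ S.conj.L ε.opp x := by
    rw [L_sup_conj_L]
    trivial
  obtain ⟨m, hm, m', hm', rfl⟩ := Submodule.mem_sup.1 hw
  have h1 : pairingC x m (l + l') = 0 := hz m hm
  have h2 : pairingC x m l = 0 := S.isotropic_L ε x hl m hm
  have h3 : pairingC x m' l' = 0 := S.conj.isotropic_L ε.opp x hl' m' hm'
  rw [map_add, h2, zero_add] at h1
  rw [pairingC_comm, map_add, LinearMap.add_apply, h1, h3, add_zero]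

theorem mem_TRC {x : M} {z : GTC n x} : z ∈ S.TRC x ↔ re x z ∈ S.TR x ∧ im x z ∈ S.TR x :=
  mem_baseChange

theorem mem_TRperpC {x : M} {z : GTC n x} :
    z ∈ S.TRperpC x ↔ re x z ∈ S.TRperp x ∧ im x z ∈ S.TRperp x :=
  mem_baseChange

theorem mem_TRperpC_iff_pairingC {x : M} {z : GTC n x} :
    z ∈ S.TRperpC x ↔ pairingC x z (toC x (S.Rsec x)) = 0 := by
  rw [mem_TRperpC, pairingC_toC_right_eq_zero, mem_TRperp, mem_TRperp]

theorem TRC_eq_span (x : M) : S.TRC x = Submodule.span ℂ {toC x (S.Rsec x)} := by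
  rw [TRC, TR, Submodule.baseChange_span, Set.image_singleton]
  rfl

theorem orthogonal_TRC (x : M) : (pairingC x).orthogonal (S.TRC x) = S.TRperpC x := by
  ext z
  rw [mem_TRperpC_iff_pairingC, TRC_eq_span, LinearMap.BilinForm.mem_orthogonal_iff]
  refine ⟨fun h => ?_, fun h w hw => ?_⟩
  · rw [pairingC_comm]
    exact h _ (Submodule.mem_span_singleton_self _)
  · obtain ⟨c, rfl⟩ := Submodule.mem_span_singleton.1 hw
    change pairingC x _ z = 0
    rw [map_smul, LinearMap.smul_apply, pairingC_comm, h, smul_zero]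

theorem TRC_le_TRperpC (x : M) : S.TRC x ≤ S.TRperpC x := fun _ hz =>
  S.mem_TRperpC.2 ⟨S.TR_le_TRperp x (S.mem_TRC.1 hz).1, S.TR_le_TRperp x (S.mem_TRC.1 hz).2⟩

theorem toC_Rsec_ne_zero (x : M) : toC x (S.Rsec x) ≠ 0 := fun h =>
  S.Rsec_ne_zero x (by rw [← re_toC x (S.Rsec x), h, map_zero])

theorem finrank_TRC (x : M) : Module.finrank ℂ (S.TRC x) = 1 := by
  rw [TRC_eq_span]
  exact finrank_span_singleton (S.toC_Rsec_ne_zero x)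

theorem orthogonal_H_sup_TRC (ε : Sgn) (x : M) :
    (pairingC x).orthogonal (S.H ε x ⊔ S.TRC x) = S.H ε x ⊔ S.TRC x := by
  have h := orthogonal_reduction (N := S.TRC x) (pairingC_nondegenerate x) (pairingC_isRefl x)
    (S.orthogonal_L ε x) (by rw [orthogonal_TRC]; exact S.TRC_le_TRperpC x)
  rwa [orthogonal_TRC] at h

/-- `H + T𝓡 ⊗ ℂ` is its own orthogonal in dimension `4n + 2`, and the quotient removes one
dimension. The count is the same whether or not `R` lies in `L`. -/
theorem finrank_diracFiber (ε : Sgn) (x : M) : Module.finrank ℂ (S.diracFiber ε x) = 2 * n := by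
  have h1 := two_mul_finrank_of_orthogonal_eq (pairingC_nondegenerate x)
    (S.orthogonal_H_sup_TRC ε x)
  have h2 := finrank_map_mkQ_add (T := S.TRC x) (W := S.H ε x ⊔ S.TRC x) le_sup_right
  rw [finrank_GTC] at h1
  rw [finrank_TRC] at h2
  change Module.finrank ℂ (S.diracFiber ε x) + 1 = _ at h2
  omega

theorem H_sup_TRC_le (ε : Sgn) (x : M) : S.H ε x ⊔ S.TRC x ≤ S.TRperpC x :=
  sup_le inf_le_right (S.TRC_le_TRperpC x)

/-- Lets a membership in `H + T𝓡 ⊗ ℂ` be proved by working modulo `T𝓡 ⊗ ℂ` in `L` and checking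
orthogonality to `R` separately. -/
theorem L_sup_TRC_inf (ε : Sgn) (x : M) :
    (S.L ε x ⊔ S.TRC x) ⊓ S.TRperpC x = S.H ε x ⊔ S.TRC x :=
  modular_of_le (S.TRC_le_TRperpC x)

theorem mkQ_mem_diracFiber {ε : Sgn} {x : M} {z : GTC n x} :
    (S.TRC x).mkQ z ∈ S.diracFiber ε x ↔ z ∈ S.H ε x ⊔ S.TRC x := by
  refine ⟨fun ⟨w, hw, h⟩ => ?_, fun h => ⟨z, h, rfl⟩⟩
  rw [← sub_eq_zero, ← map_sub, Submodule.mkQ_apply, Submodule.Quotient.mk_eq_zero] at h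
  have h1 : z = w - (w - z) := by abel
  rw [h1]
  exact sub_mem hw (Submodule.mem_sup_right h)

end GenAlmostContact

/-! ### Smooth complex functions and sections -/

/-- Smoothness of a complex function. -/
def SmoothFunC (n : ℕ) {M : Type*} [TopologicalSpace M]
    [ChartedSpace (EuclideanSpace ℝ (Fin (2 * n + 1))) M] (f : M → ℂ) : Prop :=
  SmoothFun n (fun x => (f x).re) ∧ SmoothFun n (fun x => (f x).im)

section Sections

variable [IsManifold (𝓡 (2 * n + 1)) ∞ M]

omit [IsManifold (𝓡 (2 * n + 1)) ∞ M] in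
theorem SmoothFunC.continuous {f : M → ℂ} (hf : SmoothFunC n f) : Continuous f := by
  have h : f = fun x => ((f x).re : ℂ) + ((f x).im : ℂ) * Complex.I :=
    funext fun x => (Complex.re_add_im _).symm
  rw [h]
  exact (Complex.continuous_ofReal.comp hf.1.continuous).add
    ((Complex.continuous_ofReal.comp hf.2.continuous).mul continuous_const)

omit [IsManifold (𝓡 (2 * n + 1)) ∞ M] in
theorem SmoothFunC.const (c : ℂ) : SmoothFunC n (fun _ : M => c) :=
  ⟨SmoothFun.const _, SmoothFun.const _⟩

omit [IsManifold (𝓡 (2 * n + 1)) ∞ M] in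
theorem SmoothFunC.ofReal {f : M → ℝ} (hf : SmoothFun n f) : SmoothFunC n (fun x => (f x : ℂ)) :=
  ⟨hf, SmoothFun.const 0⟩

omit [IsManifold (𝓡 (2 * n + 1)) ∞ M] in
theorem SmoothFunC.mul {f g : M → ℂ} (hf : SmoothFunC n f) (hg : SmoothFunC n g) :
    SmoothFunC n (fun x => f x * g x) := by
  refine ⟨?_, ?_⟩
  · simp_rw [Complex.mul_re]
    exact (hf.1.mul hg.1).sub (hf.2.mul hg.2)
  · simp_rw [Complex.mul_im]
    exact (hf.1.mul hg.2).add (hf.2.mul hg.1)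

omit [IsManifold (𝓡 (2 * n + 1)) ∞ M] in
theorem SmoothFunC.neg {f : M → ℂ} (hf : SmoothFunC n f) : SmoothFunC n (fun x => -f x) := by
  simp_rw [← neg_one_mul (f _)]
  exact (SmoothFunC.const (-1)).mul hf

omit [IsManifold (𝓡 (2 * n + 1)) ∞ M] in
theorem SmoothFunC.star {f : M → ℂ} (hf : SmoothFunC n f) :
    SmoothFunC n (fun x => starRingEnd ℂ (f x)) := by
  refine ⟨hf.1, ?_⟩
  have h : (fun x => (starRingEnd ℂ (f x)).im) = fun x => 0 - (f x).im :=
    funext fun x => by rw [Complex.conj_im, zero_sub]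
  rw [h]
  exact (SmoothFun.const 0).sub hf.2

theorem SmoothC.add {s t : ∀ x : M, GTC n x} (hs : SmoothC s) (ht : SmoothC t) :
    SmoothC (fun x => s x + t x) := by
  refine ⟨?_, ?_⟩
  · simp_rw [map_add]
    exact hs.1.add ht.1
  · simp_rw [map_add]
    exact hs.2.add ht.2

theorem SmoothC.smul {f : M → ℂ} {s : ∀ x : M, GTC n x} (hf : SmoothFunC n f) (hs : SmoothC s) :
    SmoothC (fun x => f x • s x) := by
  refine ⟨?_, ?_⟩
  · simp_rw [re_smul]
    exact (hs.1.smul hf.1).sub (hs.2.smul hf.2)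
  · simp_rw [im_smul]
    exact (hs.2.smul hf.1).add (hs.1.smul hf.2)

theorem SmoothC.mk {s t : ∀ x : M, GT n x} (hs : Smooth s) (ht : Smooth t) :
    SmoothC (fun x => toC x (s x) + Complex.I • toC x (t x)) := by
  refine ⟨?_, ?_⟩
  · simp_rw [re_mk]
    exact hs
  · simp_rw [im_mk]
    exact ht

theorem SmoothC.toC {s : ∀ x : M, GT n x} (hs : Smooth s) : SmoothC (fun x => toC x (s x)) := by
  refine ⟨?_, ?_⟩
  · simp_rw [re_toC]
    exact hs
  · simp_rw [im_toC]
    exact Smooth.zero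

theorem SmoothC.zero : SmoothC (fun x : M => (0 : GTC n x)) := by
  refine ⟨?_, ?_⟩
  · simp_rw [map_zero]
    exact Smooth.zero
  · simp_rw [map_zero]
    exact Smooth.zero

theorem SmoothC.pairingC {s t : ∀ x : M, GTC n x} (hs : SmoothC s) (ht : SmoothC t) :
    SmoothFunC n (fun x => pairingC x (s x) (t x)) := by
  refine ⟨?_, ?_⟩
  · have h : (fun x => (GenContact.pairingC x (s x) (t x)).re) = fun x =>
        pairing x (re x (s x)) (re x (t x)) - pairing x (im x (s x)) (im x (t x)) :=
      funext fun x => by rw [pairingC_eq]; simp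
    rw [h]
    exact (hs.1.pairing ht.1).sub (hs.2.pairing ht.2)
  · have h : (fun x => (GenContact.pairingC x (s x) (t x)).im) = fun x =>
        pairing x (re x (s x)) (im x (t x)) + pairing x (im x (s x)) (re x (t x)) :=
      funext fun x => by rw [pairingC_eq]; simp
    rw [h]
    exact (hs.1.pairing ht.2).add (hs.2.pairing ht.1)

/-! ### The complexified Courant bracket -/

omit [IsManifold (𝓡 (2 * n + 1)) ∞ M] in
theorem re_courantC (s t : ∀ x : M, GTC n x) (x : M) : re x (courantC s t x) =
    courant (fun y => re y (s y)) (fun y => re y (t y)) x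
      - courant (fun y => im y (s y)) (fun y => im y (t y)) x := re_mk ..

omit [IsManifold (𝓡 (2 * n + 1)) ∞ M] in
theorem im_courantC (s t : ∀ x : M, GTC n x) (x : M) : im x (courantC s t x) =
    courant (fun y => re y (s y)) (fun y => im y (t y)) x
      + courant (fun y => im y (s y)) (fun y => re y (t y)) x := im_mk ..

theorem courantC_skew [T2Space M] {s t : ∀ x : M, GTC n x} (hs : SmoothC s) (ht : SmoothC t)
    (x : M) : courantC s t x = -courantC t s x := by
  refine gtc_ext ?_ ?_
  · rw [map_neg, re_courantC, re_courantC, courant_skew hs.1 ht.1, courant_skew hs.2 ht.2]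
    abel
  · rw [map_neg, im_courantC, im_courantC, courant_skew hs.1 ht.2, courant_skew hs.2 ht.1]
    abel

theorem courantC_add_right [T2Space M] {s t u : ∀ x : M, GTC n x} (hs : SmoothC s)
    (ht : SmoothC t) (hu : SmoothC u) (x : M) :
    courantC s (fun y => t y + u y) x = courantC s t x + courantC s u x := by
  refine gtc_ext ?_ ?_
  · rw [map_add, re_courantC, re_courantC, re_courantC]
    simp_rw [map_add]
    rw [courant_add_right hs.1 ht.1 hu.1, courant_add_right hs.2 ht.2 hu.2]
    abel
  · rw [map_add, im_courantC, im_courantC, im_courantC]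
    simp_rw [map_add]
    rw [courant_add_right hs.1 ht.2 hu.2, courant_add_right hs.2 ht.1 hu.1]
    abel

theorem courantC_add_left [T2Space M] {s t u : ∀ x : M, GTC n x} (hs : SmoothC s)
    (ht : SmoothC t) (hu : SmoothC u) (x : M) :
    courantC (fun y => t y + u y) s x = courantC t s x + courantC u s x := by
  rw [courantC_skew (ht.add hu) hs, courantC_add_right hs ht hu, courantC_skew hs ht,
    courantC_skew hs hu, neg_add, neg_neg, neg_neg]

omit [IsManifold (𝓡 (2 * n + 1)) ∞ M] in
theorem re_ofReal_smul (x : M) (c : ℝ) (z : GTC n x) : re x ((c : ℂ) • z) = c • re x z := by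
  rw [re_smul, Complex.ofReal_re, Complex.ofReal_im, zero_smul, sub_zero]

omit [IsManifold (𝓡 (2 * n + 1)) ∞ M] in
theorem im_ofReal_smul (x : M) (c : ℝ) (z : GTC n x) : im x ((c : ℂ) • z) = c • im x z := by
  rw [im_smul, Complex.ofReal_re, Complex.ofReal_im, zero_smul, add_zero]

/-- The vanishing of the complex pairing makes the `df` terms of the real brackets cancel in pairs.
What remains is the derivative of `f` along the complex vector part of `s`. -/
theorem courantC_smul_right [T2Space M] {f : M → ℝ} {s t : ∀ x : M, GTC n x} (hf : SmoothFun n f)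
    (hs : SmoothC s) (ht : SmoothC t) (x : M) (h : pairingC x (s x) (t x) = 0) :
    courantC s (fun y => (f y : ℂ) • t y) x = (f x : ℂ) • courantC s t x
      + ((dFun n f x (re x (s x)).1 : ℂ) + (dFun n f x (im x (s x)).1 : ℂ) * Complex.I) • t x := by
  have h1 : pairing x (re x (s x)) (re x (t x)) = pairing x (im x (s x)) (im x (t x)) := by
    have := congrArg Complex.re h
    rw [pairingC_eq] at this
    simpa [sub_eq_zero] using this
  have h2 : pairing x (re x (s x)) (im x (t x)) = -pairing x (im x (s x)) (re x (t x)) := by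
    have := congrArg Complex.im h
    rw [pairingC_eq] at this
    exact eq_neg_of_add_eq_zero_left (by simpa using this)
  have h3 : ((dFun n f x (re x (s x)).1 : ℂ)
      + (dFun n f x (im x (s x)).1 : ℂ) * Complex.I).re = dFun n f x (re x (s x)).1 := by simp
  have h4 : ((dFun n f x (re x (s x)).1 : ℂ)
      + (dFun n f x (im x (s x)).1 : ℂ) * Complex.I).im = dFun n f x (im x (s x)).1 := by simp
  refine gtc_ext ?_ ?_
  · rw [map_add, re_ofReal_smul, re_smul, h3, h4, re_courantC, re_courantC]
    simp_rw [re_ofReal_smul, im_ofReal_smul]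
    rw [courant_smul_right hf hs.1 ht.1, courant_smul_right hf hs.2 ht.2, h1]
    module
  · rw [map_add, im_ofReal_smul, im_smul, h3, h4, im_courantC, im_courantC]
    simp_rw [re_ofReal_smul, im_ofReal_smul]
    rw [courant_smul_right hf hs.1 ht.2, courant_smul_right hf hs.2 ht.1, h2]
    module

theorem courant_zero_left [T2Space M] {s : ∀ x : M, GT n x} (hs : Smooth s) (x : M) :
    courant (fun _ => 0) s x = 0 := by
  have h := courant_add_left hs Smooth.zero Smooth.zero x
  simp_rw [add_zero] at h
  exact left_eq_add.1 h

end Sections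

/-! ### Smooth sections of `L_±` and `H_±`, and involutivity of the reduction -/

namespace GenAlmostContact

variable [IsManifold (𝓡 (2 * n + 1)) ∞ M] {S : GenAlmostContact n M}

/-- Bracketing with a real section of `T𝓡` separates real and imaginary parts, so complex invariance
is real invariance of both. -/
theorem mem_invSectionsC_iff [T2Space M] {s : ∀ x : M, GTC n x} : s ∈ S.invSectionsC ↔
    (fun x => re x (s x)) ∈ S.invSections ∧ (fun x => im x (s x)) ∈ S.invSections := by
  refine ⟨fun h => ?_, fun h => ?_⟩
  · have key : ∀ r : ∀ x : M, GT n x, Smooth r → (∀ x, r x ∈ S.TR x) → ∀ x,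
        courant r (fun y => re y (s y)) x ∈ S.TR x ∧ courant r (fun y => im y (s y)) x ∈ S.TR x := by
      intro r hr hrT x
      have h1 := S.mem_TRC.1 (h.2.2 _ (SmoothC.toC hr) (fun y => S.mem_TRC.2 (by
        rw [re_toC, im_toC]; exact ⟨hrT y, zero_mem _⟩)) x)
      rw [re_courantC, im_courantC] at h1
      simp_rw [re_toC, im_toC] at h1
      rw [courant_zero_left h.1.1, courant_zero_left h.1.2, sub_zero, add_zero] at h1
      exact h1
    exact ⟨⟨h.1.1, fun x => (S.mem_TRperpC.1 (h.2.1 x)).1, fun r hr hrT x => (key r hr hrT x).1⟩,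
      ⟨h.1.2, fun x => (S.mem_TRperpC.1 (h.2.1 x)).2, fun r hr hrT x => (key r hr hrT x).2⟩⟩
  · refine ⟨⟨h.1.1, h.2.1⟩, fun x => S.mem_TRperpC.2 ⟨h.1.2.1 x, h.2.2.1 x⟩, fun r hr hrT x => ?_⟩
    have hre := fun y => (S.mem_TRC.1 (hrT y)).1
    have him := fun y => (S.mem_TRC.1 (hrT y)).2
    rw [mem_TRC, re_courantC, im_courantC]
    exact ⟨sub_mem (h.1.2.2 _ hr.1 hre x) (h.2.2.2 _ hr.2 him x),
      add_mem (h.2.2.2 _ hr.1 hre x) (h.1.2.2 _ hr.2 him x)⟩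

theorem courantC_mem_invSectionsC [T2Space M] {s t : ∀ x : M, GTC n x} (hs : s ∈ S.invSectionsC)
    (ht : t ∈ S.invSectionsC) : courantC s t ∈ S.invSectionsC := by
  rw [mem_invSectionsC_iff] at hs ht ⊢
  simp_rw [re_courantC, im_courantC]
  exact ⟨invSections_sub (courant_mem_invSections hs.1 ht.1) (courant_mem_invSections hs.2 ht.2),
    invSections_add (courant_mem_invSections hs.1 ht.2) (courant_mem_invSections hs.2 ht.1)⟩

theorem mem_invSectionsC_of_TRC [T2Space M] {r : ∀ x : M, GTC n x} (hr : SmoothC r)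
    (hrT : ∀ x, r x ∈ S.TRC x) : r ∈ S.invSectionsC :=
  mem_invSectionsC_iff.2 ⟨S.mem_invSections_of_TR hr.1 fun x => (S.mem_TRC.1 (hrT x)).1,
    S.mem_invSections_of_TR hr.2 fun x => (S.mem_TRC.1 (hrT x)).2⟩

theorem pairingC_H_sup_TRC {ε : Sgn} {x : M} {z w : GTC n x} (hz : z ∈ S.H ε x ⊔ S.TRC x)
    (hw : w ∈ S.H ε x ⊔ S.TRC x) : pairingC x z w = 0 := by
  rw [← orthogonal_H_sup_TRC] at hw
  exact hw z hz

theorem pairingC_L {ε : Sgn} {x : M} {z w : GTC n x} (hz : z ∈ S.L ε x)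
    (hw : w ∈ S.L ε x) : pairingC x z w = 0 := S.isotropic_L ε x hw z hz

theorem pairingC_TRC {x : M} {z w : GTC n x} (hz : z ∈ S.TRC x)
    (hw : w ∈ S.TRperpC x) : pairingC x z w = 0 := by
  rw [← orthogonal_TRC] at hw
  exact hw z hz

variable (S) in
theorem smooth_perpProj {s : ∀ x : M, GT n x} (hs : Smooth s) :
    Smooth (fun x => S.perpProj x (s x)) :=
  hs.sub (Smooth.smul (SmoothFun.const 2) ((Smooth.smul ((S.smooth_E _).pairing hs)
    (S.smooth_E _)).add (Smooth.smul ((S.smooth_E _).pairing hs) (S.smooth_E _))))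

theorem exists_smooth_L [T2Space M] {ε : Sgn} {x : M} {z : GTC n x} (hz : z ∈ S.L ε x) :
    ∃ s : ∀ y : M, GTC n y, SmoothC s ∧ (∀ y, s y ∈ S.L ε y) ∧ s x = z := by
  -- The values at `x` of smooth sections of `L` form a complex subspace, so only generators need
  -- extending. For `e - iΦe`, extend `e` arbitrarily and project to the orthogonal of `E_±` at
  -- every point.
  let P : Submodule ℂ (GTC n x) :=
    { carrier := {z | ∃ s : ∀ y : M, GTC n y, SmoothC s ∧ (∀ y, s y ∈ S.L ε y) ∧ s x = z}
      zero_mem' := ⟨_, SmoothC.zero, fun _ => zero_mem _, rfl⟩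
      add_mem' := by
        rintro _ _ ⟨s, hs, hsL, rfl⟩ ⟨t, ht, htL, rfl⟩
        exact ⟨_, hs.add ht, fun y => add_mem (hsL y) (htL y), rfl⟩
      smul_mem' := by
        rintro c _ ⟨s, hs, hsL, rfl⟩
        exact ⟨_, SmoothC.smul (SmoothFunC.const c) hs,
          fun y => Submodule.smul_mem _ _ (hsL y), rfl⟩ }
  suffices S.L ε x ≤ P from this hz
  refine sup_le ?_ ?_
  · rw [Submodule.span_singleton_le_iff_mem]
    exact ⟨_, SmoothC.toC (S.smooth_E ε), S.E_mem_L ε, rfl⟩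
  · rw [E10, Submodule.span_le]
    rintro _ ⟨e, he, rfl⟩
    obtain ⟨s, hs, rfl⟩ := exists_smooth_eq e
    have h1 := S.smooth_perpProj hs
    refine ⟨fun y => toC y (S.perpProj y (s y))
        + (-Complex.I) • toC y (S.Φ y (S.perpProj y (s y))),
      (SmoothC.toC h1).add (SmoothC.smul (SmoothFunC.const _) (SmoothC.toC (S.smooth_Φ _ h1))),
      fun y => ?_, ?_⟩
    · dsimp only
      rw [neg_smul, ← sub_eq_add_neg]
      exact S.sub_mem_L ε (S.pairing_perpProj y (s y))
    · dsimp only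
      rw [S.perpProj_eq_self he, neg_smul, ← sub_eq_add_neg]

theorem exists_pairingC_ne_zero {ε : Sgn} {x : M} (h : toC x (S.Rsec x) ∉ S.L ε x) :
    ∃ l ∈ S.L ε x, pairingC x l (toC x (S.Rsec x)) ≠ 0 := by
  by_contra! h1
  apply h
  rw [← orthogonal_L]
  exact h1

theorem TRC_le_L {ε : Sgn} {x : M} (h : toC x (S.Rsec x) ∈ S.L ε x) : S.TRC x ≤ S.L ε x := by
  rw [TRC_eq_span, Submodule.span_singleton_le_iff_mem]
  exact h

theorem L_le_TRperpC {ε : Sgn} {x : M} (h : toC x (S.Rsec x) ∈ S.L ε x) :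
    S.L ε x ≤ S.TRperpC x := fun _ hl => S.mem_TRperpC_iff_pairingC.2 (pairingC_L hl h)

/-- Locally, sections of `H_± + T𝓡 ⊗ ℂ` can be corrected by sections of `T𝓡 ⊗ ℂ` to sections
of `L_±`, up to multiplication by a function. -/
theorem exists_correction [T2Space M] {ε : Sgn} {x : M}
    (hx : ∀ᶠ y in 𝓝 x, (toC y (S.Rsec y) ∈ S.L ε y ↔ toC x (S.Rsec x) ∈ S.L ε x)) :
    ∃ ρ : M → ℝ, SmoothFun n ρ ∧ ρ x ≠ 0 ∧ ∀ s : ∀ y : M, GTC n y, SmoothC s →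
      (∀ y, s y ∈ S.H ε y ⊔ S.TRC y) → ∃ r : ∀ y : M, GTC n y, SmoothC r ∧
        (∀ y, r y ∈ S.TRC y) ∧ ∀ y, (ρ y : ℂ) • s y + r y ∈ S.L ε y := by
  by_cases hR : toC x (S.Rsec x) ∈ S.L ε x
  · obtain ⟨f, hf, hf1, hfs⟩ := exists_smooth_bump (n := n) x hx
    refine ⟨f, hf, by rw [hf1.eq_of_nhds]; exact one_ne_zero, fun s _ hsH =>
      ⟨_, SmoothC.zero, fun _ => zero_mem _, fun y => ?_⟩⟩
    rw [add_zero]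
    by_cases hy : f y = 0
    · rw [hy, Complex.ofReal_zero, zero_smul]
      exact zero_mem _
    · have h1 : toC y (S.Rsec y) ∈ S.L ε y :=
        (hfs (subset_tsupport f hy)).2 hR
      exact Submodule.smul_mem _ _ (sup_le inf_le_left (TRC_le_L h1) (hsH y))
  · obtain ⟨l, hl, hlR⟩ := exists_pairingC_ne_zero hR
    obtain ⟨l, hls, hlL, rfl⟩ := exists_smooth_L hl
    have hRs := SmoothC.toC S.smooth_Rsec
    have hg := hls.pairingC hRs
    -- If `s = h + cR` with `h ∈ H`, then `⟨l, s⟩ = c ⟨l, R⟩`. Division by `⟨l, R⟩` is replaced by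
    -- multiplication with its conjugate: `ρ = |⟨l, R⟩|²` is real and globally smooth, and `ρ s + r
    -- = ρ h` even where `⟨l, R⟩` vanishes.
    refine ⟨fun y => Complex.normSq (pairingC y (l y) (toC y (S.Rsec y))), ?_,
      (Complex.normSq_pos.2 hlR).ne', fun s hs hsH => ⟨fun y =>
        (-(starRingEnd ℂ (pairingC y (l y) (toC y (S.Rsec y))) * pairingC y (l y) (s y)))
          • toC y (S.Rsec y), SmoothC.smul (hg.star.mul (hls.pairingC hs)).neg hRs, fun y => ?_,
        fun y => ?_⟩⟩
    · simp_rw [Complex.normSq_apply]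
      exact (hg.1.mul hg.1).add (hg.2.mul hg.2)
    · rw [TRC_eq_span]
      exact Submodule.smul_mem _ _ (Submodule.mem_span_singleton_self _)
    · obtain ⟨h, hh, r, hr, hsy⟩ := Submodule.mem_sup.1 (hsH y)
      rw [TRC_eq_span] at hr
      obtain ⟨c, rfl⟩ := Submodule.mem_span_singleton.1 hr
      have h1 : pairingC y (l y) (s y) = c * pairingC y (l y) (toC y (S.Rsec y)) := by
        rw [← hsy, map_add, pairingC_L (hlL y) hh.1, zero_add, map_smul, smul_eq_mul]
      have h2 : (Complex.normSq (pairingC y (l y) (toC y (S.Rsec y))) : ℂ) • s y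
          + (-(starRingEnd ℂ (pairingC y (l y) (toC y (S.Rsec y))) * pairingC y (l y) (s y)))
            • toC y (S.Rsec y) =
          (Complex.normSq (pairingC y (l y) (toC y (S.Rsec y))) : ℂ) • h := by
        rw [h1, ← hsy, Complex.normSq_eq_conj_mul_self]
        module
      rw [h2]
      exact Submodule.smul_mem _ _ hh.1

/-- Correct `s` and `t` to global sections `ρs + r`, `ρt + r'` of `L`, whose bracket lies in `L`.
Modulo `L + T𝓡 ⊗ ℂ` the brackets involving `r`, `r'` vanish by invariance, and the derivatives of
`ρ` only produce multiples of `s` and `t`, so `ρ(x)² [s, t]` is all that remains. -/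
theorem courantC_mem_H_sup_TRC [T2Space M] {ε : Sgn} (hL : CourantInvolutive (S.L ε)) {x : M}
    (hx : ∀ᶠ y in 𝓝 x, (toC y (S.Rsec y) ∈ S.L ε y ↔ toC x (S.Rsec x) ∈ S.L ε x))
    {s t : ∀ x : M, GTC n x} (hs : s ∈ S.invSectionsC) (ht : t ∈ S.invSectionsC)
    (hsH : ∀ y, s y ∈ S.H ε y ⊔ S.TRC y) (htH : ∀ y, t y ∈ S.H ε y ⊔ S.TRC y) :
    courantC s t x ∈ S.H ε x ⊔ S.TRC x := by
  obtain ⟨ρ, hρ, hρx, hcor⟩ := exists_correction hx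
  obtain ⟨r, hr, hrT, hrL⟩ := hcor s hs.1 hsH
  obtain ⟨r', hr', hrT', hrL'⟩ := hcor t ht.1 htH
  have hρC := SmoothFunC.ofReal hρ
  have hρs := SmoothC.smul hρC hs.1
  have hρt := SmoothC.smul hρC ht.1
  have hle : S.H ε x ⊔ S.TRC x ≤ S.L ε x ⊔ S.TRC x := sup_le_sup_right inf_le_left _
  have hTle : S.TRC x ≤ S.L ε x ⊔ S.TRC x := le_sup_right
  have h0 := hL _ _ (hρs.add hr) (hρt.add hr') hrL hrL' x
  have hst : pairingC x (s x) (t x) = 0 := pairingC_H_sup_TRC (hsH x) (htH x)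
  have hts : pairingC x (t x) (s x) = 0 := pairingC_H_sup_TRC (htH x) (hsH x)
  have h1 : courantC r (fun y => (ρ y : ℂ) • t y) x ∈ S.L ε x ⊔ S.TRC x := by
    rw [courantC_smul_right hρ hr ht.1 x (pairingC_TRC (hrT x) (ht.2.1 x))]
    exact add_mem (Submodule.smul_mem _ _ (hTle (ht.2.2 r hr hrT x)))
      (Submodule.smul_mem _ _ (hle (htH x)))
  have h2 : courantC r' (fun y => (ρ y : ℂ) • s y) x ∈ S.L ε x ⊔ S.TRC x := by
    rw [courantC_smul_right hρ hr' hs.1 x (pairingC_TRC (hrT' x) (hs.2.1 x))]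
    exact add_mem (Submodule.smul_mem _ _ (hTle (hs.2.2 r' hr' hrT' x)))
      (Submodule.smul_mem _ _ (hle (hsH x)))
  have h3 : courantC r r' x ∈ S.L ε x ⊔ S.TRC x :=
    hTle ((mem_invSectionsC_of_TRC hr' hrT').2.2 r hr hrT x)
  rw [courantC_add_left (hρt.add hr') hρs hr, courantC_add_right hρs hρt hr',
    courantC_add_right hr hρt hr', courantC_skew hρs hr'] at h0
  have h4 : courantC (fun y => (ρ y : ℂ) • s y) (fun y => (ρ y : ℂ) • t y) x
      ∈ S.L ε x ⊔ S.TRC x := by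
    have h5 := sub_mem (add_mem (Submodule.mem_sup_left h0) h2) (add_mem h1 h3)
    convert h5 using 1
    abel
  have hρst : pairingC x ((ρ x : ℂ) • s x) (t x) = 0 := by
    rw [map_smul, LinearMap.smul_apply, hst, smul_zero]
  rw [courantC_smul_right hρ hρs ht.1 x hρst, courantC_skew hρs ht.1,
    courantC_smul_right hρ ht.1 hs.1 x hts, courantC_skew ht.1 hs.1] at h4
  have h6 := sub_mem h4 (Submodule.smul_mem _ ((dFun n ρ x (re x ((ρ x : ℂ) • s x)).1 : ℂ)
    + (dFun n ρ x (im x ((ρ x : ℂ) • s x)).1 : ℂ) * Complex.I) (hle (htH x)))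
  have h7 := add_mem h6 (Submodule.smul_mem _ ((ρ x : ℂ) * ((dFun n ρ x (re x (t x)).1 : ℂ)
    + (dFun n ρ x (im x (t x)).1 : ℂ) * Complex.I)) (hle (hsH x)))
  have h8 : ((ρ x : ℂ) * (ρ x : ℂ)) • courantC s t x ∈ S.L ε x ⊔ S.TRC x := by
    convert h7 using 1
    module
  have hne : (ρ x : ℂ) * (ρ x : ℂ) ≠ 0 :=
    mul_ne_zero (Complex.ofReal_ne_zero.2 hρx) (Complex.ofReal_ne_zero.2 hρx)
  rw [Submodule.smul_mem_iff _ hne] at h8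
  -- Invariance of the bracket supplies its orthogonality to `R`.
  rw [← L_sup_TRC_inf]
  exact ⟨h8, (courantC_mem_invSectionsC hs ht).2.1 x⟩

/-- Vectors of `H_±` extend, up to a common factor, to sections of `TM ⊕ ann(R)` lying in `H_±`
near the given point. -/
theorem exists_smooth_H [T2Space M] {ε : Sgn} {x : M}
    (hx : ∀ᶠ y in 𝓝 x, (toC y (S.Rsec y) ∈ S.L ε y ↔ toC x (S.Rsec x) ∈ S.L ε x)) :
    ∃ c : ℂ, c ≠ 0 ∧ ∀ a ∈ S.H ε x, ∃ s : ∀ y : M, GTC n y, SmoothC s ∧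
      (∀ y, s y ∈ S.TRperpC y) ∧ (∀ᶠ y in 𝓝 x, s y ∈ S.H ε y) ∧ s x = c • a := by
  by_cases hR : toC x (S.Rsec x) ∈ S.L ε x
  · refine ⟨1, one_ne_zero, fun a ha => ?_⟩
    obtain ⟨l, hl, hlL, rfl⟩ := exists_smooth_L ha.1
    -- Projecting forces the section into `TM ⊕ ann(R)` everywhere. Near `x` it changes nothing,
    -- since there `R ∈ L` and so `L ⊆ R^⊥`.
    have hproj : ∀ y, l y ∈ S.TRperpC y →
        toC y (S.proj y (re y (l y))) + Complex.I • toC y (S.proj y (im y (l y))) = l y := by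
      intro y hy
      rw [mem_TRperpC] at hy
      rw [proj_eq_self hy.1, proj_eq_self hy.2, toC_re_add_toC_im]
    refine ⟨_, SmoothC.mk (smooth_proj (S := S) hl.1) (smooth_proj (S := S) hl.2), fun y => ?_, ?_, ?_⟩
    · rw [mem_TRperpC, re_mk, im_mk]
      exact ⟨proj_mem _ _, proj_mem _ _⟩
    · filter_upwards [hx] with y hy
      have h1 := L_le_TRperpC (hy.2 hR) (hlL y)
      rw [hproj y h1]
      exact ⟨hlL y, h1⟩
    · rw [one_smul, hproj x ha.2]
  · obtain ⟨l₀, hl₀, hl₀R⟩ := exists_pairingC_ne_zero hR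
    obtain ⟨l₀, hl₀s, hl₀L, rfl⟩ := exists_smooth_L hl₀
    -- The witness is `⟨l₀, R⟩ l - ⟨l, R⟩ l₀`, a section of `L` orthogonal to `R`. At `x` the second
    -- term vanishes because `a ∈ H`, which leaves the factor `c = ⟨l₀, R⟩`.
    refine ⟨_, hl₀R, fun a ha => ?_⟩
    obtain ⟨l, hl, hlL, rfl⟩ := exists_smooth_L ha.1
    have hRs := SmoothC.toC S.smooth_Rsec
    have hH : ∀ y, pairingC y (l₀ y) (toC y (S.Rsec y)) • l y
        + (-pairingC y (l y) (toC y (S.Rsec y))) • l₀ y ∈ S.H ε y := by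
      intro y
      refine ⟨add_mem (Submodule.smul_mem _ _ (hlL y)) (Submodule.smul_mem _ _ (hl₀L y)), ?_⟩
      rw [SetLike.mem_coe, mem_TRperpC_iff_pairingC, map_add, map_smul, map_smul,
        LinearMap.add_apply, LinearMap.smul_apply, LinearMap.smul_apply, smul_eq_mul, smul_eq_mul]
      ring
    refine ⟨_, (SmoothC.smul (hl₀s.pairingC hRs) hl).add
      (SmoothC.smul (hl.pairingC hRs).neg hl₀s), fun y => (hH y).2, .of_forall hH, ?_⟩
    rw [S.mem_TRperpC_iff_pairingC.1 ha.2, neg_zero, zero_smul, add_zero]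

theorem exists_smooth_TRperpC [T2Space M] {x : M} {a : GTC n x} (ha : a ∈ S.TRperpC x) :
    ∃ s : ∀ y : M, GTC n y, SmoothC s ∧ (∀ y, s y ∈ S.TRperpC y) ∧ s x = a := by
  rw [mem_TRperpC] at ha
  obtain ⟨s, hs, hsp, hsx⟩ := exists_smooth_TRperp ha.1
  obtain ⟨t, ht, htp, htx⟩ := exists_smooth_TRperp ha.2
  refine ⟨_, SmoothC.mk hs ht, fun y => ?_, ?_⟩
  · rw [mem_TRperpC, re_mk, im_mk]
    exact ⟨hsp y, htp y⟩
  · rw [hsx, htx, toC_re_add_toC_im]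

theorem mem_TRC_of_pairingC {x : M} {a : GTC n x}
    (h : ∀ b ∈ S.TRperpC x, pairingC x a b = 0) : a ∈ S.TRC x := by
  rw [← LinearMap.BilinForm.orthogonal_orthogonal (pairingC_nondegenerate x) (pairingC_isRefl x)
    (S.TRC x), orthogonal_TRC]
  intro b hb
  change pairingC x b a = 0
  rw [pairingC_comm, h b hb]

theorem exists_dirac_frame [T2Space M] {ε : Sgn} {x : M}
    (hx : ∀ᶠ y in 𝓝 x, (toC y (S.Rsec y) ∈ S.L ε y ↔ toC x (S.Rsec x) ∈ S.L ε x)) :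
    ∃ s : Fin (2 * n) → ∀ y : M, GTC n y,
    (∀ i, SmoothC (s i) ∧ ∀ y, s i y ∈ S.TRperpC y) ∧
    ∀ᶠ y in 𝓝 x, LinearIndependent ℂ (fun i => (S.TRC y).mkQ (s i y)) ∧
      Submodule.span ℂ (range fun i => (S.TRC y).mkQ (s i y)) = S.diracFiber ε y := by
  obtain ⟨c, hc, hext⟩ := exists_smooth_H hx
  let b := Module.finBasisOfFinrankEq ℂ (S.diracFiber ε x) (S.finrank_diracFiber ε x)
  have hlift : ∀ i, ∃ a ∈ S.H ε x, (S.TRC x).mkQ a = b i := by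
    intro i
    obtain ⟨w, hw, hwb⟩ := (b i).2
    obtain ⟨a, ha, r, hr, rfl⟩ := Submodule.mem_sup.1 hw
    refine ⟨a, ha, ?_⟩
    have h0 : (S.TRC x).mkQ r = 0 := (Submodule.Quotient.mk_eq_zero _).2 hr
    rw [← hwb, map_add, h0, add_zero]
  choose a ha hab using hlift
  choose s hs hsp hsH hsx using fun i => hext (a i) (ha i)
  have hli : LinearIndependent ℂ (fun i => (S.TRC x).mkQ (s i x)) := by
    simp_rw [hsx, map_smul, hab]
    have h1 := b.linearIndependent.map' (S.diracFiber ε x).subtype (Submodule.ker_subtype _)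
    exact h1.units_smul fun _ => Units.mk0 c hc
  -- The dual vectors are sought in all of `(TM ⊕ ann(R)) ⊗ ℂ`, because the pairing vanishes on `H`
  -- itself.
  obtain ⟨d, hd, hsd⟩ := exists_dual_family (pairingC x)
    (fun _ _ => S.mem_TRC_of_pairingC) (fun i => hsp i x) hli
  choose t ht htp htx using fun i => exists_smooth_TRperpC (hd i)
  refine ⟨s, fun i => ⟨hs i, hsp i⟩, ?_⟩
  have hcont : Continuous fun y => (Matrix.of fun i j => pairingC y (s i y) (t j y)).det :=
    Continuous.matrix_det (continuous_matrix fun i j => ((hs i).pairingC (ht j)).continuous)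
  have hx : (Matrix.of fun i j => pairingC x (s i x) (t j x)).det ≠ 0 := by
    simp_rw [htx, hsd]
    have : (Matrix.of fun i j : Fin (2 * n) => if i = j then (1 : ℂ) else 0) = 1 := by
      ext i j
      simp [Matrix.one_apply]
    rw [this, Matrix.det_one]
    exact one_ne_zero
  filter_upwards [hcont.continuousAt.eventually_ne hx, eventually_all.2 hsH] with y hy hyH
  have hind : LinearIndependent ℂ (fun i => (S.TRC y).mkQ (s i y)) :=
    linearIndependent_mkQ_of_det_ne_zero (pairingC y)
      (fun r hr j => pairingC_TRC hr (htp j y)) hy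
  refine ⟨hind, Submodule.eq_of_le_of_finrank_eq ?_ ?_⟩
  · rw [Submodule.span_le]
    rintro _ ⟨i, rfl⟩
    exact ⟨_, Submodule.mem_sup_left (hyH i), rfl⟩
  · rw [finrank_span_eq_card hind, finrank_diracFiber, Fintype.card_fin]

theorem isTransverseDirac [T2Space M] {ε : Sgn} (hL : CourantInvolutive (S.L ε))
    (hR : ∀ x, ∀ᶠ y in 𝓝 x, (toC y (S.Rsec y) ∈ S.L ε y ↔ toC x (S.Rsec x) ∈ S.L ε x)) :
    S.IsTransverseDirac (S.diracFiber ε) where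
  le x := Submodule.map_mono (S.H_sup_TRC_le ε x)
  frame x := exists_dirac_frame (hR x)
  isotropic _ _ _ ha hb :=
    pairingC_H_sup_TRC (S.mkQ_mem_diracFiber.1 ha) (S.mkQ_mem_diracFiber.1 hb)
  involutive _ hs _ ht hsD htD := ⟨courantC_mem_invSectionsC hs ht, fun x =>
    S.mkQ_mem_diracFiber.2 (courantC_mem_H_sup_TRC hL (hR x) hs ht
      (fun y => S.mkQ_mem_diracFiber.1 (hsD y)) fun y => S.mkQ_mem_diracFiber.1 (htD y))⟩

end GenAlmostContact

end GenContact

end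

theorem theorem3p8 {n : ℕ} {M : Type*} [TopologicalSpace M] [T2Space M]
    [SecondCountableTopology M] [ChartedSpace (EuclideanSpace ℝ (Fin (2 * n + 1))) M]
    [IsManifold (𝓡 (2 * n + 1)) ∞ M] (S : GenContact.GenAlmostContact n M)
    (ε : GenContact.Sgn) (hL : GenContact.CourantInvolutive (S.L ε)) :
    Nonempty S.TransverseCourantAlgebroid ∧
    (∀ x, Module.finrank ℂ (S.diracFiber ε x) = 2 * n) ∧
    ((∀ x, ∀ᶠ y in 𝓝 x, (GenContact.toC y (S.R y, 0) ∈ S.L ε y ↔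
        GenContact.toC x (S.R x, 0) ∈ S.L ε x)) →
      S.IsTransverseDirac (S.diracFiber ε)) :=
  ⟨⟨S.transverseCourantAlgebroid⟩, S.finrank_diracFiber ε,
    GenContact.GenAlmostContact.isTransverseDirac hL⟩
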